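/- **Setting.** A finite family $E$ of *pseudo-lines* is a finite set of graphs of continuous functions $\mathbb R\to\mathbb R$, any two of which cross exactly once and have no other common point. It is ordered from bottom to top along a vertical line to the left of all crossings. The *lower envelope* $\mathcal L(E)$ is the pointwise minimum of $E$; combinatorially it is the left-to-right sequence of its maximal segments of positive length, each with its supporting pseudo-line and its endpoints (symbolic endpoints $\pm\infty$ for unbounded segments). *Model.* Programs work on linked cells with two pointers; the atoms are pseudo-lines, coordinates and counters. Each of the following takes unit time: accessing a variable or constant, allocating a cell, following a pointer, branching, binding a variable, calling a (possibly recursive) function, incrementing a counter, comparing two counters or two coordinates, comparing two pseudo-lines in the order above, computing the abscissa of the intersection of two pseudo-lines, and computing the ordinate of a pseudo-line at a given abscissa. *The tree $\Xi$ for $E$.* $\Xi$ is a height-balanced (AVL) binary search tree whose leaves hold the members of $E$ in increasing order ($\Xi$ is empty if $E=\emptyset$). For a node $v$, let $E(v)$ be the set of pseudo-lines in the leaves below $v$, and $\mathcal L(v)=\mathcal L(E(v))$. Each inner node $v$ stores its height, its two children, $\max E(v)$, and an *envelope tree* $\Lambda(v)$: an AVL tree whose leaves hold, from left to right, the segments of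 $\mathcal L(v)$ if $v$ is the root, and otherwise the segments of the part of $\mathcal L(v)$ that is not on the lower envelope of the parent of $v$ (the part to the right of the point where the envelopes of the two siblings meet if $v$ is a left child, to the left of it if $v$ is a right child). Each inner node of an envelope tree stores its height, the common point of the last segment in its left subtree and the first segment in its right subtree, and the two pseudo-lines that support these segments. **Lemma.** There are one fixed program and an absolute constant $C$ such that, with $n=|E|$ and $\lambda(n)=\lfloor\log_2(n+2)\rfloor$, the following hold for every finite family $E$ of pseudo-lines and every tree $\Xi$ for $E$. 1. (Insertion) If $e\notin E$ and $E\cup\{e\}$ is a family of pseudo-lines, then from $e$ and $\Xi$ a tree $\Xi$ for $E\cup\{e\}$ is computed in at most $C\lambda(n)^2$ steps, that is, in time $O(\log^2 n)$. 2. (Deletion) If $e\in E$, then from $e$ and $\Xi$ a tree $\Xi$ for $E\setminus\{e\}$ is computed in at most $C\lambda(n)^2$ steps, that is, in time $O(\log^2 n)$. 3. (Vertical ray shooting) For every $x_0\in\mathbb R$, the list, without repetition, of the pseudo-lines that support a segment of $\mathcal L(E)$ meeting the vertical line $x=x_0$ is computed from $x_0$ and $\Xi$ in at most $C\lambda(n)$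 steps, that is, in time $O(\log n)$. 4. (Envelope intersection) If $A\cup B$ is a family of pseudo-lines, $A$ and $B$ are nonempty, and every member of $A$ is smaller than every member of $B$, then the abscissa of the unique intersection point of $\mathcal L(A)$ and $\mathcal L(B)$ is computed from envelope trees that hold all segments of $\mathcal L(A)$ and of $\mathcal L(B)$ in at most $C\lambda(|A\cup B|)$ steps. 5. (Storage) $\Xi$ consists of at most $C(n+1)$ cells and atoms, that is, it uses $O(n)$ space. The empty tree is a tree $\Xi$ for $E=\emptyset$. -/

import Mathlib

open Filter

namespace Envelope

/-! ### Pseudo-lines and lower envelopes -/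

/-- An infinite `x`-monotone curve in the plane: the graph of a continuous function `ℝ → ℝ`. -/
abbrev Curve : Type := C(ℝ, ℝ)

/-- `f` and `g` meet exactly once, above the abscissa `q`, and `f` passes there from below `g`
to above `g`. -/
def CrossAt (f g : Curve) (q : ℝ) : Prop :=
  (∀ x, x < q → f x < g x) ∧ f q = g q ∧ (∀ x, q < x → g x < f x)

/-- A finite family of pseudo-lines: any two members cross exactly once (and have no other point
in common). -/
def IsPseudoLines (E : Set Curve) : Prop :=
  E.Finite ∧ ∀ f ∈ E, ∀ g ∈ E, f ≠ g → ∃ q, CrossAt f g q ∨ CrossAt g f q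

/-- The strict order of the pseudo-lines: `f` is below `g` on every vertical line that is
sufficiently far to the left. -/
def Below (f g : Curve) : Prop := ∀ᶠ x in atBot, f x < g x

/-- The lower envelope of `E`, the pointwise minimum (used for finite nonempty `E`). -/
noncomputable def lowerEnv (E : Set Curve) (x : ℝ) : ℝ := sInf ((fun e : Curve => e x) '' E)

/-- `q` is the abscissa of the intersection point of the lower envelopes of `A` and `B`, where the
envelope of `A` is the lower one on the left. -/
def MeetAt (A B : Set Curve) (q : ℝ) : Prop :=
  (∀ x, x < q → lowerEnv A x < lowerEnv B x) ∧ lowerEnv A q = lowerEnv B q ∧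
    (∀ x, q < x → lowerEnv B x < lowerEnv A x)

/-- A segment: the part of `line` between the abscissas `left` and `right`. The values `⊥` and `⊤`
are the symbolic endpoints at infinity of unbounded segments. -/
structure Seg where
  line : Curve
  left : EReal
  right : EReal

/-- `s` is the sequence, from left to right, of the maximal segments that make up the part of the
lower envelope of `E` between the abscissas `lo` and `hi`. -/
def IsEnvelope (E : Set Curve) (lo hi : EReal) (s : List Seg) : Prop :=
  (∀ σ ∈ s, σ.line ∈ E ∧ σ.left < σ.right ∧
      ∀ x : ℝ, σ.left ≤ (x : EReal) → (x : EReal) ≤ σ.right → σ.line x = lowerEnv E x) ∧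
    s.IsChain (fun σ τ => σ.right = τ.left ∧ σ.line ≠ τ.line) ∧
    s.head?.map Seg.left = some lo ∧ s.getLast?.map Seg.right = some hi

/-! ### The computational model

A first-order language over linked cells. A value is an atom or a cell with two pointers. There is
no way to create a pseudo-line, and numbers are created only by the primitive operations. -/

/-- Values. `nat` is a counter, `coord` a coordinate (or a symbolic coordinate at infinity). -/
inductive Val where
  | nil
  | nat (n : ℕ)
  | coord (x : EReal)
  | line (f : Curve)
  | cons (a b : Val)

/-- The number of cells and atoms of a value. -/
def Val.size : Val → ℕ
  | .cons a b => a.size + b.size + 1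
  | _ => 1

/-- The value of a truth value: only `nil` counts as false. -/
def Val.ofProp (p : Prop) [Decidable p] : Val := if p then .nat 0 else .nil

/-- Constants. -/
inductive Const where
  | nil | zero | negInf | posInf

noncomputable def Const.val : Const → Val
  | .nil => .nil
  | .zero => .nat 0
  | .negInf => .coord ⊥
  | .posInf => .coord ⊤

/-- Unary operations: the two pointers of a cell, and incrementing a counter. -/
inductive Op1 where
  | car | cdr | succ

def Op1.run : Op1 → Val → Option Val
  | .car, .cons a _ => some a
  | .cdr, .cons _ b => some b
  | .succ, .nat n => some (.nat (n + 1))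
  | _, _ => none

/-- Binary operations: `cons` allocates a cell, `le` compares two counters or two coordinates,
`below` compares two pseudo-lines in their order, `cross` gives the abscissa of the intersection
point of two pseudo-lines, and `height` gives the ordinate of the intersection point of a
pseudo-line with a vertical line. -/
inductive Op2 where
  | cons | le | below | cross | height

open Classical in
noncomputable def Op2.run : Op2 → Val → Val → Option Val
  | .cons, a, b => some (.cons a b)
  | .le, .nat m, .nat n => some (.ofProp (m ≤ n))
  | .le, .coord x, .coord y => some (.ofProp (x ≤ y))
  | .below, .line f, .line g => some (.ofProp (Below f g))
  | .cross, .line f, .line g =>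
      if h : ∃! x : ℝ, f x = g x then some (.coord (h.choose : EReal)) else none
  | .height, .line f, .coord x =>
      if x = ⊥ ∨ x = ⊤ then none else some (.coord (f x.toReal : EReal))
  | _, _, _ => none

/-- Expressions. `var i` is the `i`-th innermost local variable, `letIn a b` binds the value of `a`
to variable `0` in `b`, and `call k a` applies the `k`-th function of the program to the value of
`a`. -/
inductive Expr where
  | var (i : ℕ)
  | const (c : Const)
  | op1 (o : Op1) (a : Expr)
  | op2 (o : Op2) (a b : Expr)
  | ite (c a b : Expr)
  | letIn (a b : Expr)
  | call (k : ℕ) (a : Expr)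

/-- A program is a finite list of function bodies, which may call each other recursively. Each
body has one variable, the argument of the function. -/
abbrev Program : Type := List Expr

/-- `Runs P ρ a v t`: with the local variables `ρ`, the evaluation of `a` ends with the value `v`
after exactly `t` steps. Each access to a variable, constant, operation, branching, binding and
function call is one step. -/
inductive Runs (P : Program) : List Val → Expr → Val → ℕ → Prop where
  | var {ρ : List Val} {i : ℕ} {v : Val} :
      ρ[i]? = some v → Runs P ρ (.var i) v 1
  | const {ρ : List Val} {c : Const} :
      Runs P ρ (.const c) c.val 1
  | op1 {ρ : List Val} {o : Op1} {a : Expr} {v w : Val} {t : ℕ} :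
      Runs P ρ a v t → o.run v = some w → Runs P ρ (.op1 o a) w (t + 1)
  | op2 {ρ : List Val} {o : Op2} {a b : Expr} {u v w : Val} {s t : ℕ} :
      Runs P ρ a u s → Runs P ρ b v t → o.run u v = some w →
      Runs P ρ (.op2 o a b) w (s + t + 1)
  | iteTrue {ρ : List Val} {c a b : Expr} {v w : Val} {s t : ℕ} :
      Runs P ρ c v s → v ≠ .nil → Runs P ρ a w t → Runs P ρ (.ite c a b) w (s + t + 1)
  | iteFalse {ρ : List Val} {c a b : Expr} {w : Val} {s t : ℕ} :
      Runs P ρ c .nil s → Runs P ρ b w t → Runs P ρ (.ite c a b) w (s + t + 1)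
  | letIn {ρ : List Val} {a b : Expr} {v w : Val} {s t : ℕ} :
      Runs P ρ a v s → Runs P (v :: ρ) b w t → Runs P ρ (.letIn a b) w (s + t + 1)
  | call {ρ : List Val} {k : ℕ} {a body : Expr} {v w : Val} {s t : ℕ} :
      Runs P ρ a v s → P[k]? = some body → Runs P [v] body w t →
      Runs P ρ (.call k a) w (s + t + 1)

/-- The `k`-th function of `P`, applied to `input`, ends with `output` after at most `bound`
steps. -/
def RunsWithin (P : Program) (k : ℕ) (input output : Val) (bound : ℕ) : Prop :=
  ∃ body t, P[k]? = some body ∧ Runs P [input] body output t ∧ t ≤ bound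

/-! ### Envelope trees -/

/-- The binary search trees `Λ`: the leaves hold segments; an inner node holds its height `h`, the
abscissa `p` of the common point of the last segment of the left subtree and the first segment of
the right subtree, and the two pseudo-lines `a`, `b` that support these segments. -/
inductive EnvTree where
  | leaf (s : Seg)
  | node (h : ℕ) (p : ℝ) (a b : Curve) (l r : EnvTree)

namespace EnvTree

/-- The segments in the leaves, from left to right. -/
def segs : EnvTree → List Seg
  | leaf s => [s]
  | node _ _ _ _ l r => l.segs ++ r.segs

def height : EnvTree → ℕ
  | leaf _ => 0
  | node _ _ _ _ l r => max l.height r.height + 1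

/-- The tree is height-balanced and the data in its inner nodes are as described. -/
def Valid : EnvTree → Prop
  | leaf _ => True
  | node h p a b l r =>
      l.Valid ∧ r.Valid ∧ h = max l.height r.height + 1 ∧
      l.height ≤ r.height + 1 ∧ r.height ≤ l.height + 1 ∧
      ∃ σ τ : Seg, l.segs.getLast? = some σ ∧ r.segs.head? = some τ ∧
        σ.right = (p : EReal) ∧ τ.left = (p : EReal) ∧ σ.line = a ∧ τ.line = b

/-- The representation in linked cells. -/
def toVal : EnvTree → Val
  | leaf s => .cons .nil (.cons (.line s.line) (.cons (.coord s.left) (.coord s.right)))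
  | node h p a b l r =>
      .cons (.nat h) (.cons (.coord (p : EReal)) (.cons (.cons (.line a) (.line b))
        (.cons l.toVal r.toVal)))

/-- A balanced tree that stores the part of the lower envelope of `E` between `lo` and `hi`. -/
def Stores (T : EnvTree) (E : Set Curve) (lo hi : EReal) : Prop :=
  T.Valid ∧ IsEnvelope E lo hi T.segs

end EnvTree

/-! ### The structure `Ξ` -/

/-- The nonempty trees `Ξ`: a leaf holds a pseudo-line; an inner node holds its height `h`, the
maximum `m` of the pseudo-lines in its subtree, the envelope tree `env` (its tree `Λ`)
and its two children. -/
inductive XiTree where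
  | leaf (e : Curve)
  | node (h : ℕ) (m : Curve) (env : EnvTree) (l r : XiTree)

namespace XiTree

/-- The pseudo-lines in the leaves, from left to right. -/
def lines : XiTree → List Curve
  | leaf e => [e]
  | node _ _ _ l r => l.lines ++ r.lines

/-- The set of the pseudo-lines in the leaves. -/
def family (t : XiTree) : Set Curve := {e | e ∈ t.lines}

def height : XiTree → ℕ
  | leaf _ => 0
  | node _ _ _ l r => max l.height r.height + 1

/-- The tree is height-balanced and the data in its inner nodes are correct, where the envelope
tree of the root holds the part between `lo` and `hi` of the lower envelope of the whole family.
If the envelopes of the two children of a node meet at `q`, then the part of the left (right)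
envelope that is not on the envelope of the node is the one to the right (left) of `q`. -/
def Correct : XiTree → EReal → EReal → Prop
  | leaf _, _, _ => True
  | node h m env l r, lo, hi =>
      h = max l.height r.height + 1 ∧
      l.height ≤ r.height + 1 ∧ r.height ≤ l.height + 1 ∧
      r.lines.getLast? = some m ∧
      env.Stores (l.family ∪ r.family) lo hi ∧
      ∃ q : ℝ, MeetAt l.family r.family q ∧ l.Correct (q : EReal) ⊤ ∧ r.Correct ⊥ (q : EReal)

def toVal : XiTree → Val
  | leaf e => .cons .nil (.line e)
  | node h m env l r =>
      .cons (.nat h) (.cons (.line m) (.cons env.toVal (.cons l.toVal r.toVal)))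

end XiTree

/-- The structure `Ξ`; `none` is the structure for the empty family. -/
abbrev Xi : Type := Option XiTree

/-- `t` is a structure `Ξ` for the family `E`: its leaves hold the members of `E` in increasing
order, its inner nodes hold the correct data, and its root holds the whole lower envelope. -/
def Xi.Represents : Xi → Set Curve → Prop
  | none, E => E = ∅
  | some t, E => t.lines.Pairwise Below ∧ t.family = E ∧ t.Correct ⊥ ⊤

/-- The representation in linked cells. -/
def Xi.toVal : Xi → Val
  | none => .nil
  | some t => t.toVal

/-- A list of pseudo-lines in linked cells. -/
def linesVal : List Curve → Val
  | [] => .nil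
  | e :: es => .cons (.line e) (linesVal es)

/-- `e` supports a segment of the lower envelope of `E` that meets the vertical line at `x₀`. -/
def HitAt (E : Set Curve) (x₀ : ℝ) (e : Curve) : Prop :=
  ∃ s, IsEnvelope E ⊥ ⊤ s ∧
    ∃ σ ∈ s, σ.line = e ∧ σ.left ≤ (x₀ : EReal) ∧ (x₀ : EReal) ≤ σ.right

end Envelope

/-! This is the Overmars–van Leeuwen scheme. At a node the lower family `A` (left child) and the
upper family `B` (right child) have envelopes that meet at exactly one abscissa `q`: once the
envelope of `B` reaches that of `A`, single crossings keep it strictly below (`Separated.lt_of_le`).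
The envelope of the node is therefore the part of `A` left of `q` followed by the part of `B` right
of `q`. Going up (`exists_up`), `q` is found, both envelopes are split there, and the outer parts
are joined. Going down (`exists_down`), `q` is recovered from the root envelope as the vertex where
the pseudo-lines exceed the largest one of the left child, and the two parts are glued back to what
the children kept. AVL insertion, deletion and rotations in `Ξ` use a bounded number of such steps
per level, each of cost `O(log n)` by AVL split and join.

The core is finding `q` in `O(log n)` time (`Searching.runs_aux`). A comparison at one vertex of
each tree may be inconclusive. In that case a tentative move is made: right in the tree of `A`, left
in the tree of `B`, with the rejected subtree kept on a stack. A later test undoes a wrong move. The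
tentative bound of `A` never exceeds that of `B`, so the two searches cannot both be wrong. While
one of them strays the other one, served alternately, makes real progress. A potential that freezes
below a wrong move turns this into a bound linear in the heights.

Storage is linear because each node adds only two segments to the total: the cut at `q` splits at
most one segment on either side (`weight_le`).

Program correctness is handled by a weakest precondition `wp` that reduces definitionally, so that
proofs about a function list its comparisons and calls in order of execution. -/

namespace Envelope

/-! ### The program -/

/-- The first pointer of a cell. -/
def fst (a : Expr) : Expr := .op1 .car a

/-- The second pointer of a cell. -/
def snd (a : Expr) : Expr := .op1 .cdr a

/-- The body of an inner node of an envelope tree: abscissa, pair of pseudo-lines, children. -/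
def bodyE (p ab l r : Expr) : Expr := .op2 .cons p (.op2 .cons ab (.op2 .cons l r))

/-- The height of a tree of either kind. -/
def htCode : Expr :=
  .ite (fst (.var 0))
  (fst (.var 0))
  (.const .zero)

/-- Completes the body of an inner node of an envelope tree by its height. -/
def mkCode : Expr :=
  .letIn (.call 0 (fst (snd (snd (.var 0))))) <|
  .letIn (.call 0 (snd (snd (snd (.var 1))))) <|
  .op2 .cons (.op1 .succ (.ite (.op2 .le (.var 1) (.var 0))
      (.var 0)
      (.var 1))) (.var 2)

/-- Builds a balanced node from two envelope trees whose heights differ by at most two. -/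
def balCode : Expr :=
  .letIn (fst (snd (snd (.var 0)))) <|
  .letIn (snd (snd (snd (.var 1)))) <|
  .letIn (.call 0 (.var 1)) <|
  .letIn (.call 0 (.var 1)) <|
  .ite (.op2 .le (.var 1) (.op1 .succ (.var 0)))
  (.ite (.op2 .le (.var 0) (.op1 .succ (.var 1)))
    (.call 1 (.var 4))
    (.letIn (snd (.var 2)) <|
      .ite (.op2 .le (.call 0 (fst (snd (snd (.var 0))))) (.call 0 (snd (snd (snd (.var 0))))))
      (.call 1 (bodyE (fst (.var 0)) (fst (snd (.var 0))) (.call 1 (bodyE (fst (.var 5)) (fst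
          (snd (.var 5))) (.var 4) (fst (snd (snd (.var 0)))))) (snd (snd (snd (.var 0))))))
      (.letIn (snd (fst (snd (snd (.var 0))))) <|
        .call 1 (bodyE (fst (.var 0)) (fst (snd (.var 0))) (.call 1 (bodyE (fst (.var 6)) (fst
            (snd (.var 6))) (.var 5) (fst (snd (snd (.var 0)))))) (.call 1 (bodyE (fst (.var 1))
                (fst (snd (.var 1))) (snd (snd (snd (.var 0)))) (snd (snd (snd (.var 1))))))))))
  (.letIn (snd (.var 3)) <|
    .ite (.op2 .le (.call 0 (snd (snd (snd (.var 0))))) (.call 0 (fst (snd (snd (.var 0))))))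
    (.call 1 (bodyE (fst (.var 0)) (fst (snd (.var 0))) (fst (snd (snd (.var 0)))) (.call 1
        (bodyE (fst (.var 5)) (fst (snd (.var 5))) (snd (snd (snd (.var 0)))) (.var 3)))))
    (.letIn (snd (snd (snd (snd (.var 0))))) <|
      .call 1 (bodyE (fst (.var 0)) (fst (snd (.var 0))) (.call 1 (bodyE (fst (.var 1)) (fst (snd
          (.var 1))) (fst (snd (snd (.var 1)))) (fst (snd (snd (.var 0)))))) (.call 1 (bodyE (fst
              (.var 6)) (fst (snd (.var 6))) (snd (snd (snd (.var 0)))) (.var 4))))))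

/-- Joins two envelope trees of arbitrary heights. -/
def joinCode : Expr :=
  .letIn (fst (snd (snd (.var 0)))) <|
  .letIn (snd (snd (snd (.var 1)))) <|
  .letIn (.call 0 (.var 1)) <|
  .letIn (.call 0 (.var 1)) <|
  .ite (.op2 .le (.var 1) (.op1 .succ (.var 0)))
  (.ite (.op2 .le (.var 0) (.op1 .succ (.var 1)))
    (.call 1 (.var 4))
    (.letIn (snd (.var 2)) <|
      .call 2 (bodyE (fst (.var 0)) (fst (snd (.var 0))) (.call 3 (bodyE (fst (.var 5)) (fst (snd
          (.var 5))) (.var 4) (fst (snd (snd (.var 0)))))) (snd (snd (snd (.var 0)))))))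
  (.letIn (snd (.var 3)) <|
    .call 2 (bodyE (fst (.var 0)) (fst (snd (.var 0))) (fst (snd (snd (.var 0)))) (.call 3 (bodyE
        (fst (.var 5)) (fst (snd (.var 5))) (snd (snd (snd (.var 0)))) (.var 3)))))

/-- The first segment of an envelope tree. -/
def firstCode : Expr :=
  .ite (fst (.var 0))
  (.call 4 (fst (snd (snd (snd (.var 0))))))
  (snd (.var 0))

/-- The last segment of an envelope tree. -/
def lastCode : Expr :=
  .ite (fst (.var 0))
  (.call 5 (snd (snd (snd (snd (.var 0))))))
  (snd (.var 0))

/-- Splits an envelope tree at an abscissa. -/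
def splitCode : Expr :=
  .letIn (fst (.var 0)) <|
  .letIn (snd (.var 1)) <|
  .letIn (snd (.var 1)) <|
  .ite (fst (.var 2))
  (.ite (.op2 .le (fst (.var 0)) (.var 1))
    (.ite (.op2 .le (.var 1) (fst (.var 0)))
      (.op2 .cons (fst (snd (snd (.var 0)))) (snd (snd (snd (.var 0)))))
      (.letIn (.call 6 (.op2 .cons (snd (snd (snd (.var 0)))) (.var 1))) <|
        .op2 .cons (.call 3 (bodyE (fst (.var 1)) (fst (snd (.var 1))) (fst (snd (snd (.var 1))))
            (fst (.var 0)))) (snd (.var 0))))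
    (.letIn (.call 6 (.op2 .cons (fst (snd (snd (.var 0)))) (.var 1))) <|
      .op2 .cons (fst (.var 0)) (.call 3 (bodyE (fst (.var 1)) (fst (snd (.var 1))) (snd
          (.var 0)) (snd (snd (snd (.var 1))))))))
  (.op2 .cons (.op2 .cons (.const .nil) (.op2 .cons (fst (.var 0)) (.op2 .cons (fst (snd
      (.var 0))) (.var 1)))) (.op2 .cons (.const .nil) (.op2 .cons (fst (.var 0)) (.op2 .cons
          (.var 1) (snd (snd (.var 0)))))))

/-- Replaces the left endpoint of the first segment. -/
def setFirstCode : Expr :=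
  .letIn (fst (.var 0)) <|
  .letIn (snd (.var 0)) <|
  .ite (fst (.var 1))
  (.op2 .cons (fst (.var 1)) (bodyE (fst (.var 0)) (fst (snd (.var 0))) (.call 7 (.op2 .cons (fst
      (snd (snd (.var 0)))) (snd (.var 2)))) (snd (snd (snd (.var 0))))))
  (.op2 .cons (.const .nil) (.op2 .cons (fst (.var 0)) (.op2 .cons (snd (.var 2)) (snd (snd
      (.var 0))))))

/-- Removes the last segment of an envelope tree that has at least two. -/
def popLastCode : Expr :=
  .letIn (snd (.var 0)) <|
  .ite (fst (snd (snd (snd (.var 0)))))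
  (.call 2 (bodyE (fst (.var 0)) (fst (snd (.var 0))) (fst (snd (snd (.var 0)))) (.call 8 (snd
      (snd (snd (.var 0)))))))
  (fst (snd (snd (.var 0))))

/-- Concatenates two adjacent parts of one envelope; the two segments at the common point are
merged if they lie on one pseudo-line. -/
def glueCode : Expr :=
  .letIn (.call 5 (fst (.var 0))) <|
  .letIn (.call 4 (snd (.var 1))) <|
  -- The model has no equality test for pseudo-lines. Distinct ones on consecutive parts of an
  -- envelope are always increasing, so a failed comparison means equality.
  .ite (.op2 .below (fst (.var 1)) (fst (.var 0)))
  (.call 3 (bodyE (fst (snd (.var 0))) (.op2 .cons (fst (.var 1)) (fst (.var 0))) (fst (.var 2))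
      (snd (.var 2))))
  (.letIn (.call 7 (.op2 .cons (snd (.var 2)) (fst (snd (.var 1))))) <|
    .ite (fst (fst (.var 3)))
    (.letIn (.call 8 (fst (.var 3))) <|
      .call 3 (bodyE (fst (snd (.var 3))) (.op2 .cons (fst (.call 5 (.var 0))) (fst (.var 2)))
          (.var 0) (.var 1)))
    (.var 0))

/-- The abscissa where an envelope passes from pseudo-lines that are at most a given one to larger
ones. -/
def findBreakCode : Expr :=
  .letIn (snd (fst (.var 0))) <|
  .ite (.op2 .below (snd (.var 1)) (snd (fst (snd (.var 0)))))
  (.ite (.op2 .below (snd (.var 1)) (fst (fst (snd (.var 0)))))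
    (.call 10 (.op2 .cons (fst (snd (snd (.var 0)))) (snd (.var 1))))
    (fst (.var 0)))
  (.call 10 (.op2 .cons (snd (snd (snd (.var 0)))) (snd (.var 1))))

/-- A step of the simultaneous search in the tree of the upper of two families (in the order on
the left). The input consists of a subtree of the first tree with a stack of tentative moves to
the right, and a subtree of the second tree with a stack of tentative moves to the left. -/
def moveRightCode : Expr :=
  .letIn (fst (fst (.var 0))) <|
  .letIn (snd (fst (.var 1))) <|
  .letIn (fst (snd (.var 2))) <|
  .letIn (snd (snd (.var 3))) <|
  .ite (fst (.var 1))
  (.letIn (snd (.var 1)) <|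
    -- A crossing to the right of the vertex proves that the meeting point is to its right, and the
    -- move right is final. Otherwise the move left is tentative, unless the vertex lies left of the
    -- top of the other stack; then the crossing refutes that top entry.
    .ite (.op2 .le (.op2 .cross (fst (snd (.var 3))) (fst (fst (snd (.var 0))))) (fst (.var 0)))
    (.ite (.op2 .le (fst (.var 3)) (fst (.var 0)))
      (.call 12 (.op2 .cons (fst (.var 5)) (.op2 .cons (fst (snd (snd (.var 0)))) (.op2 .cons
          (fst (.var 0)) (.op2 .cons (fst (fst (snd (.var 0)))) (.op2 .cons (snd (snd (snd
              (.var 0)))) (.var 1)))))))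
      (.call 11 (.op2 .cons (snd (snd (.var 3))) (snd (.var 5)))))
    (.call 12 (.op2 .cons (fst (.var 5)) (.op2 .cons (snd (snd (snd (.var 0)))) (.var 1)))))
  (.letIn (.op2 .cross (fst (snd (.var 2))) (fst (snd (.var 0)))) <|
    .ite (.op2 .le (fst (.var 3)) (.var 0))
    (.ite (fst (.var 4))
      (.call 12 (.var 5))
      (.ite (.op2 .le (.var 0) (fst (.var 1)))
        (.var 0)
        (.call 11 (.op2 .cons (fst (.var 5)) (snd (snd (.var 1)))))))
    (.call 11 (.op2 .cons (snd (snd (.var 3))) (snd (.var 5)))))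

/-- The mirror image of `moveRightCode`, a step in the tree of the lower family. -/
def moveLeftCode : Expr :=
  .letIn (fst (fst (.var 0))) <|
  .letIn (snd (fst (.var 1))) <|
  .letIn (fst (snd (.var 2))) <|
  .letIn (snd (snd (.var 3))) <|
  .ite (fst (.var 3))
  (.letIn (snd (.var 3)) <|
    .ite (.op2 .le (fst (.var 0)) (.op2 .cross (snd (fst (snd (.var 0)))) (fst (snd (.var 1)))))
    (.ite (.op2 .le (fst (.var 0)) (fst (.var 1)))
      (.call 11 (.op2 .cons (.op2 .cons (snd (snd (snd (.var 0)))) (.op2 .cons (fst (.var 0))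
          (.op2 .cons (snd (fst (snd (.var 0)))) (.op2 .cons (fst (snd (snd (.var 0))))
              (.var 3))))) (snd (.var 5))))
      (.call 12 (.op2 .cons (fst (.var 5)) (snd (snd (.var 1))))))
    (.call 11 (.op2 .cons (.op2 .cons (fst (snd (snd (.var 0)))) (.var 3)) (snd (.var 5)))))
  (.letIn (.op2 .cross (fst (snd (.var 2))) (fst (snd (.var 0)))) <|
    .ite (.op2 .le (.var 0) (fst (.var 1)))
    (.ite (fst (.var 2))
      (.call 11 (.var 5))
      (.ite (.op2 .le (fst (.var 3)) (.var 0))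
        (.var 0)
        (.call 12 (.op2 .cons (snd (snd (.var 3))) (snd (.var 5))))))
    (.call 12 (.op2 .cons (fst (.var 5)) (snd (snd (.var 1))))))

/-- The abscissa of the intersection point of two envelopes. -/
def meetCode : Expr :=
  .call 11 (.op2 .cons (.op2 .cons (fst (.var 0)) (.op2 .cons (.const .negInf) (.op2 .cons (fst
      (.call 4 (fst (.var 0)))) (.const .nil)))) (.op2 .cons (snd (.var 0)) (.op2 .cons (.const
          .posInf) (.op2 .cons (fst (.call 5 (snd (.var 0)))) (.const .nil)))))

/-- The largest pseudo-line below a node of a tree `Ξ`. -/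
def topLineCode : Expr :=
  .ite (fst (.var 0))
  (fst (snd (.var 0)))
  (snd (.var 0))

/-- The envelope tree of a node of a tree `Ξ`. -/
def envOfCode : Expr :=
  .ite (fst (.var 0))
  (fst (snd (snd (.var 0))))
  (.op2 .cons (.const .nil) (.op2 .cons (snd (.var 0)) (.op2 .cons (.const .negInf) (.const
      .posInf))))

/-- Replaces the envelope tree of a node of a tree `Ξ`. -/
def setEnvCode : Expr :=
  .letIn (fst (.var 0)) <|
  .ite (fst (.var 0))
  (.op2 .cons (fst (.var 0)) (.op2 .cons (fst (snd (.var 0))) (.op2 .cons (snd (.var 1)) (snd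
      (snd (snd (.var 0)))))))
  (.var 0)

/-- Joins two trees `Ξ` with complete envelopes whose heights differ by at most one. -/
def upCode : Expr :=
  .letIn (fst (.var 0)) <|
  .letIn (snd (.var 1)) <|
  .letIn (.call 15 (.var 1)) <|
  .letIn (.call 15 (.var 1)) <|
  .letIn (.call 13 (.op2 .cons (.var 1) (.var 0))) <|
  .letIn (.call 6 (.op2 .cons (.var 2) (.var 0))) <|
  .letIn (.call 6 (.op2 .cons (.var 2) (.var 1))) <|
  .letIn (.call 0 (.var 6)) <|
  .letIn (.call 0 (.var 6)) <|
  .op2 .cons (.op1 .succ (.ite (.op2 .le (.var 1) (.var 0))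
      (.var 0)
      (.var 1))) (.op2 .cons (.call 14 (.var 7)) (.op2 .cons (.call 3 (bodyE (.var 4) (.op2 .cons
          (fst (.call 5 (fst (.var 3)))) (fst (.call 4 (snd (.var 2))))) (fst (.var 3)) (snd
              (.var 2)))) (.op2 .cons (.call 16 (.op2 .cons (.var 8) (snd (.var 3)))) (.call 16
                  (.op2 .cons (.var 7) (fst (.var 2)))))))

/-- Restores the complete envelopes of the two children of a root. -/
def downCode : Expr :=
  .letIn (snd (.var 0)) <|
  .letIn (fst (snd (snd (.var 0)))) <|
  .letIn (snd (snd (snd (.var 1)))) <|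
  -- The meeting abscissa is not stored in `Ξ`; it is found again from the largest pseudo-line of
  -- the left child.
  .letIn (.call 6 (.op2 .cons (fst (snd (.var 2))) (.call 10 (.op2 .cons (fst (snd (.var 2)))
      (.call 14 (.var 1)))))) <|
  .op2 .cons (.call 25 (.op2 .cons (.var 2) (fst (.var 0)))) (.call 26 (.op2 .cons (.var 1) (snd
      (.var 0))))

/-- Joins two trees `Ξ` with complete envelopes whose heights differ by at most two. -/
def balanceCode : Expr :=
  .letIn (fst (.var 0)) <|
  .letIn (snd (.var 1)) <|
  .letIn (.call 0 (.var 1)) <|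
  .letIn (.call 0 (.var 1)) <|
  .ite (.op2 .le (.var 1) (.op1 .succ (.var 0)))
  (.ite (.op2 .le (.var 0) (.op1 .succ (.var 1)))
    (.call 17 (.var 4))
    (.letIn (.call 18 (.var 2)) <|
      .ite (.op2 .le (.call 0 (fst (.var 0))) (.call 0 (snd (.var 0))))
      (.call 17 (.op2 .cons (.call 17 (.op2 .cons (.var 4) (fst (.var 0)))) (snd (.var 0))))
      (.letIn (.call 18 (fst (.var 0))) <|
        .call 17 (.op2 .cons (.call 17 (.op2 .cons (.var 5) (fst (.var 0)))) (.call 17 (.op2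
            .cons (snd (.var 0)) (snd (.var 1))))))))
  (.letIn (.call 18 (.var 3)) <|
    .ite (.op2 .le (.call 0 (snd (.var 0))) (.call 0 (fst (.var 0))))
    (.call 17 (.op2 .cons (fst (.var 0)) (.call 17 (.op2 .cons (snd (.var 0)) (.var 3)))))
    (.letIn (.call 18 (snd (.var 0))) <|
      .call 17 (.op2 .cons (.call 17 (.op2 .cons (fst (.var 1)) (fst (.var 0)))) (.call 17 (.op2
          .cons (snd (.var 0)) (.var 4))))))

/-- Insertion into a nonempty tree `Ξ`. -/
def insertIntoCode : Expr :=
  .letIn (fst (.var 0)) <|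
  .letIn (snd (.var 1)) <|
  .ite (fst (.var 0))
  (.letIn (.call 18 (.var 0)) <|
    .ite (.op2 .below (.var 2) (.call 14 (fst (.var 0))))
    (.call 19 (.op2 .cons (.call 20 (.op2 .cons (.var 2) (fst (.var 0)))) (snd (.var 0))))
    (.call 19 (.op2 .cons (fst (.var 0)) (.call 20 (.op2 .cons (.var 2) (snd (.var 0)))))))
  (.letIn (.op2 .cons (.const .nil) (.var 1)) <|
    .ite (.op2 .below (.var 2) (snd (.var 1)))
    (.call 17 (.op2 .cons (.var 0) (.var 1)))
    (.call 17 (.op2 .cons (.var 1) (.var 0))))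

/-- Insertion. -/
def insertCode : Expr :=
  .ite (snd (.var 0))
  (.call 20 (.var 0))
  (.op2 .cons (.const .nil) (fst (.var 0)))

/-- Deletion. -/
def deleteCode : Expr :=
  .letIn (fst (.var 0)) <|
  .letIn (snd (.var 1)) <|
  .ite (fst (.var 0))
  (.letIn (.call 18 (.var 0)) <|
    .ite (.op2 .below (.call 14 (fst (.var 0))) (.var 2))
    (.letIn (.call 22 (.op2 .cons (.var 2) (snd (.var 0)))) <|
      .ite (.var 0)
      (.call 19 (.op2 .cons (fst (.var 1)) (.var 0)))
      (fst (.var 1)))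
    (.letIn (.call 22 (.op2 .cons (.var 2) (fst (.var 0)))) <|
      .ite (.var 0)
      (.call 19 (.op2 .cons (.var 0) (snd (.var 1))))
      (snd (.var 1))))
  (.const .nil)

/-- The pseudo-lines of an envelope tree on a vertical line. -/
def locateCode : Expr :=
  .letIn (fst (.var 0)) <|
  .letIn (snd (snd (.var 1))) <|
  .ite (fst (snd (.var 2)))
  (.ite (.op2 .le (fst (.var 0)) (.var 1))
    (.ite (.op2 .le (.var 1) (fst (.var 0)))
      (.op2 .cons (fst (fst (snd (.var 0)))) (.op2 .cons (snd (fst (snd (.var 0)))) (.const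
          .nil)))
      (.call 23 (.op2 .cons (.var 1) (snd (snd (snd (.var 0)))))))
    (.call 23 (.op2 .cons (.var 1) (fst (snd (snd (.var 0)))))))
  (.op2 .cons (fst (.var 0)) (.const .nil))

/-- Vertical ray shooting. -/
def shootCode : Expr :=
  .ite (snd (.var 0))
  (.call 23 (.op2 .cons (fst (.var 0)) (.call 15 (snd (.var 0)))))
  (.const .nil)

/-- Completes the envelope of a left child by its part on the envelope of the parent. -/
def restoreLeftCode : Expr :=
  .ite (fst (fst (.var 0)))
  (.call 16 (.op2 .cons (fst (.var 0)) (.call 9 (.op2 .cons (snd (.var 0)) (.call 15 (fst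
      (.var 0)))))))
  (fst (.var 0))

/-- Completes the envelope of a right child by its part on the envelope of the parent. -/
def restoreRightCode : Expr :=
  .ite (fst (fst (.var 0)))
  (.call 16 (.op2 .cons (fst (.var 0)) (.call 9 (.op2 .cons (.call 15 (fst (.var 0))) (snd
      (.var 0))))))
  (fst (.var 0))

/-- The program. -/
def prog : Program :=
  [htCode, mkCode, balCode, joinCode, firstCode, lastCode,
   splitCode, setFirstCode, popLastCode, glueCode, findBreakCode, moveRightCode,
   moveLeftCode, meetCode, topLineCode, envOfCode, setEnvCode, upCode,
   downCode, balanceCode, insertIntoCode, insertCode, deleteCode, locateCode,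
   shootCode, restoreLeftCode, restoreRightCode]

/-! ### Weakest preconditions -/

/-- The two ways to go on after a comparison. -/
structure Branch (p A B : Prop) : Prop where
  pos : p → A
  neg : ¬p → B

/-- There is a run of the `k`-th function after which `Q` holds. -/
structure CallRun (k : ℕ) (v : Val) (Q : Val → ℕ → Prop) : Prop where
  run : ∃ body w t, prog[k]? = some body ∧ Runs prog [v] body w t ∧ Q w t

/-- `f` and `g` have a unique common point, and `Q` holds for its abscissa. -/
structure CrossRun (f g : Curve) (Q : ℝ → Prop) : Prop where
  run : ∃ c : ℝ, (f c = g c ∧ ∀ y, f y = g y → y = c) ∧ Q c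

def Op1.wp : Op1 → Val → (Val → Prop) → Prop
  | .car, .cons a _, Q => Q a
  | .cdr, .cons _ b, Q => Q b
  | .succ, .nat n, Q => Q (.nat (n + 1))
  | _, _, _ => False

/-- Sufficient conditions for `Q` to hold for the result; ordinates are never needed. -/
def Op2.wp : Op2 → Val → Val → (Val → Prop) → Prop
  | .cons, a, b, Q => Q (.cons a b)
  | .le, .nat m, .nat n, Q => Branch (m ≤ n) (Q (.nat 0)) (Q .nil)
  | .le, .coord x, .coord y, Q => Branch (x ≤ y) (Q (.nat 0)) (Q .nil)
  | .below, .line f, .line g, Q => Branch (Below f g) (Q (.nat 0)) (Q .nil)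
  | .cross, .line f, .line g, Q => CrossRun f g fun c => Q (.coord (c : EReal))
  | _, _, _, _ => False

/-- A sufficient condition for a run of an expression of `prog` that ends with some value after
some number of steps such that `Q` holds for them. -/
def wp : Expr → List Val → (Val → ℕ → Prop) → Prop
  | .var i, ρ, Q => match ρ[i]? with
    | some v => Q v 1
    | none => False
  | .const c, _, Q => Q c.val 1
  | .op1 o a, ρ, Q => wp a ρ fun v t => o.wp v fun w => Q w (t + 1)
  | .op2 o a b, ρ, Q => wp a ρ fun u s => wp b ρ fun v t => o.wp u v fun w => Q w (s + t + 1)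
  | .ite c a b, ρ, Q => wp c ρ fun v s => match v with
    | .nil => wp b ρ fun w t => Q w (s + t + 1)
    | _ => wp a ρ fun w t => Q w (s + t + 1)
  | .letIn a b, ρ, Q => wp a ρ fun v s => wp b (v :: ρ) fun w t => Q w (s + t + 1)
  | .call k a, ρ, Q => wp a ρ fun v s => CallRun k v fun w t => Q w (s + t + 1)

theorem Op1.exists_run_of_wp {o : Op1} {v : Val} {Q : Val → Prop} (h : o.wp v Q) :
    ∃ w, o.run v = some w ∧ Q w := by
  cases o <;> cases v <;> first | exact h.elim | exact ⟨_, rfl, h⟩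

theorem Op2.exists_run_of_wp {o : Op2} {u v : Val} {Q : Val → Prop} (h : o.wp u v Q) :
    ∃ w, o.run u v = some w ∧ Q w := by
  classical
  have key : ∀ p : Prop, ∀ _ : Decidable p, Branch p (Q (.nat 0)) (Q .nil) → Q (Val.ofProp p) := by
    intro p _ hb
    unfold Val.ofProp
    split_ifs with hp
    exacts [hb.pos hp, hb.neg hp]
  cases o <;> cases u <;> cases v <;> first
    | exact h.elim
    | exact ⟨_, rfl, h⟩
    | exact ⟨_, rfl, key _ _ h⟩
    | skip
  rename_i f g
  obtain ⟨c, ⟨hc, hu⟩, hQ⟩ := h.run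
  have hex : ∃! x : ℝ, f x = g x := ⟨c, hc, hu⟩
  have hcc : hex.choose = c := hu _ hex.choose_spec.1
  refine ⟨.coord (hex.choose : EReal), ?_, by rwa [hcc]⟩
  simp only [Op2.run]
  rw [dif_pos hex]

/-- Soundness alone suffices, since every claim about the program asserts the existence of a run.
The induction is over the expression only: recursion of the program is hidden in `CallRun` and
resolved by separate inductions. -/
theorem exists_runs_of_wp {e : Expr} {ρ : List Val} {Q : Val → ℕ → Prop} (h : wp e ρ Q) :
    ∃ v t, Runs prog ρ e v t ∧ Q v t := by
  induction e generalizing ρ Q with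
  | var i =>
    unfold wp at h
    split at h
    · rename_i v hv
      exact ⟨v, 1, .var hv, h⟩
    · exact h.elim
  | const c => exact ⟨_, _, .const, h⟩
  | op1 o a ih =>
    obtain ⟨v, t, hr, hw⟩ := ih h
    obtain ⟨w, hw, hQ⟩ := Op1.exists_run_of_wp hw
    exact ⟨_, _, .op1 hr hw, hQ⟩
  | op2 o a b iha ihb =>
    obtain ⟨u, s, hr, hw⟩ := iha h
    obtain ⟨v, t, hr', hw⟩ := ihb hw
    obtain ⟨w, hw, hQ⟩ := Op2.exists_run_of_wp hw
    exact ⟨_, _, .op2 hr hr' hw, hQ⟩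
  | ite c a b ihc iha ihb =>
    obtain ⟨u, s, hr, hw⟩ := ihc h
    by_cases hu : u = .nil
    · subst hu
      obtain ⟨v, t, hr', hQ⟩ := ihb hw
      exact ⟨_, _, .iteFalse hr hr', hQ⟩
    · have hw : wp a ρ fun w t => Q w (s + t + 1) := by
        cases u <;> first | exact (hu rfl).elim | exact hw
      obtain ⟨v, t, hr', hQ⟩ := iha hw
      exact ⟨_, _, .iteTrue hr hu hr', hQ⟩
  | letIn a b iha ihb =>
    obtain ⟨u, s, hr, hw⟩ := iha h
    obtain ⟨v, t, hr', hQ⟩ := ihb hw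
    exact ⟨_, _, .letIn hr hr', hQ⟩
  | call k a ih =>
    obtain ⟨u, s, hr, hw⟩ := ih h
    obtain ⟨body, w, t, hb, hr', hQ⟩ := hw.run
    exact ⟨_, _, .call hr hb hr', hQ⟩

/-- The entry point of all runtime proofs. `Branch`, `CallRun` and `CrossRun` are structures, so
reducing `wp body` stops at each comparison, call and intersection; the rest of the execution is
checked by `rfl`. -/
theorem RunsWithin.of_wp {k : ℕ} {v w : Val} {n : ℕ} (body : Expr) (hb : prog[k]? = some body)
    (h : wp body [v] fun w' t => w' = w ∧ t ≤ n) : RunsWithin prog k v w n := by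
  obtain ⟨w', t, hr, rfl, ht⟩ := exists_runs_of_wp h
  exact ⟨body, t, hb, hr, ht⟩

theorem CallRun.intro {k n : ℕ} {v w : Val} {Q : Val → ℕ → Prop} (h : RunsWithin prog k v w n)
    (hQ : ∀ t, t ≤ n → Q w t) : CallRun k v Q := by
  obtain ⟨body, t, hb, hr, ht⟩ := h
  exact ⟨body, w, t, hb, hr, hQ t ht⟩

theorem RunsWithin.mono {P : Program} {k m n : ℕ} {v w : Val} (h : RunsWithin P k v w m)
    (hmn : m ≤ n) : RunsWithin P k v w n := by
  obtain ⟨body, t, hb, hr, ht⟩ := h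
  exact ⟨body, t, hb, hr, ht.trans hmn⟩

end Envelope

namespace Envelope

/-! ### Envelope trees: balanced trees with checked data -/

namespace EnvTree

def first : EnvTree → Seg
  | leaf s => s
  | node _ _ _ _ l _ => l.first

def last : EnvTree → Seg
  | leaf s => s
  | node _ _ _ _ _ r => r.last

def leaves : EnvTree → ℕ
  | leaf _ => 1
  | node _ _ _ _ l r => l.leaves + r.leaves

/-- A recursive form of `EnvTree.Stores`. -/
def Env (E : Set Curve) : EnvTree → EReal → EReal → Prop
  | leaf s, lo, hi => s.left = lo ∧ s.right = hi ∧ lo < hi ∧ s.line ∈ E ∧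
      ∀ x : ℝ, lo ≤ (x : EReal) → (x : EReal) ≤ hi → s.line x = lowerEnv E x
  | node h p a b l r, lo, hi => l.Env E lo p ∧ r.Env E p hi ∧ l.last.line = a ∧
      r.first.line = b ∧ a ≠ b ∧ h = max l.height r.height + 1 ∧ l.height ≤ r.height + 1 ∧
      r.height ≤ l.height + 1

/-- The representation of the children and of the data between them. -/
noncomputable def bodyVal (p : ℝ) (a b : Curve) (l r : EnvTree) : Val :=
  .cons (.coord (p : EReal)) (.cons (.cons (.line a) (.line b)) (.cons l.toVal r.toVal))

end EnvTree

open EnvTree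

variable {E : Set Curve} {l r T : EnvTree} {lo hi : EReal} {p : ℝ} {a b : Curve}

theorem runs_ht (h : T.Env E lo hi) : RunsWithin prog 0 T.toVal (.nat T.height) 8 := by
  cases T with
  | leaf s => exact .of_wp htCode rfl ⟨rfl, by omega⟩
  | node n p a b l r =>
    obtain ⟨-, -, -, -, -, rfl, -⟩ := h
    exact .of_wp htCode rfl ⟨rfl, by omega⟩

/-- `l` and `r` hold adjacent parts of the envelope of `E`, with a vertex of it above `p`. -/
structure Linked (E : Set Curve) (l r : EnvTree) (lo : EReal) (p : ℝ) (hi : EReal) : Prop where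
  left : l.Env E lo p
  right : r.Env E p hi
  ne : l.last.line ≠ r.first.line

/-- `T` is the concatenation of `l` and `r`. -/
structure Joined (E : Set Curve) (l r T : EnvTree) (lo hi : EReal) : Prop where
  env : T.Env E lo hi
  first : T.first = l.first
  last : T.last = r.last
  leaves : T.leaves = l.leaves + r.leaves

namespace Linked

/-- The input of the functions that join `l` and `r`. -/
noncomputable def val (_ : Linked E l r lo p hi) : Val := bodyVal p l.last.line r.first.line l r

/-- The inner node with children `l` and `r`. -/
def node (_ : Linked E l r lo p hi) : EnvTree :=
  .node (max l.height r.height + 1) p l.last.line r.first.line l r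

theorem joined (h : Linked E l r lo p hi) (h1 : l.height ≤ r.height + 1)
    (h2 : r.height ≤ l.height + 1) : Joined E l r h.node lo hi where
  env := ⟨h.left, h.right, rfl, rfl, h.ne, rfl, h1, h2⟩
  first := rfl
  last := rfl
  leaves := rfl

theorem height_node (h : Linked E l r lo p hi) : h.node.height = max l.height r.height + 1 := rfl

theorem runs_mk (h : Linked E l r lo p hi) : RunsWithin prog 1 h.val h.node.toVal 50 := by
  refine .of_wp mkCode rfl ?_
  refine CallRun.intro (runs_ht h.left) fun s hs => ?_
  refine CallRun.intro (runs_ht h.right) fun t ht => ?_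
  refine Branch.mk (fun hle => ?_) (fun hle => ?_)
  · refine And.intro ?_ (by omega)
    unfold node
    rw [max_eq_right hle]; rfl
  · refine And.intro ?_ (by omega)
    unfold node
    rw [max_eq_left (by omega)]; rfl

/-- An AVL rotation. The exact height in the already balanced case is needed by callers: it shows
that replacing a subtree by one of the same height does not make the whole tree lower. -/
theorem exists_bal (h : Linked E l r lo p hi) (h1 : l.height ≤ r.height + 2)
    (h2 : r.height ≤ l.height + 2) :
    ∃ T, Joined E l r T lo hi ∧ max l.height r.height ≤ T.height ∧
      T.height ≤ max l.height r.height + 1 ∧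
      (l.height ≤ r.height + 1 → r.height ≤ l.height + 1 →
        T.height = max l.height r.height + 1) ∧
      RunsWithin prog 2 h.val T.toVal 400 := by
  by_cases c1 : l.height ≤ r.height + 1
  · by_cases c2 : r.height ≤ l.height + 1
    · refine ⟨h.node, h.joined c1 c2, by rw [h.height_node]; omega, h.height_node.le,
        fun _ _ => h.height_node, .of_wp balCode rfl ?_⟩
      refine CallRun.intro (runs_ht h.left) fun s hs => ?_
      refine CallRun.intro (runs_ht h.right) fun t ht => ?_
      refine Branch.mk (fun _ => ?_) (fun hn => (hn c1).elim)
      refine Branch.mk (fun _ => ?_) (fun hn => (hn c2).elim)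
      exact CallRun.intro h.runs_mk fun t ht => ⟨rfl, by omega⟩
    · obtain ⟨hl, hr, hne⟩ := id h
      cases r with
      | leaf s => exact (c2 (Nat.zero_le _)).elim
      | node n p' a b rl rr =>
        obtain ⟨hrl, hrr, rfl, rfl, hne', rfl, h3, h4⟩ := hr
        simp only [EnvTree.height] at c2 h2
        -- A single rotation works if the outer grandchild is at least as high as the inner one;
        -- otherwise the inner one is an inner node and is split up by a double rotation.
        by_cases c3 : rl.height ≤ rr.height
        · have k1 : Linked E l rl lo p p' := ⟨hl, hrl, hne⟩
          have j1 := k1.joined (by omega) (by omega)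
          have g1 := k1.height_node
          have k2 : Linked E k1.node rr lo p' hi := ⟨j1.env, hrr, by rw [j1.last]; exact hne'⟩
          have j2 := k2.joined (by omega) (by omega)
          have g2 := k2.height_node
          refine ⟨k2.node, ⟨j2.env, j2.first, j2.last, ?_⟩, ?_, ?_, ?_, .of_wp balCode rfl ?_⟩
          · simp [j2.leaves, j1.leaves, EnvTree.leaves, add_assoc]
          · simp only [EnvTree.height]; omega
          · simp only [EnvTree.height]; omega
          · simp only [EnvTree.height]; omega
          refine CallRun.intro (runs_ht h.left) fun s hs => ?_
          refine CallRun.intro (runs_ht h.right) fun t ht => ?_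
          refine Branch.mk (fun _ => ?_) (fun hn => (hn c1).elim)
          refine Branch.mk (fun hn => (c2 hn).elim) (fun _ => ?_)
          refine CallRun.intro (runs_ht hrl) fun s hs => ?_
          refine CallRun.intro (runs_ht hrr) fun t ht => ?_
          refine Branch.mk (fun _ => ?_) (fun hn => (hn c3).elim)
          refine CallRun.intro k1.runs_mk fun t ht => ?_
          refine CallRun.intro k2.runs_mk fun t ht => ?_
          exact ⟨rfl, by omega⟩
        · cases rl with
          | leaf s => exact (c3 (Nat.zero_le _)).elim
          | node n p'' a b rll rlr =>
          obtain ⟨hrll, hrlr, rfl, rfl, hne'', rfl, h5, h6⟩ := hrl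
          simp only [EnvTree.height] at c2 h2 c3 h3 h4
          have k1 : Linked E l rll lo p p'' := ⟨hl, hrll, hne⟩
          have j1 := k1.joined (by omega) (by omega)
          have g1 := k1.height_node
          have k2 : Linked E rlr rr p'' p' hi := ⟨hrlr, hrr, hne'⟩
          have j2 := k2.joined (by omega) (by omega)
          have g2 := k2.height_node
          have k3 : Linked E k1.node k2.node lo p'' hi :=
            ⟨j1.env, j2.env, by rw [j1.last, j2.first]; exact hne''⟩
          have j3 := k3.joined (by omega) (by omega)
          have g3 := k3.height_node
          refine ⟨k3.node, ⟨j3.env, j3.first, j3.last, ?_⟩, ?_, ?_, ?_, .of_wp balCode rfl ?_⟩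
          · simp [j3.leaves, j2.leaves, j1.leaves, EnvTree.leaves, add_assoc]
          · simp only [EnvTree.height]; omega
          · simp only [EnvTree.height]; omega
          · simp only [EnvTree.height]; omega
          refine CallRun.intro (runs_ht h.left) fun s hs => ?_
          refine CallRun.intro (runs_ht h.right) fun t ht => ?_
          refine Branch.mk (fun _ => ?_) (fun hn => (hn c1).elim)
          refine Branch.mk (fun hn => (c2 hn).elim) (fun _ => ?_)
          refine CallRun.intro (runs_ht (T := .node _ p'' _ _ rll rlr)
            ⟨hrll, hrlr, rfl, rfl, hne'', rfl, h5, h6⟩) fun s hs => ?_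
          refine CallRun.intro (runs_ht hrr) fun t ht => ?_
          refine Branch.mk (fun hn => (c3 hn).elim) (fun _ => ?_)
          refine CallRun.intro k1.runs_mk fun t ht => ?_
          refine CallRun.intro k2.runs_mk fun t ht => ?_
          refine CallRun.intro k3.runs_mk fun t ht => ?_
          exact ⟨rfl, by omega⟩
  · obtain ⟨hl, hr, hne⟩ := id h
    cases l with
    | leaf s => exact (c1 (Nat.zero_le _)).elim
    | node n p' a b ll lr =>
        obtain ⟨hll, hlr, rfl, rfl, hne', rfl, h3, h4⟩ := hl
        simp only [EnvTree.height] at c1 h1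
        by_cases c3 : lr.height ≤ ll.height
        · have k1 : Linked E lr r p' p hi := ⟨hlr, hr, hne⟩
          have j1 := k1.joined (by omega) (by omega)
          have g1 := k1.height_node
          have k2 : Linked E ll k1.node lo p' hi := ⟨hll, j1.env, by rw [j1.first]; exact hne'⟩
          have j2 := k2.joined (by omega) (by omega)
          have g2 := k2.height_node
          refine ⟨k2.node, ⟨j2.env, j2.first, j2.last, ?_⟩, ?_, ?_, ?_, .of_wp balCode rfl ?_⟩
          · simp [j2.leaves, j1.leaves, EnvTree.leaves, add_assoc]
          · simp only [EnvTree.height]; omega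
          · simp only [EnvTree.height]; omega
          · simp only [EnvTree.height]; omega
          refine CallRun.intro (runs_ht h.left) fun s hs => ?_
          refine CallRun.intro (runs_ht h.right) fun t ht => ?_
          refine Branch.mk (fun hn => (c1 hn).elim) (fun _ => ?_)
          refine CallRun.intro (runs_ht hlr) fun t ht => ?_
          refine CallRun.intro (runs_ht hll) fun s hs => ?_
          refine Branch.mk (fun _ => ?_) (fun hn => (hn c3).elim)
          refine CallRun.intro k1.runs_mk fun t ht => ?_
          refine CallRun.intro k2.runs_mk fun t ht => ?_
          exact ⟨rfl, by omega⟩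
        · cases lr with
          | leaf s => exact (c3 (Nat.zero_le _)).elim
          | node n p'' a b lrl lrr =>
          obtain ⟨hlrl, hlrr, rfl, rfl, hne'', rfl, h5, h6⟩ := hlr
          simp only [EnvTree.height] at c1 h1 c3 h3 h4
          have k1 : Linked E ll lrl lo p' p'' := ⟨hll, hlrl, hne'⟩
          have j1 := k1.joined (by omega) (by omega)
          have g1 := k1.height_node
          have k2 : Linked E lrr r p'' p hi := ⟨hlrr, hr, hne⟩
          have j2 := k2.joined (by omega) (by omega)
          have g2 := k2.height_node
          have k3 : Linked E k1.node k2.node lo p'' hi :=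
            ⟨j1.env, j2.env, by rw [j1.last, j2.first]; exact hne''⟩
          have j3 := k3.joined (by omega) (by omega)
          have g3 := k3.height_node
          refine ⟨k3.node, ⟨j3.env, j3.first, j3.last, ?_⟩, ?_, ?_, ?_, .of_wp balCode rfl ?_⟩
          · simp [j3.leaves, j2.leaves, j1.leaves, EnvTree.leaves, add_assoc]
          · simp only [EnvTree.height]; omega
          · simp only [EnvTree.height]; omega
          · simp only [EnvTree.height]; omega
          refine CallRun.intro (runs_ht h.left) fun s hs => ?_
          refine CallRun.intro (runs_ht h.right) fun t ht => ?_
          refine Branch.mk (fun hn => (c1 hn).elim) (fun _ => ?_)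
          refine CallRun.intro (runs_ht (T := .node _ p'' _ _ lrl lrr)
            ⟨hlrl, hlrr, rfl, rfl, hne'', rfl, h5, h6⟩) fun s hs => ?_
          refine CallRun.intro (runs_ht hll) fun t ht => ?_
          refine Branch.mk (fun hn => (c3 hn).elim) (fun _ => ?_)
          refine CallRun.intro k1.runs_mk fun t ht => ?_
          refine CallRun.intro k2.runs_mk fun t ht => ?_
          refine CallRun.intro k3.runs_mk fun t ht => ?_
          exact ⟨rfl, by omega⟩

/-- The lower tree is pushed down the facing spine of the higher one until the heights differ by at
most one. The recursive result exceeds the subtree it replaces by at most one level, so one rotation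
per level repairs the balance. The number of levels is governed by the height difference, which
makes successive joins telescope in `exists_split`. -/
theorem exists_join (h : Linked E l r lo p hi) :
    ∃ T, Joined E l r T lo hi ∧ max l.height r.height ≤ T.height ∧
      T.height ≤ max l.height r.height + 1 ∧
      RunsWithin prog 3 h.val T.toVal
        (600 * ((l.height - r.height) + (r.height - l.height) + 1)) := by
  induction hn : l.height + r.height using Nat.strong_induction_on generalizing l r lo p hi with
  | _ n ih =>
  subst hn
  by_cases c1 : l.height ≤ r.height + 1
  · by_cases c2 : r.height ≤ l.height + 1
    · refine ⟨h.node, h.joined c1 c2, by rw [h.height_node]; omega, h.height_node.le,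
        .of_wp joinCode rfl ?_⟩
      refine CallRun.intro (runs_ht h.left) fun s hs => ?_
      refine CallRun.intro (runs_ht h.right) fun t ht => ?_
      refine Branch.mk (fun _ => ?_) (fun hn => (hn c1).elim)
      refine Branch.mk (fun _ => ?_) (fun hn => (hn c2).elim)
      exact CallRun.intro h.runs_mk fun t ht => ⟨rfl, by omega⟩
    · obtain ⟨hl, hr, hne⟩ := id h
      cases r with
      | leaf s => exact (c2 (Nat.zero_le _)).elim
      | node n p' a b rl rr =>
        obtain ⟨hrl, hrr, rfl, rfl, hne', rfl, h3, h4⟩ := hr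
        simp only [EnvTree.height] at c2 ⊢
        have k1 : Linked E l rl lo p p' := ⟨hl, hrl, hne⟩
        obtain ⟨T, j1, g1, g1', r1⟩ := ih _ (by simp only [EnvTree.height]; omega) k1 rfl
        have k2 : Linked E T rr lo p' hi := ⟨j1.env, hrr, by rw [j1.last]; exact hne'⟩
        obtain ⟨T', j2, g2, g2', g2'', r2⟩ := k2.exists_bal (by omega) (by omega)
        refine ⟨T', ⟨j2.env, by rw [j2.first, j1.first], j2.last, ?_⟩, ?_, ?_,
          .of_wp joinCode rfl ?_⟩
        · simp [j2.leaves, j1.leaves, EnvTree.leaves, add_assoc]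
        · omega
        · omega
        refine CallRun.intro (runs_ht h.left) fun s hs => ?_
        refine CallRun.intro (runs_ht h.right) fun t ht => ?_
        refine Branch.mk (fun _ => ?_) (fun hn => (hn c1).elim)
        refine Branch.mk (fun hn => (c2 hn).elim) (fun _ => ?_)
        refine CallRun.intro r1 fun t ht => ?_
        -- The program reuses the pair of pseudo-lines stored at the old root. It is still correct
        -- because a join keeps the outer segments.
        unfold val at r2
        rw [j1.last] at r2
        refine CallRun.intro r2 fun t ht => ?_
        exact ⟨rfl, by omega⟩
  · obtain ⟨hl, hr, hne⟩ := id h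
    cases l with
    | leaf s => exact (c1 (Nat.zero_le _)).elim
    | node n p' a b ll lr =>
      obtain ⟨hll, hlr, rfl, rfl, hne', rfl, h3, h4⟩ := hl
      simp only [EnvTree.height] at c1 ⊢
      have k1 : Linked E lr r p' p hi := ⟨hlr, hr, hne⟩
      obtain ⟨T, j1, g1, g1', r1⟩ := ih _ (by simp only [EnvTree.height]; omega) k1 rfl
      have k2 : Linked E ll T lo p' hi := ⟨hll, j1.env, by rw [j1.first]; exact hne'⟩
      obtain ⟨T', j2, g2, g2', g2'', r2⟩ := k2.exists_bal (by omega) (by omega)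
      refine ⟨T', ⟨j2.env, j2.first, by rw [j2.last, j1.last], ?_⟩, ?_, ?_,
        .of_wp joinCode rfl ?_⟩
      · simp [j2.leaves, j1.leaves, EnvTree.leaves, add_assoc]
      · omega
      · omega
      refine CallRun.intro (runs_ht h.left) fun s hs => ?_
      refine CallRun.intro (runs_ht h.right) fun t ht => ?_
      refine Branch.mk (fun hn => (c1 hn).elim) (fun _ => ?_)
      refine CallRun.intro r1 fun t ht => ?_
      unfold val at r2
      rw [j1.first] at r2
      refine CallRun.intro r2 fun t ht => ?_
      exact ⟨rfl, by omega⟩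

end Linked

end Envelope

namespace Envelope

open EnvTree

variable {E : Set Curve} {l r T : EnvTree} {lo hi : EReal} {p : ℝ} {a b : Curve}

/-! ### Lower envelopes of finite families -/

theorem lowerEnv_le (hE : E.Finite) {e : Curve} (he : e ∈ E) (x : ℝ) : lowerEnv E x ≤ e x :=
  csInf_le (hE.image _).bddBelow ⟨e, he, rfl⟩

theorem exists_eq_lowerEnv (hE : E.Finite) (hne : E.Nonempty) (x : ℝ) :
    ∃ e ∈ E, e x = lowerEnv E x :=
  (hne.image _).csInf_mem (hE.image _)

theorem CrossAt.below {f g : Curve} {c : ℝ} (h : CrossAt f g c) : Below f g :=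
  (eventually_lt_atBot c).mono fun x hx => h.1 x hx

theorem Below.trans {f g h : Curve} (hfg : Below f g) (hgh : Below g h) : Below f h :=
  hfg.mp (hgh.mono fun _ h1 h2 => h2.trans h1)

theorem not_below_self (f : Curve) : ¬ Below f f := fun h => by
  obtain ⟨x, hx⟩ := h.exists
  exact lt_irrefl _ hx

theorem Below.asymm {f g : Curve} (hfg : Below f g) : ¬ Below g f :=
  fun h => not_below_self _ (hfg.trans h)

theorem Below.ne {f g : Curve} (hfg : Below f g) : f ≠ g := by
  rintro rfl
  exact not_below_self _ hfg

theorem IsPseudoLines.below_or_below (hE : IsPseudoLines E) {f g : Curve} (hf : f ∈ E)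
    (hg : g ∈ E) (hne : f ≠ g) : Below f g ∨ Below g f := by
  obtain ⟨c, h | h⟩ := hE.2 f hf g hg hne
  exacts [.inl h.below, .inr h.below]

theorem IsPseudoLines.exists_crossAt (hE : IsPseudoLines E) {f g : Curve} (hf : f ∈ E)
    (hg : g ∈ E) (hfg : Below f g) : ∃ c, CrossAt f g c := by
  obtain ⟨c, h | h⟩ := hE.2 f hf g hg hfg.ne
  exacts [⟨c, h⟩, (hfg.asymm h.below).elim]

theorem IsPseudoLines.mono {F : Set Curve} (hE : IsPseudoLines E) (h : F ⊆ E) :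
    IsPseudoLines F :=
  ⟨hE.1.subset h, fun f hf g hg => hE.2 f (h hf) g (h hg)⟩

/-- The pseudo-lines that support consecutive parts of a lower envelope are ordered from bottom
to top. -/
theorem IsPseudoLines.below_of_eq (hE : IsPseudoLines E) {f g : Curve} (hf : f ∈ E) (hg : g ∈ E)
    (hne : f ≠ g) {x y : ℝ} (hxy : x < y) (hx : f x = lowerEnv E x) (hy : g y = lowerEnv E y) :
    Below f g := by
  obtain ⟨c, h | h⟩ := hE.2 f hf g hg hne
  · exact h.below
  · have h1 : f x ≤ g x := hx ▸ lowerEnv_le hE.1 hg x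
    have h2 : g y ≤ f y := hy ▸ lowerEnv_le hE.1 hf y
    have h3 : c ≤ x := not_lt.1 fun hlt => (h.1 x hlt).not_ge h1
    exact absurd h2 (h.2.2 y (by linarith)).not_ge

namespace EnvTree

theorem Env.lt (h : T.Env E lo hi) : lo < hi := by
  induction T generalizing lo hi with
  | leaf s => exact h.2.2.1
  | node n p a b l r ihl ihr => exact (ihl h.1).trans (ihr h.2.1)

theorem Env.first_left (h : T.Env E lo hi) : T.first.left = lo := by
  induction T generalizing lo hi with
  | leaf s => exact h.1
  | node n p a b l r ihl ihr => exact ihl h.1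

theorem Env.last_right (h : T.Env E lo hi) : T.last.right = hi := by
  induction T generalizing lo hi with
  | leaf s => exact h.2.1
  | node n p a b l r ihl ihr => exact ihr h.2.1

theorem Env.lt_first_right (h : T.Env E lo hi) : lo < T.first.right := by
  induction T generalizing lo hi with
  | leaf s => exact h.2.1.symm ▸ h.2.2.1
  | node n p a b l r ihl ihr => exact ihl h.1

theorem Env.last_left_lt (h : T.Env E lo hi) : T.last.left < hi := by
  induction T generalizing lo hi with
  | leaf s => exact h.1.symm ▸ h.2.2.1
  | node n p a b l r ihl ihr => exact ihr h.2.1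

theorem Env.first_mem (h : T.Env E lo hi) : T.first.line ∈ E := by
  induction T generalizing lo hi with
  | leaf s => exact h.2.2.2.1
  | node n p a b l r ihl ihr => exact ihl h.1

theorem Env.last_mem (h : T.Env E lo hi) : T.last.line ∈ E := by
  induction T generalizing lo hi with
  | leaf s => exact h.2.2.2.1
  | node n p a b l r ihl ihr => exact ihr h.2.1

theorem Env.first_eq (h : T.Env E lo hi) {x : ℝ} (h1 : lo ≤ x) (h2 : (x : EReal) ≤ T.first.right) :
    T.first.line x = lowerEnv E x := by
  induction T generalizing lo hi with
  | leaf s => exact h.2.2.2.2 x h1 (h.2.1 ▸ h2)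
  | node n p a b l r ihl ihr => exact ihl h.1 h1 h2

theorem Env.last_eq (h : T.Env E lo hi) {x : ℝ} (h1 : T.last.left ≤ x) (h2 : (x : EReal) ≤ hi) :
    T.last.line x = lowerEnv E x := by
  induction T generalizing lo hi with
  | leaf s => exact h.2.2.2.2 x (h.1 ▸ h1) h2
  | node n p a b l r ihl ihr => exact ihr h.2.1 h1 h2

theorem Env.first_eq_left (h : T.Env E p hi) : T.first.line p = lowerEnv E p :=
  h.first_eq le_rfl h.lt_first_right.le

theorem Env.last_eq_right (h : T.Env E lo p) : T.last.line p = lowerEnv E p :=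
  h.last_eq h.last_left_lt.le le_rfl

end EnvTree

/-- The representation of a segment in a leaf. -/
noncomputable def Seg.val (s : Seg) : Val :=
  .cons (.line s.line) (.cons (.coord s.left) (.coord s.right))

/-! ### Splitting, trimming and gluing envelope trees -/

theorem runs_first (T : EnvTree) : RunsWithin prog 4 T.toVal T.first.val (16 * T.height + 8) := by
  induction T with
  | leaf s => exact .of_wp firstCode rfl ⟨rfl, by omega⟩
  | node n p a b l r ihl ihr =>
    refine .of_wp firstCode rfl ?_
    refine CallRun.intro ihl fun t ht => ?_
    exact ⟨rfl, by simp only [EnvTree.height]; omega⟩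

theorem runs_last (T : EnvTree) : RunsWithin prog 5 T.toVal T.last.val (16 * T.height + 8) := by
  induction T with
  | leaf s => exact .of_wp lastCode rfl ⟨rfl, by omega⟩
  | node n p a b l r ihl ihr =>
    refine .of_wp lastCode rfl ?_
    refine CallRun.intro ihr fun t ht => ?_
    exact ⟨rfl, by simp only [EnvTree.height]; omega⟩

/-- The two parts of an envelope tree on the two sides of the abscissa `q`. -/
structure SplitAt (E : Set Curve) (T T₁ T₂ : EnvTree) (lo : EReal) (q : ℝ) (hi : EReal) : Prop where
  left : T₁.Env E lo q
  right : T₂.Env E q hi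
  first : T₁.first.line = T.first.line
  last : T₂.last.line = T.last.line
  height_left : T₁.height ≤ T.height
  height_right : T₂.height ≤ T.height
  leaves : T.leaves ≤ T₁.leaves + T₂.leaves

/-- The parts beside the search path are joined on the way back. The heights of the two results
occur in the bound as a potential: a join with a higher tree costs no more than the growth of the
result, and a join with a lower one meets a height difference of at most one. Hence the joins
telescope to a total linear in the height. -/
theorem exists_split (h : T.Env E lo hi) {q : ℝ} (h1 : lo < q) (h2 : (q : EReal) < hi) :
    ∃ T₁ T₂, SplitAt E T T₁ T₂ lo q hi ∧
      RunsWithin prog 6 (.cons T.toVal (.coord q)) (.cons T₁.toVal T₂.toVal)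
        (700 * (3 * T.height + T₁.height + T₂.height + 1)) := by
  induction T generalizing lo hi with
  | leaf s =>
    obtain ⟨rfl, rfl, h3, h4, h5⟩ := h
    refine ⟨.leaf ⟨s.line, s.left, q⟩, .leaf ⟨s.line, q, s.right⟩,
      ⟨⟨rfl, rfl, h1, h4, fun x hx hx' => h5 x hx (hx'.trans h2.le)⟩,
        ⟨rfl, rfl, h2, h4, fun x hx hx' => h5 x (h1.le.trans hx) hx'⟩, rfl, rfl, le_rfl, le_rfl,
        by simp [leaves]⟩, .of_wp splitCode rfl ⟨rfl, by omega⟩⟩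
  | node n p a b l r ihl ihr =>
    obtain ⟨hl, hr, rfl, rfl, hne, rfl, h3, h4⟩ := h
    by_cases c1 : (p : EReal) ≤ q
    · by_cases c2 : (q : EReal) ≤ p
      · obtain rfl : p = q := EReal.coe_eq_coe_iff.1 (le_antisymm c1 c2)
        refine ⟨l, r, ⟨hl, hr, rfl, rfl, ?_, ?_, le_rfl⟩, .of_wp splitCode rfl ?_⟩
        · simp only [EnvTree.height]; omega
        · simp only [EnvTree.height]; omega
        refine Branch.mk (fun _ => ?_) (fun hn => (hn c1).elim)
        refine Branch.mk (fun _ => ?_) (fun hn => (hn c2).elim)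
        exact ⟨rfl, by omega⟩
      · obtain ⟨T₁, T₂, s, hs⟩ := ihr hr (not_le.1 c2) h2
        have k : Linked E l T₁ lo p q := ⟨hl, s.left, by rw [s.first]; exact hne⟩
        obtain ⟨T', j, g, g', hj⟩ := k.exists_join
        have g1 := s.height_left
        have g2 := s.height_right
        refine ⟨T', T₂, ⟨j.env, s.right, by rw [j.first]; rfl, s.last, ?_, ?_, ?_⟩,
          .of_wp splitCode rfl ?_⟩
        · simp only [EnvTree.height]; omega
        · simp only [EnvTree.height]; omega
        · have := s.leaves
          simp only [leaves, j.leaves]; omega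
        refine Branch.mk (fun _ => ?_) (fun hn => (hn c1).elim)
        refine Branch.mk (fun hn => (c2 hn).elim) (fun _ => ?_)
        refine CallRun.intro hs fun t ht => ?_
        unfold Linked.val at hj
        rw [s.first] at hj
        refine CallRun.intro hj fun t ht => ?_
        exact ⟨rfl, by simp only [EnvTree.height]; omega⟩
    · obtain ⟨T₁, T₂, s, hs⟩ := ihl hl h1 (not_le.1 c1)
      have k : Linked E T₂ r q p hi := ⟨s.right, hr, by rw [s.last]; exact hne⟩
      obtain ⟨T', j, g, g', hj⟩ := k.exists_join
      have g1 := s.height_left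
      have g2 := s.height_right
      refine ⟨T₁, T', ⟨s.left, j.env, s.first, by rw [j.last]; rfl, ?_, ?_, ?_⟩,
        .of_wp splitCode rfl ?_⟩
      · simp only [EnvTree.height]; omega
      · simp only [EnvTree.height]; omega
      · have := s.leaves
        simp only [leaves, j.leaves]; omega
      refine Branch.mk (fun hn => (c1 hn).elim) (fun _ => ?_)
      refine CallRun.intro hs fun t ht => ?_
      unfold Linked.val at hj
      rw [s.last] at hj
      refine CallRun.intro hj fun t ht => ?_
      exact ⟨rfl, by simp only [EnvTree.height]; omega⟩

theorem exists_setFirst {q x : EReal} (h : T.Env E q hi) (hx : x < q)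
    (heq : ∀ y : ℝ, x ≤ y → (y : EReal) ≤ q → T.first.line y = lowerEnv E y) :
    ∃ T' : EnvTree, T'.Env E x hi ∧ T'.first.line = T.first.line ∧ T'.last.line = T.last.line ∧
      T'.height = T.height ∧ T'.leaves = T.leaves ∧
      RunsWithin prog 7 (.cons T.toVal (.coord x)) T'.toVal (50 * T.height + 40) := by
  induction T generalizing hi with
  | leaf s =>
    obtain ⟨rfl, rfl, h3, h4, h5⟩ := h
    refine ⟨.leaf ⟨s.line, x, s.right⟩, ⟨rfl, rfl, hx.trans h3, h4, fun y hy hy' => ?_⟩, rfl, rfl,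
      rfl, rfl, .of_wp setFirstCode rfl ⟨rfl, by omega⟩⟩
    rcases le_total (y : EReal) s.left with hc | hc
    exacts [heq y hy hc, h5 y hc hy']
  | node n p a b l r ihl ihr =>
    obtain ⟨hl, hr, rfl, rfl, hne, rfl, h3, h4⟩ := h
    obtain ⟨T', g1, g2, g3, g4, g5, g6⟩ := ihl hl heq
    refine ⟨.node (max l.height r.height + 1) p l.last.line r.first.line T' r,
      ⟨g1, hr, g3, rfl, hne, by rw [g4], g4 ▸ h3, g4 ▸ h4⟩, g2, rfl, by simp only [EnvTree.height, g4],
      by simp only [leaves, g5], .of_wp setFirstCode rfl ?_⟩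
    refine CallRun.intro g6 fun t ht => ?_
    exact ⟨rfl, by simp only [EnvTree.height]; omega⟩

/-- The height falls by at most one, so a single rotation at each ancestor suffices. -/
theorem exists_popLast {n : ℕ} (h : (node n p a b l r).Env E lo hi) :
    ∃ (A : EnvTree) (x : ℝ), (node n p a b l r).last.left = x ∧ A.Env E lo x ∧
      A.last.line ≠ (node n p a b l r).last.line ∧ A.first = l.first ∧
      A.height ≤ (node n p a b l r).height ∧ (node n p a b l r).height ≤ A.height + 1 ∧
      A.leaves + 1 = (node n p a b l r).leaves ∧
      RunsWithin prog 8 (node n p a b l r).toVal A.toVal (500 * (node n p a b l r).height) := by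
  induction r generalizing n p a b l lo hi with
  | leaf s =>
    obtain ⟨hl, hr, rfl, rfl, hne, rfl, h3, h4⟩ := h
    refine ⟨l, p, hr.1, hl, hne, rfl, ?_, ?_, rfl, .of_wp popLastCode rfl ⟨rfl, ?_⟩⟩ <;>
    simp only [EnvTree.height] at * <;> omega
  | node n' p' a' b' l' r' ihl ihr =>
    obtain ⟨hl, hr, rfl, rfl, hne, rfl, h3, h4⟩ := h
    obtain ⟨A, x, g1, g2, g3, g4, g5, g6, g7, g8⟩ := ihr hr
    have k : Linked E l A lo p x := ⟨hl, g2, by rw [g4]; exact hne⟩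
    obtain ⟨T', j, m1, m2, m3, m4⟩ := k.exists_bal (by omega) (by omega)
    refine ⟨T', x, g1, j.env, by rw [j.last]; exact g3, j.first, ?_, ?_, ?_,
      .of_wp popLastCode rfl ?_⟩
    · simp only [EnvTree.height] at *; omega
    · simp only [EnvTree.height] at *; omega
    · simp only [leaves, j.leaves] at *; omega
    refine CallRun.intro g8 fun t ht => ?_
    unfold Linked.val at m4
    rw [g4] at m4
    refine CallRun.intro m4 fun t ht => ?_
    refine ⟨rfl, ?_⟩
    simp only [EnvTree.height] at *; omega

/-- This justifies using `Below` as a test for equality at a common endpoint. -/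
theorem IsPseudoLines.below_of_env (hE : IsPseudoLines E) {T₁ T₂ : EnvTree} {q : ℝ}
    (h₁ : T₁.Env E lo q) (h₂ : T₂.Env E q hi) (hne : T₁.last.line ≠ T₂.first.line) :
    Below T₁.last.line T₂.first.line := by
  obtain ⟨x, hx, hx'⟩ := EReal.lt_iff_exists_real_btwn.1 h₁.last_left_lt
  exact hE.below_of_eq h₁.last_mem h₂.first_mem hne (EReal.coe_lt_coe_iff.1 hx')
    (h₁.last_eq hx.le hx'.le) h₂.first_eq_left

/-- At most one pair of segments is merged. The resulting inequality between the leaf counts is the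
source of the linear storage bound. -/
theorem exists_glue (hE : IsPseudoLines E) {T₁ T₂ : EnvTree} {q : ℝ} (h₁ : T₁.Env E lo q)
    (h₂ : T₂.Env E q hi) :
    ∃ T : EnvTree, T.Env E lo hi ∧ T₁.leaves + T₂.leaves ≤ T.leaves + 1 ∧
      RunsWithin prog 9 (.cons T₁.toVal T₂.toVal) T.toVal
        (2000 * (T₁.height + T₂.height + 1)) := by
  by_cases hne : T₁.last.line = T₂.first.line
  · have hx := h₁.last_left_lt
    obtain ⟨T₂', g1, g2, g3, g4, g5, g6⟩ := exists_setFirst h₂ hx fun y hy hy' => by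
      rw [← hne]; exact h₁.last_eq hy hy'
    have hb : ¬ Below T₁.last.line T₂.first.line := fun h => h.ne hne
    cases T₁ with
    | leaf s =>
      obtain ⟨rfl, -⟩ := h₁
      refine ⟨T₂', g1, by simp only [leaves]; omega, .of_wp glueCode rfl ?_⟩
      refine CallRun.intro (runs_last _) fun t ht => ?_
      refine CallRun.intro (runs_first _) fun t ht => ?_
      refine Branch.mk (fun hn => (hb hn).elim) (fun _ => ?_)
      refine CallRun.intro g6 fun t ht => ?_
      refine ⟨rfl, ?_⟩
      simp only [EnvTree.height] at *; omega
    | node n p a b l r =>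
      -- The last segment of the left part is dropped, and the first one of the right part, already
      -- extended to the left, takes its place. The new junction is a true vertex because neighbours
      -- in the left part lie on different pseudo-lines.
      obtain ⟨A, x, m1, m2, m3, m4, m5, m6, m7, m8⟩ := exists_popLast h₁
      rw [m1] at g1 g6
      have k : Linked E A T₂' lo x hi := ⟨m2, g1, by rw [g2, ← hne]; exact m3⟩
      obtain ⟨T, j, c1, c2, c3⟩ := k.exists_join
      refine ⟨T, j.env, by rw [j.leaves]; omega, .of_wp glueCode rfl ?_⟩
      refine CallRun.intro (runs_last _) fun t ht => ?_
      refine CallRun.intro (runs_first _) fun t ht => ?_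
      refine Branch.mk (fun hn => (hb hn).elim) (fun _ => ?_)
      rw [← m1] at g6
      refine CallRun.intro g6 fun t ht => ?_
      refine CallRun.intro m8 fun t ht => ?_
      refine CallRun.intro (runs_last _) fun t ht => ?_
      unfold Linked.val bodyVal at c3
      rw [g2, ← m1] at c3
      refine CallRun.intro c3 fun t ht => ?_
      exact ⟨rfl, by omega⟩
  · have k : Linked E T₁ T₂ lo q hi := ⟨h₁, h₂, hne⟩
    obtain ⟨T, j, c1, c2, c3⟩ := k.exists_join
    refine ⟨T, j.env, by rw [j.leaves]; omega, .of_wp glueCode rfl ?_⟩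
    refine CallRun.intro (runs_last _) fun t ht => ?_
    refine CallRun.intro (runs_first _) fun t ht => ?_
    refine Branch.mk (fun _ => ?_) (fun hn => (hn (hE.below_of_env h₁ h₂ hne)).elim)
    unfold Linked.val bodyVal at c3
    rw [← h₂.first_left] at c3
    refine CallRun.intro c3 fun t ht => ?_
    exact ⟨rfl, by omega⟩

end Envelope

/-! ### Size and height of envelope trees, and their equivalence with `Stores` -/

namespace Envelope

open EnvTree

variable {E : Set Curve} {l r T : EnvTree} {lo hi : EReal} {p : ℝ} {a b : Curve}

/-- A pseudo-line is determined by two points of it on the envelope. -/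
theorem IsPseudoLines.eq_of_eq (hE : IsPseudoLines E) {f g : Curve} (hf : f ∈ E) (hg : g ∈ E)
    {x y : ℝ} (hxy : x < y) (hfx : f x = lowerEnv E x) (hgx : g x = lowerEnv E x)
    (hfy : f y = lowerEnv E y) (hgy : g y = lowerEnv E y) : f = g := by
  by_contra hne
  exact (hE.below_of_eq hf hg hne hxy hfx hgy).asymm
    (hE.below_of_eq hg hf (Ne.symm hne) hxy hgx hfy)

theorem IsPseudoLines.eq_of_eqOn (hE : IsPseudoLines E) {f g : Curve} (hf : f ∈ E) (hg : g ∈ E)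
    {α β : EReal} (hαβ : α < β)
    (h : ∀ x : ℝ, α < x → (x : EReal) < β → f x = lowerEnv E x ∧ g x = lowerEnv E x) : f = g := by
  obtain ⟨x, h1, h2⟩ := EReal.lt_iff_exists_real_btwn.1 hαβ
  obtain ⟨y, h3, h4⟩ := EReal.lt_iff_exists_real_btwn.1 h2
  have hx := h x h1 h2
  have hy := h y (h1.trans h3) h4
  exact hE.eq_of_eq hf hg (EReal.coe_lt_coe_iff.1 h3) hx.1 hx.2 hy.1 hy.2

namespace EnvTree

theorem head?_segs (T : EnvTree) : T.segs.head? = some T.first := by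
  induction T with
  | leaf s => rfl
  | node n p a b l r ihl ihr => simp [segs, first, List.head?_append, ihl]

theorem getLast?_segs (T : EnvTree) : T.segs.getLast? = some T.last := by
  induction T with
  | leaf s => rfl
  | node n p a b l r ihl ihr => simp [segs, last, List.getLast?_append, ihr]

theorem first_mem_segs (T : EnvTree) : T.first ∈ T.segs := List.mem_of_mem_head? T.head?_segs

theorem last_mem_segs (T : EnvTree) : T.last ∈ T.segs := List.mem_of_mem_getLast? T.getLast?_segs

theorem length_segs (T : EnvTree) : T.segs.length = T.leaves := by
  induction T with
  | leaf s => rfl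
  | node n p a b l r ihl ihr => simp [segs, leaves, ihl, ihr]

theorem Env.of_mem_segs (h : T.Env E lo hi) {σ : Seg} (hσ : σ ∈ T.segs) :
    σ.line ∈ E ∧ lo ≤ σ.left ∧ σ.left < σ.right ∧ σ.right ≤ hi ∧
      ∀ x : ℝ, σ.left ≤ x → (x : EReal) ≤ σ.right → σ.line x = lowerEnv E x := by
  induction T generalizing lo hi with
  | leaf s =>
    obtain rfl : σ = s := by simpa [segs] using hσ
    obtain ⟨rfl, rfl, h3, h4, h5⟩ := h
    exact ⟨h4, le_rfl, h3, le_rfl, h5⟩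
  | node n p a b l r ihl ihr =>
    rcases List.mem_append.1 hσ with hm | hm
    · obtain ⟨h1, h2, h3, h4, h5⟩ := ihl h.1 hm
      exact ⟨h1, h2, h3, h4.trans h.2.1.lt.le, h5⟩
    · obtain ⟨h1, h2, h3, h4, h5⟩ := ihr h.2.1 hm
      exact ⟨h1, h.1.lt.le.trans h2, h3, h4, h5⟩

/-- A pseudo-line on the envelope on both sides of a vertex would be both below and above any other
one through that vertex. So it would be the only one on the envelope there, but two different ones
meet at a vertex. -/
theorem Env.nodup (hE : IsPseudoLines E) (h : T.Env E lo hi) : (T.segs.map Seg.line).Nodup := by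
  induction T generalizing lo hi with
  | leaf s => simp [segs]
  | node n p a b l r ihl ihr =>
    obtain ⟨hl, hr, -, -, hne, -⟩ := id h
    simp only [segs, List.map_append]
    refine (ihl hl).append (ihr hr) ?_
    rw [List.disjoint_left]
    intro f hf hf'
    obtain ⟨σ, hσ, rfl⟩ := List.mem_map.1 hf
    obtain ⟨τ, hτ, hτσ⟩ := List.mem_map.1 hf'
    obtain ⟨m1, m2, m3, m4, m5⟩ := hl.of_mem_segs hσ
    obtain ⟨k1, k2, k3, k4, k5⟩ := hr.of_mem_segs hτ
    obtain ⟨x, hx, hx'⟩ := EReal.lt_iff_exists_real_btwn.1 m3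
    obtain ⟨y, hy, hy'⟩ := EReal.lt_iff_exists_real_btwn.1 k3
    have hxp : x < p := EReal.coe_lt_coe_iff.1 (hx'.trans_le m4)
    have hpy : p < y := EReal.coe_lt_coe_iff.1 (k2.trans_lt hy)
    have ex := m5 x hx.le hx'.le
    have ey := k5 y hy.le hy'.le
    rw [hτσ] at ey
    have key : ∀ g ∈ E, g p = lowerEnv E p → σ.line = g := by
      intro g hg hgp
      by_contra hne
      exact (hE.below_of_eq m1 hg hne hxp ex hgp).asymm
        (hE.below_of_eq hg m1 (Ne.symm hne) hpy hgp ey)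
    exact h.2.2.2.2.1 (h.2.2.1 ▸ h.2.2.2.1 ▸ (key _ hl.last_mem hl.last_eq_right).symm.trans
      (key _ hr.first_mem hr.first_eq_left))

theorem Env.leaves_le (hE : IsPseudoLines E) (h : T.Env E lo hi) : T.leaves ≤ E.ncard := by
  classical
  have h1 := List.toFinset_card_of_nodup (h.nodup hE)
  rw [List.length_map, length_segs] at h1
  rw [← h1, ← Set.ncard_coe_finset]
  refine Set.ncard_le_ncard (fun f hf => ?_) hE.1
  obtain ⟨σ, hσ, rfl⟩ := List.mem_map.1 (List.mem_toFinset.1 hf)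
  exact (h.of_mem_segs hσ).1

end EnvTree

/-- The AVL bound: a tree of height `h` has at least `2 ^ ⌈h / 2⌉` leaves. Both children of a node
have height at least the larger one minus one, so each has at least `2 ^ ⌊max h k / 2⌋` leaves. -/
theorem two_pow_step {h k m n : ℕ} (hk : 2 ^ ((h + 1) / 2) ≤ m) (hn : 2 ^ ((k + 1) / 2) ≤ n)
    (h1 : h ≤ k + 1) (h2 : k ≤ h + 1) : 2 ^ ((max h k + 1 + 1) / 2) ≤ m + n := by
  rcases le_total h k with hc | hc
  · have e : (max h k + 1 + 1) / 2 = k / 2 + 1 := by omega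
    have i1 : 2 ^ (k / 2) ≤ 2 ^ ((h + 1) / 2) := Nat.pow_le_pow_right (by omega) (by omega)
    have i2 : 2 ^ (k / 2) ≤ 2 ^ ((k + 1) / 2) := Nat.pow_le_pow_right (by omega) (by omega)
    rw [e, pow_succ]; omega
  · have e : (max h k + 1 + 1) / 2 = h / 2 + 1 := by omega
    have i1 : 2 ^ (h / 2) ≤ 2 ^ ((h + 1) / 2) := Nat.pow_le_pow_right (by omega) (by omega)
    have i2 : 2 ^ (h / 2) ≤ 2 ^ ((k + 1) / 2) := Nat.pow_le_pow_right (by omega) (by omega)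
    rw [e, pow_succ]; omega

theorem EnvTree.Env.two_pow_le (h : T.Env E lo hi) : 2 ^ ((T.height + 1) / 2) ≤ T.leaves := by
  induction T generalizing lo hi with
  | leaf s => simp [EnvTree.height, leaves]
  | node n p a b l r ihl ihr =>
    obtain ⟨hl, hr, -, -, -, -, h1, h2⟩ := h
    exact two_pow_step (ihl hl) (ihr hr) h1 h2

theorem le_two_mul_log {h n N : ℕ} (h1 : 2 ^ ((h + 1) / 2) ≤ n) (h2 : n ≤ N) :
    h ≤ 2 * Nat.log 2 (N + 2) := by
  have : (h + 1) / 2 ≤ Nat.log 2 (N + 2) := Nat.le_log_of_pow_le (by omega) (by omega)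
  omega

theorem EnvTree.Env.height_le (hE : IsPseudoLines E) (h : T.Env E lo hi) :
    T.height ≤ 2 * Nat.log 2 (E.ncard + 2) :=
  le_two_mul_log h.two_pow_le (h.leaves_le hE)

namespace EnvTree

/-- Together with `Stores.env`, this lets all constructions work by recursion on the tree with
`Env`, and use `Stores` only where `Ξ` requires it. -/
theorem Env.stores (h : T.Env E lo hi) : T.Stores E lo hi := by
  refine ⟨?_, fun σ hσ => ?_, ?_, ?_, ?_⟩
  · induction T generalizing lo hi with
    | leaf s => trivial
    | node n p a b l r ihl ihr =>
      obtain ⟨hl, hr, h1, h2, h3, h4, h5, h6⟩ := h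
      exact ⟨ihl hl, ihr hr, h4, h5, h6, l.last, r.first, l.getLast?_segs, r.head?_segs,
        hl.last_right, hr.first_left, h1, h2⟩
  · obtain ⟨h1, -, h2, -, h3⟩ := h.of_mem_segs hσ
    exact ⟨h1, h2, h3⟩
  · induction T generalizing lo hi with
    | leaf s => exact List.isChain_singleton _
    | node n p a b l r ihl ihr =>
      obtain ⟨hl, hr, rfl, rfl, hne, -⟩ := h
      refine List.isChain_append.2 ⟨ihl hl, ihr hr, fun σ hσ τ hτ => ?_⟩
      rw [getLast?_segs, Option.mem_some_iff] at hσ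
      rw [head?_segs, Option.mem_some_iff] at hτ
      subst hσ hτ
      exact ⟨hl.last_right.trans hr.first_left.symm, hne⟩
  · rw [head?_segs, Option.map_some, h.first_left]
  · rw [getLast?_segs, Option.map_some, h.last_right]

theorem Stores.env (h : T.Stores E lo hi) : T.Env E lo hi := by
  induction T generalizing lo hi with
  | leaf s =>
    obtain ⟨-, h1, -, h2, h3⟩ := h
    obtain ⟨h4, h5, h6⟩ := h1 s (List.mem_singleton_self s)
    obtain rfl : s.left = lo := by simpa [segs] using h2
    obtain rfl : s.right = hi := by simpa [segs] using h3
    exact ⟨rfl, rfl, h5, h4, h6⟩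
  | node n p a b l r ihl ihr =>
    obtain ⟨⟨v1, v2, v3, v4, v5, σ, τ, v6, v7, v8, v9, v10, v11⟩, h1, h2, h3, h4⟩ := h
    rw [getLast?_segs, Option.some.injEq] at v6
    rw [head?_segs, Option.some.injEq] at v7
    subst v6 v7
    obtain ⟨c1, c2, c3⟩ := List.isChain_append.1 h2
    obtain ⟨-, hne⟩ := c3 _ l.getLast?_segs _ r.head?_segs
    have h3' : (first l).left = lo := by
      simpa [segs, List.head?_append, head?_segs] using h3
    have h4' : (last r).right = hi := by
      simpa [segs, List.getLast?_append, getLast?_segs] using h4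
    refine ⟨ihl ⟨v1, fun σ hσ => h1 σ (List.mem_append_left _ hσ), c1, ?_, ?_⟩,
      ihr ⟨v2, fun σ hσ => h1 σ (List.mem_append_right _ hσ), c2, ?_, ?_⟩, v10, v11,
      v10 ▸ v11 ▸ hne, v3, v4, v5⟩
    · rw [head?_segs, Option.map_some, h3']
    · rw [getLast?_segs, Option.map_some, v8]
    · rw [head?_segs, Option.map_some, v9]
    · rw [getLast?_segs, Option.map_some, h4']

end EnvTree

/-! ### Searching in one envelope tree -/

/-- Completeness is stated for every pseudo-line that agrees with the envelope on some nondegenerate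
interval containing `x`, because `HitAt` allows any segment sequence and not only the one in the
tree. This avoids proving that the sequence is unique. -/
theorem exists_locate (hE : IsPseudoLines E) (h : T.Env E lo hi) {x : ℝ} (h1 : lo < x)
    (h2 : (x : EReal) < hi) :
    ∃ ans : List Curve, ans.Nodup ∧
      (∀ e ∈ ans, ∃ σ ∈ T.segs, σ.line = e ∧ σ.left ≤ x ∧ (x : EReal) ≤ σ.right) ∧
      (∀ e ∈ E, ∀ α β : EReal, α < β → α ≤ x → (x : EReal) ≤ β →
        (∀ y : ℝ, α ≤ y → (y : EReal) ≤ β → e y = lowerEnv E y) → e ∈ ans) ∧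
      RunsWithin prog 23 (.cons (.coord x) T.toVal) (linesVal ans) (60 * T.height + 60) := by
  induction T generalizing lo hi with
  | leaf s =>
    obtain ⟨rfl, rfl, h3, h4, h5⟩ := h
    refine ⟨[s.line], List.nodup_singleton _, ?_, ?_, .of_wp locateCode rfl ⟨rfl, by omega⟩⟩
    · intro e he
      obtain rfl := List.mem_singleton.1 he
      exact ⟨s, List.mem_singleton_self _, rfl, h1.le, h2.le⟩
    · intro e he α β hαβ hα hβ heq
      rw [List.mem_singleton]
      refine hE.eq_of_eqOn he h4 (α := max α s.left) (β := min β s.right) ?_ fun y hy hy' => ?_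
      · rw [max_lt_iff, lt_min_iff, lt_min_iff]
        exact ⟨⟨hαβ, hα.trans_lt h2⟩, h1.trans_le hβ, h3⟩
      · obtain ⟨u1, u2⟩ := max_lt_iff.1 hy
        obtain ⟨u3, u4⟩ := lt_min_iff.1 hy'
        exact ⟨heq y u1.le u3.le, h5 y u2.le u4.le⟩
  | node n p a b l r ihl ihr =>
    obtain ⟨hl, hr, rfl, rfl, hne, rfl, -⟩ := h
    by_cases c1 : (p : EReal) ≤ x
    · by_cases c2 : (x : EReal) ≤ p
      · obtain rfl : p = x := EReal.coe_eq_coe_iff.1 (le_antisymm c1 c2)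
        refine ⟨[l.last.line, r.first.line], ?_, ?_, ?_, .of_wp locateCode rfl ?_⟩
        · simpa using hne
        · intro e he
          rcases List.mem_pair.1 he with rfl | rfl
          · exact ⟨l.last, List.mem_append_left _ l.last_mem_segs, rfl, hl.last_left_lt.le,
              hl.last_right.ge⟩
          · exact ⟨r.first, List.mem_append_right _ r.first_mem_segs, rfl, hr.first_left.le,
              hr.lt_first_right.le⟩
        · intro e he α β hαβ hα hβ heq
          rw [List.mem_pair]
          -- At a vertex the interval reaches to the left of it, or else starts there and reaches to
          -- the right; it thus overlaps one of the two adjacent segments.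
          rcases hα.lt_or_eq with hlt | rfl
          · left
            refine hE.eq_of_eqOn he hl.last_mem (max_lt hlt hl.last_left_lt) fun y hy hy' => ?_
            obtain ⟨u1, u2⟩ := max_lt_iff.1 hy
            exact ⟨heq y u1.le (hy'.le.trans hβ), hl.last_eq u2.le hy'.le⟩
          · right
            refine hE.eq_of_eqOn he hr.first_mem (lt_min hαβ hr.lt_first_right) fun y hy hy' => ?_
            obtain ⟨u1, u2⟩ := lt_min_iff.1 hy'
            exact ⟨heq y hy.le u1.le, hr.first_eq hy.le u2.le⟩
        refine Branch.mk (fun _ => ?_) (fun hn => (hn c1).elim)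
        refine Branch.mk (fun _ => ?_) (fun hn => (hn c2).elim)
        exact ⟨rfl, by omega⟩
      · obtain ⟨ans, g1, g2, g3, g4⟩ := ihr hr (not_le.1 c2) h2
        refine ⟨ans, g1, fun e he => ?_, g3, .of_wp locateCode rfl ?_⟩
        · obtain ⟨σ, hσ, hh⟩ := g2 e he
          exact ⟨σ, List.mem_append_right _ hσ, hh⟩
        refine Branch.mk (fun _ => ?_) (fun hn => (hn c1).elim)
        refine Branch.mk (fun hn => (c2 hn).elim) (fun _ => ?_)
        refine CallRun.intro g4 fun t ht => ?_
        exact ⟨rfl, by simp only [EnvTree.height]; omega⟩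
    · obtain ⟨ans, g1, g2, g3, g4⟩ := ihl hl h1 (not_le.1 c1)
      refine ⟨ans, g1, fun e he => ?_, g3, .of_wp locateCode rfl ?_⟩
      · obtain ⟨σ, hσ, hh⟩ := g2 e he
        exact ⟨σ, List.mem_append_left _ hσ, hh⟩
      refine Branch.mk (fun hn => (c1 hn).elim) (fun _ => ?_)
      refine CallRun.intro g4 fun t ht => ?_
      exact ⟨rfl, by simp only [EnvTree.height]; omega⟩

/-- Bisection with the invariant that the first pseudo-line is not above `m` and the last one is.
Monotonicity along the envelope is not needed to find some such vertex; uniqueness comes in at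
`exists_down`. -/
theorem exists_findBreak (h : T.Env E lo hi) {m : Curve} (h1 : ¬ Below m T.first.line)
    (h2 : Below m T.last.line) :
    ∃ p : ℝ, (∃ a ∈ E, ¬ Below m a ∧ a p = lowerEnv E p) ∧
      (∃ b ∈ E, Below m b ∧ b p = lowerEnv E p) ∧
      RunsWithin prog 10 (.cons T.toVal (.line m)) (.coord p) (60 * T.height) := by
  induction T generalizing lo hi with
  | leaf s => exact (h1 h2).elim
  | node n p a b l r ihl ihr =>
    obtain ⟨hl, hr, rfl, rfl, hne, rfl, -⟩ := h
    by_cases c1 : Below m r.first.line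
    · by_cases c2 : Below m l.last.line
      · obtain ⟨q, g1, g2, g3⟩ := ihl hl h1 c2
        refine ⟨q, g1, g2, .of_wp findBreakCode rfl ?_⟩
        refine Branch.mk (fun _ => ?_) (fun hn => (hn c1).elim)
        refine Branch.mk (fun _ => ?_) (fun hn => (hn c2).elim)
        refine CallRun.intro g3 fun t ht => ?_
        exact ⟨rfl, by simp only [EnvTree.height]; omega⟩
      · refine ⟨p, ⟨_, hl.last_mem, c2, hl.last_eq_right⟩, ⟨_, hr.first_mem, c1, hr.first_eq_left⟩,
          .of_wp findBreakCode rfl ?_⟩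
        refine Branch.mk (fun _ => ?_) (fun hn => (hn c1).elim)
        refine Branch.mk (fun hn => (c2 hn).elim) (fun _ => ?_)
        exact ⟨rfl, by simp only [EnvTree.height]; omega⟩
    · obtain ⟨q, g1, g2, g3⟩ := ihr hr c1 h2
      refine ⟨q, g1, g2, .of_wp findBreakCode rfl ?_⟩
      refine Branch.mk (fun hn => (c1 hn).elim) (fun _ => ?_)
      refine CallRun.intro g3 fun t ht => ?_
      exact ⟨rfl, by simp only [EnvTree.height]; omega⟩

end Envelope

namespace Envelope

open EnvTree

/-! ### The intersection point of two lower envelopes -/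

theorem continuous_lowerEnv {E : Set Curve} (hE : E.Finite) (hne : E.Nonempty) :
    Continuous (lowerEnv E) := by
  have hne' : hE.toFinset.Nonempty := by simpa using hne
  have h : lowerEnv E = fun x => hE.toFinset.inf' hne' fun e : Curve => e x := by
    funext x
    rw [Finset.inf'_eq_csInf_image, hE.coe_toFinset]
    rfl
  rw [h]
  exact Continuous.finset_inf'_apply hne' fun e _ => e.continuous

/-- `A` and `B` are two nonempty families of which the first lies below the second. -/
structure Separated (A B : Set Curve) : Prop where
  lines : IsPseudoLines (A ∪ B)
  left : A.Nonempty
  right : B.Nonempty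
  below : ∀ a ∈ A, ∀ b ∈ B, Below a b

namespace Separated

variable {A B : Set Curve}

theorem lines_left (h : Separated A B) : IsPseudoLines A := h.lines.mono Set.subset_union_left

theorem lines_right (h : Separated A B) : IsPseudoLines B := h.lines.mono Set.subset_union_right

theorem exists_crossAt (h : Separated A B) {a b : Curve} (ha : a ∈ A) (hb : b ∈ B) :
    ∃ c, CrossAt a b c :=
  h.lines.exists_crossAt (.inl ha) (.inr hb) (h.below a ha b hb)

/-- Take `b` lowest in `B` at `x` and `a` lowest in `A` at `y`. Since `b` is not above `a` at `x`,
their only crossing is at or before `x`, so `b` is strictly below `a` at `y`. -/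
theorem lt_of_le (h : Separated A B) {x y : ℝ} (hxy : x < y)
    (hx : lowerEnv B x ≤ lowerEnv A x) : lowerEnv B y < lowerEnv A y := by
  obtain ⟨b, hb, hbx⟩ := exists_eq_lowerEnv h.lines_right.1 h.right x
  obtain ⟨a, ha, hay⟩ := exists_eq_lowerEnv h.lines_left.1 h.left y
  obtain ⟨c, hc⟩ := h.exists_crossAt ha hb
  have h1 : b x ≤ a x := hbx ▸ hx.trans (lowerEnv_le h.lines_left.1 ha x)
  have h2 : c ≤ x := not_lt.1 fun hlt => (hc.1 x hlt).not_ge h1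
  rw [← hay]
  exact (lowerEnv_le h.lines_right.1 hb y).trans_lt (hc.2.2 y (by linarith))

theorem exists_meetAt (h : Separated A B) : ∃ q, MeetAt A B q := by
  have hbot : ∀ᶠ x in atBot, ∀ a ∈ A, ∀ b ∈ B, a x < b x := by
    rw [eventually_all_finite h.lines_left.1]
    intro a ha
    rw [eventually_all_finite h.lines_right.1]
    exact fun b hb => h.below a ha b hb
  have htop : ∀ᶠ x in atTop, ∀ a ∈ A, ∀ b ∈ B, b x < a x := by
    rw [eventually_all_finite h.lines_left.1]
    intro a ha
    rw [eventually_all_finite h.lines_right.1]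
    intro b hb
    obtain ⟨c, hc⟩ := h.exists_crossAt ha hb
    exact (eventually_gt_atTop c).mono fun x hx => hc.2.2 x hx
  obtain ⟨x, hx⟩ := hbot.exists
  obtain ⟨y, hy⟩ := htop.exists
  have hx' : lowerEnv A x ≤ lowerEnv B x := by
    obtain ⟨a, ha, hax⟩ := exists_eq_lowerEnv h.lines_left.1 h.left x
    obtain ⟨b, hb, hbx⟩ := exists_eq_lowerEnv h.lines_right.1 h.right x
    exact hax ▸ hbx ▸ (hx a ha b hb).le
  have hy' : lowerEnv B y ≤ lowerEnv A y := by
    obtain ⟨a, ha, hay⟩ := exists_eq_lowerEnv h.lines_left.1 h.left y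
    obtain ⟨b, hb, hby⟩ := exists_eq_lowerEnv h.lines_right.1 h.right y
    exact hay ▸ hby ▸ (hy a ha b hb).le
  obtain ⟨q, hq⟩ := intermediate_value_univ₂ (continuous_lowerEnv h.lines_left.1 h.left)
    (continuous_lowerEnv h.lines_right.1 h.right) hx' hy'
  refine ⟨q, fun z hz => ?_, hq, fun z hz => h.lt_of_le hz hq.ge⟩
  by_contra hn
  exact (h.lt_of_le hz (not_lt.1 hn)).ne' hq

end Separated

variable {A B : Set Curve} {q : ℝ}

theorem MeetAt.le_of_le (h : MeetAt A B q) {x : ℝ} (hx : lowerEnv A x ≤ lowerEnv B x) : x ≤ q :=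
  not_lt.1 fun hlt => (h.2.2 x hlt).not_ge hx

theorem MeetAt.ge_of_ge (h : MeetAt A B q) {x : ℝ} (hx : lowerEnv B x ≤ lowerEnv A x) : q ≤ x :=
  not_lt.1 fun hlt => (h.1 x hlt).not_ge hx

theorem MeetAt.lt_of_lt (h : MeetAt A B q) {x : ℝ} (hx : lowerEnv A x < lowerEnv B x) : x < q :=
  not_le.1 fun hle => by
    rcases hle.lt_or_eq with hlt | rfl
    exacts [(h.2.2 x hlt).asymm hx, hx.ne h.2.1]

theorem MeetAt.gt_of_gt (h : MeetAt A B q) {x : ℝ} (hx : lowerEnv B x < lowerEnv A x) : q < x :=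
  not_le.1 fun hle => by
    rcases hle.lt_or_eq with hlt | rfl
    exacts [(h.1 x hlt).asymm hx, hx.ne' h.2.1]

end Envelope

namespace Envelope

open EnvTree

/-! ### The simultaneous search for the intersection point -/

/-- A stack of tentative moves. An entry holds the abscissa of the node from which the move was
made, the pseudo-line that supports the envelope on the side of `p` that was chosen, and the
subtree that was not chosen. -/
inductive Stack where
  | base (m : Curve)
  | push (p : ℝ) (m : Curve) (t : EnvTree) (s : Stack)

namespace Stack

/-- The innermost tentative bound; `z` is the bound at the bottom of the stack. -/
noncomputable def top (z : EReal) : Stack → EReal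
  | base _ => z
  | push p _ _ _ => p

def line : Stack → Curve
  | base m => m
  | push _ m _ _ => m

def length : Stack → ℕ
  | base _ => 0
  | push _ _ _ s => s.length + 1

/-- The representation of a stack without the abscissa and the pseudo-line at its top. -/
noncomputable def rest (z : EReal) : Stack → Val
  | base _ => .nil
  | push _ _ t s => .cons t.toVal (.cons (.coord (s.top z)) (.cons (.line s.line) (s.rest z)))

noncomputable def toVal (z : EReal) (s : Stack) : Val :=
  .cons (.coord (s.top z)) (.cons (.line s.line) (s.rest z))

/-- The entries of a stack of tentative moves to the right in an envelope tree of `A`. -/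
def OkLeft (A : Set Curve) : Stack → Prop
  | base _ => True
  | push p _ t s => t.Env A (s.top ⊥) p ∧ t.first.line = s.line ∧ s.OkLeft A

/-- The entries of a stack of tentative moves to the left in an envelope tree of `B`. -/
def OkRight (B : Set Curve) : Stack → Prop
  | base _ => True
  | push p _ t s => t.Env B p (s.top ⊤) ∧ t.last.line = s.line ∧ s.OkRight B

/-- The potential of the current subtree `u` with a stack of tentative moves to the right. -/
noncomputable def potLeft (q : ℝ) (u : EnvTree) : Stack → ℕ
  | base _ => 6 * u.height
  | push p _ t s => if q < p then 2 + potLeft q t s else 6 * u.height + 2 * (s.length + 1)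

/-- The potential of the current subtree `v` with a stack of tentative moves to the left. -/
noncomputable def potRight (q : ℝ) (v : EnvTree) : Stack → ℕ
  | base _ => 6 * v.height
  | push p _ t s => if p < q then 2 + potRight q t s else 6 * v.height + 2 * (s.length + 1)

variable {q : ℝ} {s : Stack}

theorem potLeft_of_le (u : EnvTree) (h : s.top ⊥ ≤ q) :
    potLeft q u s = 6 * u.height + 2 * s.length := by
  cases s with
  | base m => rfl
  | push p m t s => exact if_neg (not_lt.2 (EReal.coe_le_coe_iff.1 h))

theorem potRight_of_le (v : EnvTree) (h : q ≤ s.top ⊤) :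
    potRight q v s = 6 * v.height + 2 * s.length := by
  cases s with
  | base m => rfl
  | push p m t s => exact if_neg (not_lt.2 (EReal.coe_le_coe_iff.1 h))

/-- Under a wrong move the current subtree is irrelevant: whatever is done in it will be discarded.
-/
theorem potLeft_of_lt (u u' : EnvTree) (h : q < s.top ⊥) : potLeft q u s = potLeft q u' s := by
  cases s with
  | base m => exact (not_lt_bot h).elim
  | push p m t s =>
    have h : q < p := EReal.coe_lt_coe_iff.1 h
    simp only [potLeft, if_pos h]

theorem potRight_of_lt (v v' : EnvTree) (h : s.top ⊤ < q) :
    potRight q v s = potRight q v' s := by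
  cases s with
  | base m => exact (not_top_lt h).elim
  | push p m t s =>
    have h : p < q := EReal.coe_lt_coe_iff.1 h
    simp only [potRight, if_pos h]

end Stack

open Stack

/-- The state of the search for the intersection point above `q`: the subtree `u` of the first tree
covers the abscissas from the top of the stack `s` to `U`, and the subtree `v` of the second tree
those from `V` to the top of the stack `w`. -/
structure Searching (A B : Set Curve) (q : ℝ) (u : EnvTree) (s : Stack) (v : EnvTree) (w : Stack)
    (U V : EReal) : Prop where
  envLeft : u.Env A (s.top ⊥) U
  first : u.first.line = s.line
  okLeft : s.OkLeft A
  le : q ≤ U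
  envRight : v.Env B V (w.top ⊤)
  last : v.last.line = w.line
  okRight : w.OkRight B
  ge : V ≤ q
  top_le : s.top ⊥ ≤ w.top ⊤

/-- The input of the search. -/
noncomputable def searchVal (u : EnvTree) (s : Stack) (v : EnvTree) (w : Stack) : Val :=
  .cons (.cons u.toVal (s.toVal ⊥)) (.cons v.toVal (w.toVal ⊤))

open Classical in
/-- A bound for the number of calls after a call of `moveRightCode`. -/
noncomputable def measureRight (q : ℝ) (u : EnvTree) (s : Stack) (v : EnvTree) (w : Stack) : ℕ :=
  potLeft q u s + potRight q v w +
    if w.top ⊤ < q then 3 else if v.height = 0 ∧ s.top ⊥ ≤ q then 1 else 0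

open Classical in
/-- A bound for the number of calls after a call of `moveLeftCode`. -/
noncomputable def measureLeft (q : ℝ) (u : EnvTree) (s : Stack) (v : EnvTree) (w : Stack) : ℕ :=
  potLeft q u s + potRight q v w +
    if q < s.top ⊥ then 3 else if u.height = 0 ∧ q ≤ w.top ⊤ then 1 else 0

section Measure

variable {q : ℝ} {u v v' u' : EnvTree} {s w w' s' : Stack}

/-- If the bound at the top of `w` is right, a move in `v` lowers the potential by at least four,
which covers any bonus of up to three in the new measure. If it is wrong, the move may push and
raise the potential by two, but the bonus of three is given up: the other stack is then right, as
`s.top ⊥ ≤ w.top ⊤`. -/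
theorem measureLeft_lt_measureRight (hsw : s.top ⊥ ≤ w.top ⊤)
    (h1 : q ≤ w.top ⊤ → potRight q v' w' + 4 ≤ potRight q v w)
    (h2 : w.top ⊤ < q → potRight q v' w' ≤ potRight q v w + 2 ∧ w'.top ⊤ < q) :
    measureLeft q u s v' w' < measureRight q u s v w := by
  unfold measureLeft measureRight
  rcases le_or_gt (q : EReal) (w.top ⊤) with hc | hc
  · have := h1 hc
    split_ifs <;> omega
  · obtain ⟨i1, i2⟩ := h2 hc
    rw [if_pos hc, if_neg (not_lt.2 (hsw.trans hc.le)), if_neg fun h => h.2.not_gt i2]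
    omega

theorem measureRight_lt_measureLeft (hsw : s.top ⊥ ≤ w.top ⊤)
    (h1 : s.top ⊥ ≤ q → potLeft q u' s' + 4 ≤ potLeft q u s)
    (h2 : q < s.top ⊥ → potLeft q u' s' ≤ potLeft q u s + 2 ∧ q < s'.top ⊥) :
    measureRight q u' s' v w < measureLeft q u s v w := by
  unfold measureLeft measureRight
  rcases le_or_gt (s.top ⊥) (q : EReal) with hc | hc
  · have := h1 hc
    split_ifs <;> omega
  · obtain ⟨i1, i2⟩ := h2 hc
    rw [if_pos hc, if_neg (not_lt.2 (hc.le.trans hsw)), if_neg fun h => h.2.not_gt i2]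
    omega

theorem measureRight_popLeft {p : ℝ} {m : Curve} {t : EnvTree} (hsw : (p : EReal) ≤ w.top ⊤)
    (h : q < p) : measureRight q t s v w < measureRight q u (push p m t s) v w := by
  have h' : (q : EReal) < p := EReal.coe_lt_coe_iff.2 h
  unfold measureRight
  have h'' : ¬ (v.height = 0 ∧ (push p m t s).top ⊥ ≤ q) := fun hh => hh.2.not_gt h'
  rw [if_neg (not_lt.2 (h'.le.trans hsw)), if_neg h'', potLeft, if_pos h]
  split_ifs <;> omega

theorem measureLeft_popRight {p : ℝ} {m : Curve} {t : EnvTree} (hsw : s.top ⊥ ≤ p)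
    (h : p < q) : measureLeft q u s t w < measureLeft q u s v (push p m t w) := by
  have h' : (p : EReal) < q := EReal.coe_lt_coe_iff.2 h
  unfold measureLeft
  have h'' : ¬ (u.height = 0 ∧ q ≤ (push p m t w).top ⊤) := fun hh => hh.2.not_gt h'
  rw [if_neg (not_lt.2 (hsw.trans h'.le)), if_neg h'', potRight, if_pos h]
  split_ifs <;> omega

/-- Used when both subtrees are leaves. The turn does not change, so the bonus of three may persist,
but the discarded entry releases two units. -/
theorem measureRight_popRight {p : ℝ} {m : Curve} {t : EnvTree}
    (h : p < q) : measureRight q u s t w + 2 ≤ measureRight q u s v (push p m t w) := by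
  have h' : (p : EReal) < q := EReal.coe_lt_coe_iff.2 h
  have h'' : (push p m t w).top ⊤ < q := h'
  unfold measureRight
  rw [if_pos h'', potRight, if_pos h]
  split_ifs <;> omega

theorem measureLeft_popLeft {p : ℝ} {m : Curve} {t : EnvTree}
    (h : q < p) : measureLeft q t s v w + 2 ≤ measureLeft q u (push p m t s) v w := by
  have h' : (q : EReal) < p := EReal.coe_lt_coe_iff.2 h
  have h'' : q < (push p m t s).top ⊥ := h'
  unfold measureLeft
  rw [if_pos h'', potLeft, if_pos h]
  split_ifs <;> omega

end Measure

variable {A B : Set Curve} {q : ℝ} {u v : EnvTree} {s w : Stack} {U V : EReal}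

/-- The conclusive outcome of a test: `b` is on the envelope of `B` at `p` and `a` passes below it,
so the envelope of `A` is strictly lower there. -/
theorem MeetAt.lt_of_crossAt (hq : MeetAt A B q) (hA : A.Finite) {a b : Curve} {c p : ℝ} (ha : a ∈ A)
    (hc : CrossAt a b c) (hb : b p = lowerEnv B p) (hpc : p < c) : p < q :=
  hq.lt_of_lt ((lowerEnv_le hA ha p).trans_lt ((hc.1 p hpc).trans_eq hb))

theorem MeetAt.gt_of_crossAt (hq : MeetAt A B q) (hB : B.Finite) {a b : Curve} {c p : ℝ} (hb : b ∈ B)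
    (hc : CrossAt a b c) (ha : a p = lowerEnv A p) (hcp : c < p) : q < p :=
  hq.gt_of_gt ((lowerEnv_le hB hb p).trans_lt ((hc.2.2 p hcp).trans_eq ha))

namespace Searching

/-- A refuted tentative move becomes definite knowledge: its abscissa is now a proven right bound
for the subtree that was set aside. -/
theorem popLeft {p : ℝ} {m : Curve} {t : EnvTree} (h : Searching A B q u (push p m t s) v w U V)
    (hq : q < p) : Searching A B q t s v w p V :=
  ⟨h.okLeft.1, h.okLeft.2.1, h.okLeft.2.2, (EReal.coe_lt_coe_iff.2 hq).le, h.envRight, h.last,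
    h.okRight, h.ge, h.okLeft.1.lt.le.trans h.top_le⟩

theorem popRight {p : ℝ} {m : Curve} {t : EnvTree} (h : Searching A B q u s v (push p m t w) U V)
    (hq : p < q) : Searching A B q u s t w U p :=
  ⟨h.envLeft, h.first, h.okLeft, h.le, h.okRight.1, h.okRight.2.1, h.okRight.2.2,
    (EReal.coe_lt_coe_iff.2 hq).le, h.top_le.trans h.okRight.1.lt.le⟩

section Inner

variable {n : ℕ} {p : ℝ} {a b : Curve} {l r : EnvTree}

theorem right (h : Searching A B q u s (node n p a b l r) w U V) (hq : p < q) :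
    Searching A B q u s r w U p :=
  ⟨h.envLeft, h.first, h.okLeft, h.le, h.envRight.2.1, h.last, h.okRight,
    (EReal.coe_lt_coe_iff.2 hq).le, h.top_le⟩

theorem pushRight (h : Searching A B q u s (node n p a b l r) w U V) (hp : s.top ⊥ ≤ p) :
    Searching A B q u s l (push p a r w) U V :=
  ⟨h.envLeft, h.first, h.okLeft, h.le, h.envRight.1, h.envRight.2.2.1,
    ⟨h.envRight.2.1, h.last, h.okRight⟩, h.ge, hp⟩

theorem left (h : Searching A B q (node n p a b l r) s v w U V) (hq : q < p) :
    Searching A B q l s v w p V :=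
  ⟨h.envLeft.1, h.first, h.okLeft, (EReal.coe_lt_coe_iff.2 hq).le, h.envRight, h.last, h.okRight,
    h.ge, h.top_le⟩

theorem pushLeft (h : Searching A B q (node n p a b l r) s v w U V) (hp : p ≤ w.top ⊤) :
    Searching A B q r (push p b l s) v w U V :=
  ⟨h.envLeft.2.1, h.envLeft.2.2.2.1, ⟨h.envLeft.1, h.first, h.okLeft⟩, h.le, h.envRight, h.last,
    h.okRight, h.ge, hp⟩

theorem measure_right (h : Searching A B q u s (node n p a b l r) w U V) :
    measureLeft q u s r w < measureRight q u s (node n p a b l r) w := by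
  refine measureLeft_lt_measureRight h.top_le (fun hc => ?_) (fun hc => ⟨?_, hc⟩)
  · rw [potRight_of_le _ hc, potRight_of_le _ hc]
    simp only [EnvTree.height]; omega
  · rw [potRight_of_lt (node n p a b l r) r hc]; omega

theorem measure_pushRight (h : Searching A B q u s (node n p a b l r) w U V) :
    measureLeft q u s l (push p a r w) < measureRight q u s (node n p a b l r) w := by
  refine measureLeft_lt_measureRight h.top_le (fun hc => ?_) (fun hc => ⟨?_, ?_⟩)
  · rw [potRight_of_le _ hc, potRight, potRight_of_le _ hc]
    simp only [EnvTree.height]; split_ifs <;> omega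
  · have : p < q := EReal.coe_lt_coe_iff.1 (h.envRight.2.1.lt.trans hc)
    rw [potRight, if_pos this, potRight_of_lt (node n p a b l r) r hc]; omega
  · exact h.envRight.2.1.lt.trans hc

theorem measure_left (h : Searching A B q (node n p a b l r) s v w U V) :
    measureRight q l s v w < measureLeft q (node n p a b l r) s v w := by
  refine measureRight_lt_measureLeft h.top_le (fun hc => ?_) (fun hc => ⟨?_, hc⟩)
  · rw [potLeft_of_le _ hc, potLeft_of_le _ hc]
    simp only [EnvTree.height]; omega
  · rw [potLeft_of_lt (node n p a b l r) l hc]; omega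

theorem measure_pushLeft (h : Searching A B q (node n p a b l r) s v w U V) :
    measureRight q r (push p b l s) v w < measureLeft q (node n p a b l r) s v w := by
  refine measureRight_lt_measureLeft h.top_le (fun hc => ?_) (fun hc => ⟨?_, ?_⟩)
  · rw [potLeft_of_le _ hc, potLeft, potLeft_of_le _ hc]
    simp only [EnvTree.height]; split_ifs <;> omega
  · have : q < p := EReal.coe_lt_coe_iff.1 (hc.trans h.envLeft.1.lt)
    rw [potLeft, if_pos this, potLeft_of_lt (node n p a b l r) l hc]; omega
  · exact hc.trans h.envLeft.1.lt

end Inner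

theorem line_mem_left (h : Searching A B q u s v w U V) : s.line ∈ A := h.first ▸ h.envLeft.first_mem

theorem line_mem_right (h : Searching A B q u s v w U V) : w.line ∈ B := h.last ▸ h.envRight.last_mem

/-- If `v` is a leaf, then the test at the top of the stack `s` is conclusive. -/
theorem top_le_of_leaf {σ : Seg} (h : Searching A B q u s (.leaf σ) w U V) (hq : MeetAt A B q)
    {c : ℝ} (hc : CrossAt s.line w.line c) (hsc : s.top ⊥ ≤ c) : s.top ⊥ ≤ q := by
  cases s with
  | base m => exact bot_le
  | push p m t s =>
    rcases le_or_gt V p with hV | hV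
    · have h1 : m p = lowerEnv A p := by
        have := h.envLeft.first_eq_left
        rwa [h.first] at this
      have h2 : w.line p = lowerEnv B p := by
        rw [← h.last]
        exact h.envRight.last_eq (h.envRight.1 ▸ hV) h.top_le
      have h3 : p ≤ c := EReal.coe_le_coe_iff.1 hsc
      refine EReal.coe_le_coe_iff.2 (hq.le_of_le ?_)
      rw [← h1, ← h2]
      rcases h3.lt_or_eq with h3 | rfl
      exacts [(hc.1 p h3).le, hc.2.1.le]
    · exact hV.le.trans h.ge

theorem le_top_of_leaf {σ : Seg} (h : Searching A B q (.leaf σ) s v w U V) (hq : MeetAt A B q)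
    {c : ℝ} (hc : CrossAt s.line w.line c) (hsc : c ≤ w.top ⊤) : q ≤ w.top ⊤ := by
  cases w with
  | base m => exact le_top
  | push p m t w =>
    rcases le_or_gt (p : EReal) U with hU | hU
    · have h1 : m p = lowerEnv B p := by
        have := h.envRight.last_eq_right
        rwa [h.last] at this
      have h2 : s.line p = lowerEnv A p := by
        rw [← h.first]
        exact h.envLeft.first_eq h.top_le (h.envLeft.2.1.symm ▸ hU)
      have h3 : c ≤ p := EReal.coe_le_coe_iff.1 hsc
      refine EReal.coe_le_coe_iff.2 (hq.ge_of_ge ?_)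
      rw [← h1, ← h2]
      rcases h3.lt_or_eq with h3 | rfl
      exacts [(hc.2.2 p h3).le, hc.2.1.ge]
    · exact h.le.trans hU.le

/-- The two passed tests certify both tentative bounds, so `q` lies in both segments and their
supporting pseudo-lines cross exactly there. -/
theorem eq_of_leaf {σ τ : Seg} (h : Searching A B q (.leaf σ) s (.leaf τ) w U V)
    (hq : MeetAt A B q) {c : ℝ} (hc : CrossAt s.line w.line c) (hsc : s.top ⊥ ≤ c)
    (hcw : c ≤ w.top ⊤) : c = q := by
  have h1 := h.top_le_of_leaf hq hc hsc
  have h2 := h.le_top_of_leaf hq hc hcw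
  have h3 : s.line q = lowerEnv A q := by
    rw [← h.first]
    exact h.envLeft.first_eq h1 (h.envLeft.2.1.symm ▸ h.le)
  have h4 : w.line q = lowerEnv B q := by
    rw [← h.last]
    exact h.envRight.last_eq (h.envRight.1 ▸ h.ge) h2
  have h5 : s.line q = w.line q := by rw [h3, h4, hq.2.1]
  rcases lt_trichotomy c q with hlt | heq | hgt
  exacts [((hc.2.2 q hlt).ne' h5).elim, heq, ((hc.1 q hgt).ne h5).elim]

/-- A crossing left of the top shows that the stack is not empty, since its base bound is `⊥`, and
that the top move was wrong. -/
theorem exists_popLeft (h : Searching A B q u s v w U V) (hq : MeetAt A B q) (hB : B.Finite)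
    {b : Curve} (hb : b ∈ B) {c : ℝ} (hc : CrossAt s.line b c) (hcs : c < s.top ⊥) :
    ∃ p m t s', s = push p m t s' ∧ q < p := by
  cases s with
  | base m => exact (not_lt_bot hcs).elim
  | push p m t s =>
    refine ⟨p, m, t, s, rfl, hq.gt_of_crossAt hB hb hc ?_ (EReal.coe_lt_coe_iff.1 hcs)⟩
    have := h.envLeft.first_eq_left
    rwa [h.first] at this

theorem exists_popRight (h : Searching A B q u s v w U V) (hq : MeetAt A B q) (hA : A.Finite)
    {a : Curve} (ha : a ∈ A) {c : ℝ} (hc : CrossAt a w.line c) (hcs : w.top ⊤ < c) :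
    ∃ p m t w', w = push p m t w' ∧ p < q := by
  cases w with
  | base m => exact (not_top_lt hcs).elim
  | push p m t s =>
    refine ⟨p, m, t, s, rfl, hq.lt_of_crossAt hA ha hc ?_ (EReal.coe_lt_coe_iff.1 hcs)⟩
    have := h.envRight.last_eq_right
    rwa [h.last] at this

end Searching

end Envelope

/-! ### Correctness and running time of the simultaneous search -/

namespace Envelope

open EnvTree Stack

variable {A B : Set Curve} {q : ℝ} {u v : EnvTree} {s w : Stack} {U V : EReal}

theorem CrossAt.crossRun {f g : Curve} {c : ℝ} {Q : ℝ → Prop} (h : CrossAt f g c) (hQ : Q c) :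
    CrossRun f g Q := by
  refine ⟨c, ⟨h.2.1, fun y hy => ?_⟩, hQ⟩
  rcases lt_trichotomy y c with hlt | heq | hgt
  exacts [((h.1 y hlt).ne hy).elim, heq, ((h.2.2 y hgt).ne' hy).elim]

/-- The two step functions call each other, so one induction on the measure treats both. Each call
decreases the measure of the function entered and costs at most 100 steps of its own. -/
theorem Searching.runs_aux (hS : Separated A B) (hq : MeetAt A B q) (N : ℕ) :
    ∀ {u v : EnvTree} {s w : Stack} {U V : EReal}, Searching A B q u s v w U V →
      (measureRight q u s v w = N →
        RunsWithin prog 11 (searchVal u s v w) (.coord q) (100 * (N + 1))) ∧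
      (measureLeft q u s v w = N →
        RunsWithin prog 12 (searchVal u s v w) (.coord q) (100 * (N + 1))) := by
  induction N using Nat.strong_induction_on with
  | _ N ih =>
  intro u v s w U V h
  have hA := hS.lines_left.1
  have hB := hS.lines_right.1
  obtain ⟨d, hd⟩ := hS.exists_crossAt h.line_mem_left h.line_mem_right
  have popL : d < s.top ⊥ → measureRight q u s v w = N → ∃ p m t s', s = push p m t s' ∧
      RunsWithin prog 11 (searchVal t s' v w) (.coord q) (100 * N) := by
    intro hlt hN
    obtain ⟨p, m, t, s, rfl, hqp⟩ := h.exists_popLeft hq hB h.line_mem_right hd hlt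
    have hm := hN ▸ measureRight_popLeft (u := u) (m := m) (t := t) (s := s) (v := v) h.top_le hqp
    exact ⟨p, m, t, s, rfl, ((ih _ hm (h.popLeft hqp)).1 rfl).mono (by omega)⟩
  have popR : w.top ⊤ < d → measureLeft q u s v w = N → ∃ p m t w', w = push p m t w' ∧
      RunsWithin prog 12 (searchVal u s t w') (.coord q) (100 * N) := by
    intro hlt hN
    obtain ⟨p, m, t, w, rfl, hqp⟩ := h.exists_popRight hq hA h.line_mem_left hd hlt
    have hm := hN ▸ measureLeft_popRight (u := u) (m := m) (t := t) (w := w) (v := v) h.top_le hqp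
    exact ⟨p, m, t, w, rfl, ((ih _ hm (h.popRight hqp)).2 rfl).mono (by omega)⟩
  constructor
  · intro hN
    cases v with
    | node n p a b l r =>
      obtain ⟨c, hc⟩ := hS.exists_crossAt h.line_mem_left (h.envRight.2.2.1 ▸ h.envRight.1.last_mem)
      have hap : a p = lowerEnv B p := h.envRight.2.2.1 ▸ h.envRight.1.last_eq_right
      have ha : a ∈ B := h.envRight.2.2.1 ▸ h.envRight.1.last_mem
      refine .of_wp moveRightCode rfl ?_
      refine hc.crossRun ?_
      refine Branch.mk (fun hcp => ?_) (fun hcp => ?_)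
      · refine Branch.mk (fun hsp => ?_) (fun hsp => ?_)
        · have hm := hN ▸ h.measure_pushRight
          refine CallRun.intro ((ih _ hm (h.pushRight hsp)).2 rfl) fun t ht => ⟨rfl, ?_⟩
          omega
        · obtain ⟨p', m, t, s, rfl, hqp⟩ := h.exists_popLeft hq hB ha hc
            (hcp.trans_lt (not_le.1 hsp))
          have hm := hN ▸ measureRight_popLeft (u := u) (m := m) (t := t) (s := s)
            (v := .node n p a b l r) h.top_le hqp
          refine CallRun.intro ((ih _ hm (h.popLeft hqp)).1 rfl) fun t ht => ⟨rfl, ?_⟩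
          omega
      · have hpq : p < q := hq.lt_of_crossAt hA h.line_mem_left hc hap
          (EReal.coe_lt_coe_iff.1 (not_le.1 hcp))
        have hm := hN ▸ h.measure_right
        refine CallRun.intro ((ih _ hm (h.right hpq)).2 rfl) fun t ht => ⟨rfl, ?_⟩
        omega
    | leaf τ =>
      refine .of_wp moveRightCode rfl ?_
      refine hd.crossRun ?_
      refine Branch.mk (fun hsd => ?_) (fun hsd => ?_)
      · have hsq := h.top_le_of_leaf hq hd hsd
        cases u with
        | node n p a b l r =>
          -- Nothing changes here but the turn. The bonus of at least one for a leaf `v` whose test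
          -- certified the top of `s` pays for this call.
          have hm : measureLeft q (.node n p a b l r) s (.leaf τ) w < N := by
            rw [← hN]
            unfold measureLeft measureRight
            rw [if_neg (not_lt.2 hsq), if_neg (by simp [EnvTree.height])]
            have : (EnvTree.leaf τ).height = 0 ∧ s.top ⊥ ≤ q := ⟨rfl, hsq⟩
            rw [if_pos this]
            split_ifs <;> omega
          refine CallRun.intro ((ih _ hm h).2 rfl) fun t ht => ⟨rfl, ?_⟩
          omega
        | leaf σ =>
          refine Branch.mk (fun hdw => ?_) (fun hdw => ?_)
          · refine And.intro ?_ (by omega)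
            rw [h.eq_of_leaf hq hd hsd hdw]
          · obtain ⟨p, m, t, w, rfl, hqp⟩ := h.exists_popRight hq hA h.line_mem_left hd
              (not_le.1 hdw)
            have hm := hN ▸ measureRight_popRight (u := .leaf σ) (s := s) (m := m) (t := t) (w := w)
              (v := .leaf τ) hqp
            refine CallRun.intro ((ih _ (by omega) (h.popRight hqp)).1 rfl) fun t ht => ⟨rfl, ?_⟩
            omega
      · obtain ⟨p, m, t, s, rfl, hr⟩ := popL (not_le.1 hsd) hN
        refine CallRun.intro hr fun t ht => ⟨rfl, ?_⟩
        omega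
  · intro hN
    cases u with
    | node n p a b l r =>
      have hb : b ∈ A := h.envLeft.2.2.2.1 ▸ h.envLeft.2.1.first_mem
      have hbp : b p = lowerEnv A p := h.envLeft.2.2.2.1 ▸ h.envLeft.2.1.first_eq_left
      obtain ⟨c, hc⟩ := hS.exists_crossAt hb h.line_mem_right
      refine .of_wp moveLeftCode rfl ?_
      refine hc.crossRun ?_
      refine Branch.mk (fun hcp => ?_) (fun hcp => ?_)
      · refine Branch.mk (fun hsp => ?_) (fun hsp => ?_)
        · have hm := hN ▸ h.measure_pushLeft
          refine CallRun.intro ((ih _ hm (h.pushLeft hsp)).1 rfl) fun t ht => ⟨rfl, ?_⟩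
          omega
        · obtain ⟨p', m, t, w, rfl, hqp⟩ := h.exists_popRight hq hA hb hc
            ((not_le.1 hsp).trans_le hcp)
          have hm := hN ▸ measureLeft_popRight (u := .node n p a b l r) (m := m) (t := t) (w := w)
            (v := v) h.top_le hqp
          refine CallRun.intro ((ih _ hm (h.popRight hqp)).2 rfl) fun t ht => ⟨rfl, ?_⟩
          omega
      · have hpq : q < p := hq.gt_of_crossAt hB h.line_mem_right hc hbp
          (EReal.coe_lt_coe_iff.1 (not_le.1 hcp))
        have hm := hN ▸ h.measure_left
        refine CallRun.intro ((ih _ hm (h.left hpq)).1 rfl) fun t ht => ⟨rfl, ?_⟩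
        omega
    | leaf σ =>
      refine .of_wp moveLeftCode rfl ?_
      refine hd.crossRun ?_
      refine Branch.mk (fun hdw => ?_) (fun hdw => ?_)
      · have hqw := h.le_top_of_leaf hq hd hdw
        cases v with
        | node n p a b l r =>
          have hm : measureRight q (.leaf σ) s (.node n p a b l r) w < N := by
            rw [← hN]
            unfold measureLeft measureRight
            rw [if_neg (not_lt.2 hqw), if_neg (by simp [EnvTree.height])]
            have : (EnvTree.leaf σ).height = 0 ∧ q ≤ w.top ⊤ := ⟨rfl, hqw⟩
            rw [if_pos this]
            split_ifs <;> omega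
          refine CallRun.intro ((ih _ hm h).1 rfl) fun t ht => ⟨rfl, ?_⟩
          omega
        | leaf τ =>
          refine Branch.mk (fun hsd => ?_) (fun hsd => ?_)
          · refine And.intro ?_ (by omega)
            rw [h.eq_of_leaf hq hd hsd hdw]
          · obtain ⟨p, m, t, s, rfl, hqp⟩ := h.exists_popLeft hq hB h.line_mem_right hd
              (not_le.1 hsd)
            have hm := hN ▸ measureLeft_popLeft (u := .leaf σ) (s := s) (m := m) (t := t) (w := w)
              (v := .leaf τ) hqp
            refine CallRun.intro ((ih _ (by omega) (h.popLeft hqp)).2 rfl) fun t ht => ⟨rfl, ?_⟩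
            omega
      · obtain ⟨p, m, t, w, rfl, hr⟩ := popR (not_le.1 hdw) hN
        refine CallRun.intro hr fun t ht => ⟨rfl, ?_⟩
        omega

theorem runs_meet (hS : Separated A B) (hq : MeetAt A B q) {S T : EnvTree} (hA : S.Env A ⊥ ⊤)
    (hB : T.Env B ⊥ ⊤) :
    RunsWithin prog 13 (.cons S.toVal T.toVal) (.coord q)
      (1000 * (S.height + T.height + 1)) := by
  have h : Searching A B q S (.base S.first.line) T (.base T.last.line) ⊤ ⊥ :=
    ⟨hA, rfl, trivial, le_top, hB, rfl, trivial, bot_le, bot_le⟩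
  have hm : measureRight q S (.base S.first.line) T (.base T.last.line) ≤
      6 * S.height + 6 * T.height + 3 := by
    unfold measureRight
    simp only [potLeft, potRight]
    split_ifs <;> omega
  refine .of_wp meetCode rfl ?_
  refine CallRun.intro (runs_first _) fun t ht => ?_
  refine CallRun.intro (runs_last _) fun t ht => ?_
  refine CallRun.intro ((h.runs_aux hS hq _).1 rfl) fun t ht => ⟨rfl, ?_⟩
  omega

end Envelope

namespace Envelope

open EnvTree

/-! ### Nodes of the tree `Ξ` -/

section Union

variable {A B : Set Curve} {T : EnvTree} {lo hi : EReal} {q : ℝ}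

/-- Membership is required only for pseudo-lines seen strictly inside the interval. This matters at
the meeting point, where members of both families lie on the envelope of the union. -/
theorem EnvTree.Env.congr {E E' : Set Curve} (h : T.Env E lo hi)
    (heq : ∀ x : ℝ, lo ≤ x → (x : EReal) ≤ hi → lowerEnv E' x = lowerEnv E x)
    (hmem : ∀ e ∈ E, ∀ x : ℝ, lo < x → (x : EReal) < hi → e x = lowerEnv E x → e ∈ E') :
    T.Env E' lo hi := by
  induction T generalizing lo hi with
  | leaf s =>
    obtain ⟨rfl, rfl, h3, h4, h5⟩ := h
    obtain ⟨x, hx, hx'⟩ := EReal.lt_iff_exists_real_btwn.1 h3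
    exact ⟨rfl, rfl, h3, hmem _ h4 x hx hx' (h5 x hx.le hx'.le), fun y hy hy' =>
      (h5 y hy hy').trans (heq y hy hy').symm⟩
  | node n p a b l r ihl ihr =>
    obtain ⟨hl, hr, h3⟩ := h
    exact ⟨ihl hl (fun x hx hx' => heq x hx (hx'.trans hr.lt.le))
        (fun e he x hx hx' => hmem e he x hx (hx'.trans hr.lt)),
      ihr hr (fun x hx hx' => heq x (hl.lt.le.trans hx) hx')
        (fun e he x hx hx' => hmem e he x (hl.lt.trans hx) hx'), h3⟩

namespace Separated

theorem lowerEnv_union (h : Separated A B) (x : ℝ) :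
    lowerEnv (A ∪ B) x = min (lowerEnv A x) (lowerEnv B x) := by
  unfold lowerEnv
  rw [Set.image_union]
  exact csInf_union (h.lines_left.1.image _).bddBelow (h.left.image _)
    (h.lines_right.1.image _).bddBelow (h.right.image _)

theorem lowerEnv_union_of_le (h : Separated A B) (hq : MeetAt A B q) {x : ℝ} (hx : x ≤ q) :
    lowerEnv (A ∪ B) x = lowerEnv A x := by
  rw [h.lowerEnv_union, min_eq_left]
  rcases hx.lt_or_eq with hx | rfl
  exacts [(hq.1 x hx).le, hq.2.1.le]

theorem lowerEnv_union_of_ge (h : Separated A B) (hq : MeetAt A B q) {x : ℝ} (hx : q ≤ x) :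
    lowerEnv (A ∪ B) x = lowerEnv B x := by
  rw [h.lowerEnv_union, min_eq_right]
  rcases hx.lt_or_eq with hx | rfl
  exacts [(hq.2.2 x hx).le, hq.2.1.ge]

theorem mem_left (h : Separated A B) (hq : MeetAt A B q) {x : ℝ} (hx : x < q) {e : Curve}
    (he : e ∈ A ∪ B) (hex : e x = lowerEnv (A ∪ B) x) : e ∈ A :=
  he.resolve_right fun hB => by
    rw [h.lowerEnv_union_of_le hq hx.le] at hex
    exact (lowerEnv_le h.lines_right.1 hB x).not_gt (hex ▸ hq.1 x hx)

theorem mem_right (h : Separated A B) (hq : MeetAt A B q) {x : ℝ} (hx : q < x) {e : Curve}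
    (he : e ∈ A ∪ B) (hex : e x = lowerEnv (A ∪ B) x) : e ∈ B :=
  he.resolve_left fun hA => by
    rw [h.lowerEnv_union_of_ge hq hx.le] at hex
    exact (lowerEnv_le h.lines_left.1 hA x).not_gt (hex ▸ hq.2.2 x hx)

theorem env_union_left (h : Separated A B) (hq : MeetAt A B q) :
    T.Env (A ∪ B) lo q ↔ T.Env A lo q := by
  have heq : ∀ x : ℝ, (x : EReal) ≤ q → lowerEnv (A ∪ B) x = lowerEnv A x := fun x hx =>
    h.lowerEnv_union_of_le hq (EReal.coe_le_coe_iff.1 hx)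
  exact ⟨fun hT => hT.congr (fun x _ hx => (heq x hx).symm)
      fun e he x _ hx hex => h.mem_left hq (EReal.coe_lt_coe_iff.1 hx) he hex,
    fun hT => hT.congr (fun x _ hx => heq x hx) fun e he _ _ _ _ => .inl he⟩

theorem env_union_right (h : Separated A B) (hq : MeetAt A B q) :
    T.Env (A ∪ B) q hi ↔ T.Env B q hi := by
  have heq : ∀ x : ℝ, q ≤ (x : EReal) → lowerEnv (A ∪ B) x = lowerEnv B x := fun x hx =>
    h.lowerEnv_union_of_ge hq (EReal.coe_le_coe_iff.1 hx)
  exact ⟨fun hT => hT.congr (fun x hx _ => (heq x hx).symm)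
      fun e he x hx _ hex => h.mem_right hq (EReal.coe_lt_coe_iff.1 hx) he hex,
    fun hT => hT.congr (fun x hx _ => heq x hx) fun e he _ _ _ _ => .inr he⟩

end Separated

end Union

namespace XiTree

/-- The largest pseudo-line. -/
def topLine : XiTree → Curve
  | leaf e => e
  | node _ m _ _ _ => m

/-- The envelope tree; the one of a leaf is not stored. -/
noncomputable def env : XiTree → EnvTree
  | leaf e => .leaf ⟨e, ⊥, ⊤⟩
  | node _ _ env _ _ => env

def setEnv (T : EnvTree) : XiTree → XiTree
  | leaf e => leaf e
  | node h m _ l r => node h m T l r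

/-- The number of segments in all envelope trees, where one is counted for each leaf. -/
def weight : XiTree → ℕ
  | leaf _ => 1
  | node _ _ env l r => env.leaves + l.weight + r.weight

variable {t : XiTree} {lo hi : EReal}

theorem lines_setEnv (T : EnvTree) (t : XiTree) : (t.setEnv T).lines = t.lines := by
  cases t <;> rfl

theorem height_setEnv (T : EnvTree) (t : XiTree) : (t.setEnv T).height = t.height := by
  cases t <;> rfl

theorem lines_ne_nil (t : XiTree) : t.lines ≠ [] := by
  induction t with
  | leaf e => simp [lines]
  | node n m T l r ihl ihr => simp [lines, ihl]

theorem family_nonempty (t : XiTree) : t.family.Nonempty := by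
  obtain ⟨e, he⟩ := List.exists_mem_of_ne_nil _ t.lines_ne_nil
  exact ⟨e, he⟩

theorem family_node (n : ℕ) (m : Curve) (T : EnvTree) (l r : XiTree) :
    (node n m T l r).family = l.family ∪ r.family := by
  ext e
  simp [family, lines]

theorem lowerEnv_singleton (e : Curve) (x : ℝ) : lowerEnv {e} x = e x := by
  simp [lowerEnv]

theorem family_leaf (e : Curve) : (leaf e).family = {e} := by
  ext f
  simp [family, lines]

theorem Correct.getLast? (h : t.Correct lo hi) : t.lines.getLast? = some t.topLine := by
  cases t with
  | leaf e => rfl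
  | node n m T l r =>
    have := h.2.2.2.1
    simp [lines, List.getLast?_append, this, topLine]

theorem Correct.setEnv (h : t.Correct lo hi) {T : EnvTree} {lo' hi' : EReal}
    (hT : T.Env t.family lo' hi') : (t.setEnv T).Correct lo' hi' := by
  cases t with
  | leaf e => trivial
  | node n m T l r =>
    rw [family_node] at hT
    exact ⟨h.1, h.2.1, h.2.2.1, h.2.2.2.1, hT.stores, h.2.2.2.2.2⟩

theorem runs_ht (h : t.Correct lo hi) : RunsWithin prog 0 t.toVal (.nat t.height) 8 := by
  cases t with
  | leaf e => exact .of_wp htCode rfl ⟨rfl, by omega⟩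
  | node n m T l r =>
    obtain ⟨rfl, -⟩ := h
    exact .of_wp htCode rfl ⟨rfl, by omega⟩

theorem runs_topLine (t : XiTree) : RunsWithin prog 14 t.toVal (.line t.topLine) 10 := by
  cases t <;> exact .of_wp topLineCode rfl ⟨rfl, by omega⟩

theorem runs_envOf (t : XiTree) : RunsWithin prog 15 t.toVal t.env.toVal 20 := by
  cases t <;> exact .of_wp envOfCode rfl ⟨rfl, by omega⟩

theorem runs_setEnv (t : XiTree) (T : EnvTree) :
    RunsWithin prog 16 (.cons t.toVal T.toVal) (t.setEnv T).toVal 40 := by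
  cases t <;> exact .of_wp setEnvCode rfl ⟨rfl, by omega⟩

/-- `t` is a tree `Ξ` for a subfamily of `F`. -/
structure Full (F : Set Curve) (t : XiTree) : Prop where
  pairwise : t.lines.Pairwise Below
  correct : t.Correct ⊥ ⊤
  subset : t.family ⊆ F

theorem Correct.env_of_node {n : ℕ} {m : Curve} {T : EnvTree} {l r : XiTree}
    (h : (node n m T l r).Correct lo hi) : T.Env (node n m T l r).family lo hi := by
  rw [family_node]
  exact h.2.2.2.2.1.env

variable {F : Set Curve} {l r : XiTree}

theorem Full.env (h : t.Full F) : t.env.Env t.family ⊥ ⊤ := by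
  cases t with
  | leaf e =>
    rw [family_leaf]
    exact ⟨rfl, rfl, bot_lt_top, rfl, fun x _ _ => (lowerEnv_singleton e x).symm⟩
  | node n m T l r => exact h.correct.env_of_node

theorem Full.height_env_le (hF : IsPseudoLines F) (h : t.Full F) :
    t.env.height ≤ 2 * Nat.log 2 (F.ncard + 2) :=
  (h.env.height_le (hF.mono h.subset)).trans (by
    have := Nat.log_mono_right (b := 2)
      (Nat.add_le_add_right (Set.ncard_le_ncard h.subset hF.1) 2)
    omega)

theorem separated (hF : IsPseudoLines F) (hl : l.family ⊆ F) (hr : r.family ⊆ F)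
    (h : ∀ a ∈ l.lines, ∀ b ∈ r.lines, Below a b) : Separated l.family r.family :=
  ⟨hF.mono (Set.union_subset hl hr), l.family_nonempty, r.family_nonempty, h⟩

/-- The outer parts of the two envelopes are joined at their meeting point, which is a true vertex
because the families are disjoint in the order. The inner parts remain with the children. -/
theorem exists_up (hF : IsPseudoLines F) (hl : l.Full F) (hr : r.Full F)
    (hlr : ∀ a ∈ l.lines, ∀ b ∈ r.lines, Below a b) (h1 : l.height ≤ r.height + 1)
    (h2 : r.height ≤ l.height + 1) :
    ∃ t : XiTree, t.Full F ∧ t.lines = l.lines ++ r.lines ∧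
      t.height = max l.height r.height + 1 ∧
      RunsWithin prog 17 (.cons l.toVal r.toVal) t.toVal
        (20000 * (2 * Nat.log 2 (F.ncard + 2) + 1)) := by
  have hS := separated hF hl.subset hr.subset hlr
  obtain ⟨q, hq⟩ := hS.exists_meetAt
  obtain ⟨S₁, S₂, s, hs⟩ := exists_split hl.env (EReal.bot_lt_coe q) (EReal.coe_lt_top q)
  obtain ⟨W₁, W₂, w, hw⟩ := exists_split hr.env (EReal.bot_lt_coe q) (EReal.coe_lt_top q)
  have k : Linked (l.family ∪ r.family) S₁ W₂ ⊥ q ⊤ :=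
    ⟨(hS.env_union_left hq).2 s.left, (hS.env_union_right hq).2 w.right,
      (hlr _ s.left.last_mem _ w.right.first_mem).ne⟩
  obtain ⟨T, j, g1, g2, hj⟩ := k.exists_join
  have b1 := hl.height_env_le hF
  have b2 := hr.height_env_le hF
  have b3 := s.height_left
  have b4 := s.height_right
  have b5 := w.height_left
  have b6 := w.height_right
  refine ⟨.node (max l.height r.height + 1) r.topLine T (l.setEnv S₂) (r.setEnv W₁), ?_, ?_, ?_,
    .of_wp upCode rfl ?_⟩
  · have hfl : (l.setEnv S₂).family = l.family := by simp only [family, lines_setEnv]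
    have hfr : (r.setEnv W₁).family = r.family := by simp only [family, lines_setEnv]
    refine ⟨?_, ⟨?_, ?_, ?_, ?_, ?_, q, ?_, ?_, ?_⟩, ?_⟩
    · simp only [lines, lines_setEnv]
      exact List.pairwise_append.2 ⟨hl.pairwise, hr.pairwise, hlr⟩
    · simp only [height_setEnv]
    · simpa only [height_setEnv] using h1
    · simpa only [height_setEnv] using h2
    · rw [lines_setEnv, hr.correct.getLast?]
    · rw [hfl, hfr]; exact j.env.stores
    · rwa [hfl, hfr]
    · exact hl.correct.setEnv s.right
    · exact hr.correct.setEnv w.left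
    · rw [family_node, hfl, hfr]
      exact Set.union_subset hl.subset hr.subset
  · simp only [lines, lines_setEnv]
  · simp only [height, height_setEnv]
  refine CallRun.intro (runs_envOf l) fun t ht => ?_
  refine CallRun.intro (runs_envOf r) fun t ht => ?_
  refine CallRun.intro (runs_meet hS hq hl.env hr.env) fun t ht => ?_
  refine CallRun.intro hs fun t ht => ?_
  refine CallRun.intro hw fun t ht => ?_
  refine CallRun.intro (runs_ht hl.correct) fun t ht => ?_
  refine CallRun.intro (runs_ht hr.correct) fun t ht => ?_
  refine Branch.mk (fun hle => ?_) (fun hle => ?_)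
  · refine CallRun.intro (runs_topLine r) fun t ht => ?_
    refine CallRun.intro (runs_last S₁) fun t ht => ?_
    refine CallRun.intro (runs_first W₂) fun t ht => ?_
    refine CallRun.intro hj fun t ht => ?_
    refine CallRun.intro (runs_setEnv l S₂) fun t ht => ?_
    refine CallRun.intro (runs_setEnv r W₁) fun t ht => ?_
    refine And.intro ?_ (by omega)
    rw [max_eq_right hle]; rfl
  · refine CallRun.intro (runs_topLine r) fun t ht => ?_
    refine CallRun.intro (runs_last S₁) fun t ht => ?_
    refine CallRun.intro (runs_first W₂) fun t ht => ?_
    refine CallRun.intro hj fun t ht => ?_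
    refine CallRun.intro (runs_setEnv l S₂) fun t ht => ?_
    refine CallRun.intro (runs_setEnv r W₁) fun t ht => ?_
    refine And.intro ?_ (by omega)
    rw [max_eq_left (by omega)]; rfl

end XiTree

end Envelope

/-! ### Restoring the complete envelopes of the children -/

namespace Envelope

open EnvTree

namespace XiTree

variable {F : Set Curve} {t l r : XiTree} {q : ℝ}

theorem Full.height_le_of_env (hF : IsPseudoLines F) {E : Set Curve} (hE : E ⊆ F) {T : EnvTree}
    {lo hi : EReal} (h : T.Env E lo hi) : T.height ≤ 2 * Nat.log 2 (F.ncard + 2) :=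
  (h.height_le (hF.mono hE)).trans (by
    have := Nat.log_mono_right (b := 2) (Nat.add_le_add_right (Set.ncard_le_ncard hE hF.1) 2)
    omega)

theorem exists_restoreLeft (hF : IsPseudoLines F) (hs : l.family ⊆ F)
    (hp : l.lines.Pairwise Below) (hc : l.Correct q ⊤) {S : EnvTree}
    (hS : S.Env l.family ⊥ q) :
    ∃ l' : XiTree, l'.Full F ∧ l'.lines = l.lines ∧ l'.height = l.height ∧
      S.leaves + l.weight ≤ l'.weight + 1 ∧
      RunsWithin prog 25 (.cons l.toVal S.toVal) l'.toVal
        (5000 * (2 * Nat.log 2 (F.ncard + 2) + 1)) := by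
  cases l with
  | leaf e =>
    -- A leaf of `Ξ` stores no envelope. The part handed down to it is a single segment and is
    -- dropped, which loses at most the one unit allowed.
    have := hS.leaves_le (hF.mono hs)
    rw [family_leaf, Set.ncard_singleton] at this
    exact ⟨.leaf e, ⟨hp, trivial, hs⟩, rfl, rfl, by simp only [weight]; omega,
      .of_wp restoreLeftCode rfl ⟨rfl, by omega⟩⟩
  | node n m T l r =>
    obtain ⟨T', g1, g2, g3⟩ := exists_glue (hF.mono hs) hS hc.env_of_node
    have b1 := Full.height_le_of_env hF hs hS
    have b2 := Full.height_le_of_env hF hs hc.env_of_node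
    refine ⟨(node n m T l r).setEnv T', ⟨hp, hc.setEnv g1, hs⟩, rfl, rfl, ?_,
      .of_wp restoreLeftCode rfl ?_⟩
    · simp only [weight, setEnv]; omega
    refine CallRun.intro (runs_envOf (node n m T l r)) fun t ht => ?_
    refine CallRun.intro g3 fun t ht => ?_
    refine CallRun.intro (runs_setEnv (node n m T l r) T') fun t ht => ?_
    exact ⟨rfl, by omega⟩

theorem exists_restoreRight (hF : IsPseudoLines F) (hs : r.family ⊆ F)
    (hp : r.lines.Pairwise Below) (hc : r.Correct ⊥ q) {S : EnvTree}
    (hS : S.Env r.family q ⊤) :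
    ∃ r' : XiTree, r'.Full F ∧ r'.lines = r.lines ∧ r'.height = r.height ∧
      S.leaves + r.weight ≤ r'.weight + 1 ∧
      RunsWithin prog 26 (.cons r.toVal S.toVal) r'.toVal
        (5000 * (2 * Nat.log 2 (F.ncard + 2) + 1)) := by
  cases r with
  | leaf e =>
    have := hS.leaves_le (hF.mono hs)
    rw [family_leaf, Set.ncard_singleton] at this
    exact ⟨.leaf e, ⟨hp, trivial, hs⟩, rfl, rfl, by simp only [weight]; omega,
      .of_wp restoreRightCode rfl ⟨rfl, by omega⟩⟩
  | node n m T l r =>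
    obtain ⟨T', g1, g2, g3⟩ := exists_glue (hF.mono hs) hc.env_of_node hS
    have b1 := Full.height_le_of_env hF hs hS
    have b2 := Full.height_le_of_env hF hs hc.env_of_node
    refine ⟨(node n m T l r).setEnv T', ⟨hp, hc.setEnv g1, hs⟩, rfl, rfl, ?_,
      .of_wp restoreRightCode rfl ?_⟩
    · simp only [weight, setEnv]; omega
    refine CallRun.intro (runs_envOf (node n m T l r)) fun t ht => ?_
    refine CallRun.intro g3 fun t ht => ?_
    refine CallRun.intro (runs_setEnv (node n m T l r) T') fun t ht => ?_
    exact ⟨rfl, by omega⟩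

theorem Correct.topLine_mem {lo hi : EReal} (h : t.Correct lo hi) : t.topLine ∈ t.lines :=
  List.mem_of_mem_getLast? h.getLast?

theorem eq_or_below_topLine {lo hi : EReal} (h : t.Correct lo hi) (hp : t.lines.Pairwise Below)
    {e : Curve} (he : e ∈ t.lines) : e = t.topLine ∨ Below e t.topLine := by
  obtain ⟨s, hs⟩ := List.getLast?_eq_some_iff.1 h.getLast?
  rw [hs] at hp he
  rcases List.mem_append.1 he with hm | hm
  · exact .inr ((List.pairwise_append.1 hp).2.2 e hm _ (List.mem_singleton_self _))
  · exact .inl (List.mem_singleton.1 hm)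

theorem exists_down (hF : IsPseudoLines F) {n : ℕ} {m : Curve} {T : EnvTree}
    (h : (node n m T l r).Full F) :
    ∃ l' r' : XiTree, l'.Full F ∧ r'.Full F ∧ l'.lines = l.lines ∧ r'.lines = r.lines ∧
      l'.height = l.height ∧ r'.height = r.height ∧
      (node n m T l r).weight ≤ l'.weight + r'.weight + 2 ∧
      RunsWithin prog 18 (node n m T l r).toVal (.cons l'.toVal r'.toVal)
        (20000 * (2 * Nat.log 2 (F.ncard + 2) + 1)) := by
  obtain ⟨hp, ⟨h1, h2, h3, h4, h5, q, hq, hcl, hcr⟩, hs⟩ := h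
  obtain ⟨hpl, hpr, hlr⟩ := List.pairwise_append.1 hp
  rw [family_node] at hs
  obtain ⟨hsl, hsr⟩ := Set.union_subset_iff.1 hs
  have hS := separated hF hsl hsr hlr
  have hT := h5.env
  have mem_l : ∀ e ∈ l.lines, ¬ Below l.topLine e := fun e he => by
    rcases eq_or_below_topLine hcl hpl he with rfl | hb
    exacts [not_below_self _, hb.asymm]
  have mem_r : ∀ e ∈ r.lines, Below l.topLine e := fun e he => hlr _ hcl.topLine_mem _ he
  have hfirst : ¬ Below l.topLine T.first.line := by
    obtain ⟨x, -, hx⟩ := EReal.lt_iff_exists_real_btwn.1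
      (lt_min hT.lt_first_right (EReal.bot_lt_coe q))
    obtain ⟨hx1, hx2⟩ := lt_min_iff.1 hx
    exact mem_l _ (hS.mem_left hq (EReal.coe_lt_coe_iff.1 hx2) hT.first_mem
      (hT.first_eq bot_le hx1.le))
  have hlast : Below l.topLine T.last.line := by
    obtain ⟨x, hx, -⟩ := EReal.lt_iff_exists_real_btwn.1
      (max_lt hT.last_left_lt (EReal.coe_lt_top q))
    obtain ⟨hx1, hx2⟩ := max_lt_iff.1 hx
    exact mem_r _ (hS.mem_right hq (EReal.coe_lt_coe_iff.1 hx2) hT.last_mem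
      (hT.last_eq hx1.le le_top))
  obtain ⟨p, ⟨a, ha, ham, hap⟩, ⟨b, hb, hbm, hbp⟩, hfind⟩ := exists_findBreak hT hfirst hlast
  -- At the vertex found, a member of each family attains the envelope of the union, so the
  -- envelopes of the children agree there; they do so only at `q`.
  have hpq : p = q := by
    replace ha : a ∈ l.family := ha.resolve_right fun hr => ham (mem_r a hr)
    replace hb : b ∈ r.family := hb.resolve_left fun hl => mem_l b hl hbm
    have i1 := lowerEnv_le hS.lines_left.1 ha p
    have i2 := lowerEnv_le hS.lines_right.1 hb p
    rw [hap, hS.lowerEnv_union] at i1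
    rw [hbp, hS.lowerEnv_union] at i2
    exact le_antisymm (hq.le_of_le (i1.trans (min_le_right _ _)))
      (hq.ge_of_ge (i2.trans (min_le_left _ _)))
  subst hpq
  obtain ⟨S₁, S₂, s, hsp⟩ := exists_split hT (EReal.bot_lt_coe p) (EReal.coe_lt_top p)
  obtain ⟨l', l1, l2, l3, l4, l5⟩ := exists_restoreLeft hF hsl hpl hcl
    ((hS.env_union_left hq).1 s.left)
  obtain ⟨r', r1, r2, r3, r4, r5⟩ := exists_restoreRight hF hsr hpr hcr
    ((hS.env_union_right hq).1 s.right)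
  have b1 := Full.height_le_of_env hF hs hT
  have b2 := s.height_left
  have b3 := s.height_right
  refine ⟨l', r', l1, r1, l2, r2, l3, r3, ?_, .of_wp downCode rfl ?_⟩
  · have := s.leaves
    simp only [weight]; omega
  refine CallRun.intro (runs_topLine l) fun t ht => ?_
  refine CallRun.intro hfind fun t ht => ?_
  refine CallRun.intro hsp fun t ht => ?_
  refine CallRun.intro l5 fun t ht => ?_
  refine CallRun.intro r5 fun t ht => ?_
  exact ⟨rfl, by omega⟩

end XiTree

end Envelope

/-! ### Rotations in `Ξ` -/

namespace Envelope

open EnvTree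

namespace XiTree

variable {F : Set Curve} {t l r : XiTree}

theorem height_node_eq {lo hi : EReal} {n : ℕ} {m : Curve} {T : EnvTree}
    (h : (node n m T l r).Correct lo hi) :
    (node n m T l r).height = max l.height r.height + 1 ∧ l.height ≤ r.height + 1 ∧
      r.height ≤ l.height + 1 :=
  ⟨rfl, h.2.1, h.2.2.1⟩

/-- Every node taken apart first hands its envelope down, and every new node is formed by
`exists_up`. A double rotation needs two descents and three ascents at 20000 units each, within the
bound of 120000. -/
theorem exists_balance_right (hF : IsPseudoLines F) (hl : l.Full F) (hr : r.Full F)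
    (hlr : ∀ a ∈ l.lines, ∀ b ∈ r.lines, Below a b) (c1 : l.height ≤ r.height + 1)
    (c2 : ¬ r.height ≤ l.height + 1) (h2 : r.height ≤ l.height + 2) :
    ∃ t : XiTree, t.Full F ∧ t.lines = l.lines ++ r.lines ∧
      max l.height r.height ≤ t.height ∧ t.height ≤ max l.height r.height + 1 ∧
      RunsWithin prog 19 (.cons l.toVal r.toVal) t.toVal
        (120000 * (2 * Nat.log 2 (F.ncard + 2) + 1)) := by
  cases r with
  | leaf e => exact (c2 (Nat.zero_le _)).elim
  | node n m T r₁ r₂ =>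
  obtain ⟨e1, e2, e3⟩ := height_node_eq hr.correct
  rw [e1] at c2 h2 c1 ⊢
  obtain ⟨a, b, ha, hb, hal, hbl, hah, hbh, -, hd⟩ := exists_down hF hr
  have hlines : (node n m T r₁ r₂).lines = a.lines ++ b.lines := by rw [hal, hbl]; rfl
  have hab := (List.pairwise_append.1 (hlines ▸ hr.pairwise)).2.2
  rw [hlines] at hlr ⊢
  have hla : ∀ x ∈ l.lines, ∀ y ∈ a.lines, Below x y := fun x hx y hy =>
    hlr x hx y (List.mem_append_left _ hy)
  have hlb : ∀ x ∈ l.lines, ∀ y ∈ b.lines, Below x y := fun x hx y hy =>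
    hlr x hx y (List.mem_append_right _ hy)
  by_cases c3 : a.height ≤ b.height
  · obtain ⟨u, u1, u2, u3, u4⟩ := exists_up hF hl ha hla (by omega) (by omega)
    obtain ⟨w, w1, w2, w3, w4⟩ := exists_up hF u1 hb (by
      rw [u2]
      intro x hx y hy
      rcases List.mem_append.1 hx with hx | hx
      exacts [hlb x hx y hy, hab x hx y hy]) (by omega) (by omega)
    refine ⟨w, w1, by rw [w2, u2, List.append_assoc], by omega, by omega,
      .of_wp balanceCode rfl ?_⟩
    refine CallRun.intro (runs_ht hl.correct) fun t ht => ?_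
    refine CallRun.intro (runs_ht hr.correct) fun t ht => ?_
    refine Branch.mk (fun _ => ?_) (fun hn => (hn c1).elim)
    refine Branch.mk (fun hn => (c2 hn).elim) (fun _ => ?_)
    refine CallRun.intro hd fun t ht => ?_
    refine CallRun.intro (runs_ht ha.correct) fun t ht => ?_
    refine CallRun.intro (runs_ht hb.correct) fun t ht => ?_
    refine Branch.mk (fun _ => ?_) (fun hn => (hn c3).elim)
    refine CallRun.intro u4 fun t ht => ?_
    refine CallRun.intro w4 fun t ht => ?_
    exact ⟨rfl, by omega⟩
  · cases a with
    | leaf e => exact (c3 (Nat.zero_le _)).elim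
    | node n' m' T' a₁ a₂ =>
    obtain ⟨i1, i2, i3⟩ := height_node_eq ha.correct
    obtain ⟨c, d, hc, hd', hcl, hdl, hch, hdh, -, hdd⟩ := exists_down hF ha
    have hlines' : (node n' m' T' a₁ a₂).lines = c.lines ++ d.lines := by rw [hcl, hdl]; rfl
    have hcd := (List.pairwise_append.1 (hlines' ▸ ha.pairwise)).2.2
    rw [hlines'] at hla hab ⊢
    obtain ⟨u, u1, u2, u3, u4⟩ := exists_up hF hl hc
      (fun x hx y hy => hla x hx y (List.mem_append_left _ hy)) (by omega) (by omega)
    obtain ⟨w, w1, w2, w3, w4⟩ := exists_up hF hd' hb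
      (fun x hx y hy => hab x (List.mem_append_right _ hx) y hy) (by omega) (by omega)
    obtain ⟨z, z1, z2, z3, z4⟩ := exists_up hF u1 w1 (by
      rw [u2, w2]
      intro x hx y hy
      rcases List.mem_append.1 hx with hx | hx <;> rcases List.mem_append.1 hy with hy | hy
      exacts [hla x hx y (List.mem_append_right _ hy), hlb x hx y hy, hcd x hx y hy,
        hab x (List.mem_append_left _ hx) y hy]) (by omega) (by omega)
    refine ⟨z, z1, by rw [z2, u2, w2]; simp only [List.append_assoc], by omega, by omega,
      .of_wp balanceCode rfl ?_⟩
    refine CallRun.intro (runs_ht hl.correct) fun t ht => ?_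
    refine CallRun.intro (runs_ht hr.correct) fun t ht => ?_
    refine Branch.mk (fun _ => ?_) (fun hn => (hn c1).elim)
    refine Branch.mk (fun hn => (c2 hn).elim) (fun _ => ?_)
    refine CallRun.intro hd fun t ht => ?_
    refine CallRun.intro (runs_ht ha.correct) fun t ht => ?_
    refine CallRun.intro (runs_ht hb.correct) fun t ht => ?_
    refine Branch.mk (fun hn => (c3 hn).elim) (fun _ => ?_)
    refine CallRun.intro hdd fun t ht => ?_
    refine CallRun.intro u4 fun t ht => ?_
    refine CallRun.intro w4 fun t ht => ?_
    refine CallRun.intro z4 fun t ht => ?_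
    exact ⟨rfl, by omega⟩

theorem exists_balance_left (hF : IsPseudoLines F) (hl : l.Full F) (hr : r.Full F)
    (hlr : ∀ a ∈ l.lines, ∀ b ∈ r.lines, Below a b) (c1 : ¬ l.height ≤ r.height + 1)
    (h1 : l.height ≤ r.height + 2) :
    ∃ t : XiTree, t.Full F ∧ t.lines = l.lines ++ r.lines ∧
      max l.height r.height ≤ t.height ∧ t.height ≤ max l.height r.height + 1 ∧
      RunsWithin prog 19 (.cons l.toVal r.toVal) t.toVal
        (120000 * (2 * Nat.log 2 (F.ncard + 2) + 1)) := by
  cases l with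
  | leaf e => exact (c1 (Nat.zero_le _)).elim
  | node n m T l₁ l₂ =>
  obtain ⟨e1, e2, e3⟩ := height_node_eq hl.correct
  rw [e1] at h1 c1 ⊢
  obtain ⟨b, a, hb, ha, hbl, hal, hbh, hah, -, hd⟩ := exists_down hF hl
  have hlines : (node n m T l₁ l₂).lines = b.lines ++ a.lines := by rw [hal, hbl]; rfl
  have hba := (List.pairwise_append.1 (hlines ▸ hl.pairwise)).2.2
  rw [hlines] at hlr ⊢
  have har : ∀ x ∈ a.lines, ∀ y ∈ r.lines, Below x y := fun x hx y hy =>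
    hlr x (List.mem_append_right _ hx) y hy
  have hbr : ∀ x ∈ b.lines, ∀ y ∈ r.lines, Below x y := fun x hx y hy =>
    hlr x (List.mem_append_left _ hx) y hy
  by_cases c3 : a.height ≤ b.height
  · obtain ⟨u, u1, u2, u3, u4⟩ := exists_up hF ha hr har (by omega) (by omega)
    obtain ⟨w, w1, w2, w3, w4⟩ := exists_up hF hb u1 (by
      rw [u2]
      intro x hx y hy
      rcases List.mem_append.1 hy with hy | hy
      exacts [hba x hx y hy, hbr x hx y hy]) (by omega) (by omega)
    refine ⟨w, w1, by rw [w2, u2, List.append_assoc], by omega, by omega,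
      .of_wp balanceCode rfl ?_⟩
    refine CallRun.intro (runs_ht hl.correct) fun t ht => ?_
    refine CallRun.intro (runs_ht hr.correct) fun t ht => ?_
    refine Branch.mk (fun hn => (c1 hn).elim) (fun _ => ?_)
    refine CallRun.intro hd fun t ht => ?_
    refine CallRun.intro (runs_ht ha.correct) fun t ht => ?_
    refine CallRun.intro (runs_ht hb.correct) fun t ht => ?_
    refine Branch.mk (fun _ => ?_) (fun hn => (hn c3).elim)
    refine CallRun.intro u4 fun t ht => ?_
    refine CallRun.intro w4 fun t ht => ?_
    exact ⟨rfl, by omega⟩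
  · cases a with
    | leaf e => exact (c3 (Nat.zero_le _)).elim
    | node n' m' T' a₁ a₂ =>
    obtain ⟨i1, i2, i3⟩ := height_node_eq ha.correct
    obtain ⟨c, d, hc, hd', hcl, hdl, hch, hdh, -, hdd⟩ := exists_down hF ha
    have hlines' : (node n' m' T' a₁ a₂).lines = c.lines ++ d.lines := by rw [hcl, hdl]; rfl
    have hcd := (List.pairwise_append.1 (hlines' ▸ ha.pairwise)).2.2
    rw [hlines'] at har hba ⊢
    obtain ⟨u, u1, u2, u3, u4⟩ := exists_up hF hb hc
      (fun x hx y hy => hba x hx y (List.mem_append_left _ hy)) (by omega) (by omega)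
    obtain ⟨w, w1, w2, w3, w4⟩ := exists_up hF hd' hr
      (fun x hx y hy => har x (List.mem_append_right _ hx) y hy) (by omega) (by omega)
    obtain ⟨z, z1, z2, z3, z4⟩ := exists_up hF u1 w1 (by
      rw [u2, w2]
      intro x hx y hy
      rcases List.mem_append.1 hx with hx | hx <;> rcases List.mem_append.1 hy with hy | hy
      exacts [hba x hx y (List.mem_append_right _ hy), hbr x hx y hy, hcd x hx y hy,
        har x (List.mem_append_left _ hx) y hy]) (by omega) (by omega)
    refine ⟨z, z1, by rw [z2, u2, w2]; simp only [List.append_assoc], by omega, by omega,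
      .of_wp balanceCode rfl ?_⟩
    refine CallRun.intro (runs_ht hl.correct) fun t ht => ?_
    refine CallRun.intro (runs_ht hr.correct) fun t ht => ?_
    refine Branch.mk (fun hn => (c1 hn).elim) (fun _ => ?_)
    refine CallRun.intro hd fun t ht => ?_
    refine CallRun.intro (runs_ht ha.correct) fun t ht => ?_
    refine CallRun.intro (runs_ht hb.correct) fun t ht => ?_
    refine Branch.mk (fun hn => (c3 hn).elim) (fun _ => ?_)
    refine CallRun.intro hdd fun t ht => ?_
    refine CallRun.intro u4 fun t ht => ?_
    refine CallRun.intro w4 fun t ht => ?_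
    refine CallRun.intro z4 fun t ht => ?_
    exact ⟨rfl, by omega⟩

theorem exists_balance (hF : IsPseudoLines F) (hl : l.Full F) (hr : r.Full F)
    (hlr : ∀ a ∈ l.lines, ∀ b ∈ r.lines, Below a b) (h1 : l.height ≤ r.height + 2)
    (h2 : r.height ≤ l.height + 2) :
    ∃ t : XiTree, t.Full F ∧ t.lines = l.lines ++ r.lines ∧
      max l.height r.height ≤ t.height ∧ t.height ≤ max l.height r.height + 1 ∧
      (l.height ≤ r.height + 1 → r.height ≤ l.height + 1 →
        t.height = max l.height r.height + 1) ∧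
      RunsWithin prog 19 (.cons l.toVal r.toVal) t.toVal
        (120000 * (2 * Nat.log 2 (F.ncard + 2) + 1)) := by
  by_cases c1 : l.height ≤ r.height + 1
  · by_cases c2 : r.height ≤ l.height + 1
    · obtain ⟨u, u1, u2, u3, u4⟩ := exists_up hF hl hr hlr c1 c2
      refine ⟨u, u1, u2, by omega, by omega, fun _ _ => u3, .of_wp balanceCode rfl ?_⟩
      refine CallRun.intro (runs_ht hl.correct) fun t ht => ?_
      refine CallRun.intro (runs_ht hr.correct) fun t ht => ?_
      refine Branch.mk (fun _ => ?_) (fun hn => (hn c1).elim)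
      refine Branch.mk (fun _ => ?_) (fun hn => (hn c2).elim)
      refine CallRun.intro u4 fun t ht => ?_
      exact ⟨rfl, by omega⟩
    · obtain ⟨t, t1, t2, t3, t4, t5⟩ := exists_balance_right hF hl hr hlr c1 c2 h2
      exact ⟨t, t1, t2, t3, t4, fun _ h => (c2 h).elim, t5⟩
  · obtain ⟨t, t1, t2, t3, t4, t5⟩ := exists_balance_left hF hl hr hlr c1 h1
    exact ⟨t, t1, t2, t3, t4, fun h _ => (c1 h).elim, t5⟩

end XiTree

end Envelope

/-! ### Insertion and deletion -/

namespace Envelope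

open EnvTree

namespace XiTree

variable {F : Set Curve} {t l r : XiTree}

theorem full_leaf {e : Curve} (he : e ∈ F) : (leaf e).Full F :=
  ⟨List.pairwise_singleton _ _, trivial, by rwa [family_leaf, Set.singleton_subset_iff]⟩

theorem mul_step {K D h h' x : ℕ} (hx : x + K * D * (h' + 1) ≤ K * D * (h' + 1) + K * D)
    (hh : h' + 1 ≤ h) : x + K * D * (h' + 1) ≤ K * D * (h + 1) :=
  hx.trans (by
    have := Nat.mul_le_mul_left (K * D) (show h' + 1 + 1 ≤ h + 1 by omega)
    rwa [mul_add (K * D) (h' + 1) 1, mul_one] at this)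

/-- The recursion enters the children after their envelopes are restored, which are not subterms of
the given tree; hence the induction is on the height. The height grows by at most one, as
`exists_balance` requires on the way back. -/
theorem exists_insertInto (hF : IsPseudoLines F) {e : Curve} (he : e ∈ F) (n : ℕ) :
    ∀ {t : XiTree}, t.height = n → t.Full F → e ∉ t.lines →
      ∃ t' : XiTree, t'.Full F ∧ (∀ x, x ∈ t'.lines ↔ x = e ∨ x ∈ t.lines) ∧
        t.height ≤ t'.height ∧ t'.height ≤ t.height + 1 ∧
        RunsWithin prog 20 (.cons (.line e) t.toVal) t'.toVal
          (200000 * (2 * Nat.log 2 (F.ncard + 2) + 1) * (t.height + 1)) := by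
  induction n using Nat.strong_induction_on with
  | _ n ih =>
  intro t htn hfull het
  cases t with
  | leaf f =>
    have hf : f ∈ F := hfull.subset (by rw [family_leaf]; rfl)
    have hne : e ≠ f := fun h => het (by simp [lines, h])
    have hl := full_leaf he
    by_cases hb : Below e f
    · obtain ⟨u, u1, u2, u3, u4⟩ := exists_up hF hl hfull (by simpa [lines] using hb)
        (by simp [height]) (by simp [height])
      refine ⟨u, u1, fun x => by simp [u2, lines], by simp [height], by simp [u3, height],
        .of_wp insertIntoCode rfl ?_⟩
      refine Branch.mk (fun _ => ?_) (fun hn => (hn hb).elim)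
      refine CallRun.intro u4 fun t ht => ?_
      exact ⟨rfl, by simp only [height]; omega⟩
    · have hb' := (hF.below_or_below he hf hne).resolve_left hb
      obtain ⟨u, u1, u2, u3, u4⟩ := exists_up hF hfull hl (by simpa [lines] using hb')
        (by simp [height]) (by simp [height])
      refine ⟨u, u1, fun x => by simp [u2, lines, or_comm], by simp [height], by simp [u3, height],
        .of_wp insertIntoCode rfl ?_⟩
      refine Branch.mk (fun hn => (hb hn).elim) (fun _ => ?_)
      refine CallRun.intro u4 fun t ht => ?_
      exact ⟨rfl, by simp only [height]; omega⟩
  | node n' m T l r =>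
    obtain ⟨e1, e2, e3⟩ := height_node_eq hfull.correct
    obtain ⟨a, b, ha, hb, hal, hbl, hah, hbh, -, hd⟩ := exists_down hF hfull
    have hlines : (node n' m T l r).lines = a.lines ++ b.lines := by rw [hal, hbl]; rfl
    have hab := (List.pairwise_append.1 (hlines ▸ hfull.pairwise)).2.2
    rw [hlines, List.mem_append, not_or] at het
    rw [hlines]
    have htop := ha.correct.topLine_mem
    by_cases hc : Below e a.topLine
    · obtain ⟨a', i1, i2, i3, i4, i5⟩ := ih _ (by omega) rfl ha het.1
      obtain ⟨w, w1, w2, w3, w4, w5, w6⟩ := exists_balance hF i1 hb (fun x hx y hy => by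
        rcases (i2 x).1 hx with rfl | hx
        exacts [hc.trans (hab _ htop y hy), hab x hx y hy]) (by omega) (by omega)
      refine ⟨w, w1, fun x => by rw [w2, List.mem_append, i2, List.mem_append, or_assoc],
        by omega, by omega, .of_wp insertIntoCode rfl ?_⟩
      refine CallRun.intro hd fun t ht => ?_
      refine CallRun.intro (runs_topLine a) fun t ht => ?_
      refine Branch.mk (fun _ => ?_) (fun hn => (hn hc).elim)
      refine CallRun.intro i5 fun t ht => ?_
      refine CallRun.intro w6 fun t ht => ?_
      refine And.intro rfl ?_
      -- One level costs a descent (20000) and a rebalancing (120000), plus slack for the remaining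
      -- steps.
      have := mul_step (K := 200000) (D := 2 * Nat.log 2 (F.ncard + 2) + 1) (h' := a.height)
        (h := (node n' m T l r).height) (x := 150000 * (2 * Nat.log 2 (F.ncard + 2) + 1))
        (by omega) (by omega)
      omega
    · have hc' := (hF.below_or_below he (ha.subset htop)
        (fun h => het.1 (h ▸ htop))).resolve_left hc
      obtain ⟨b', i1, i2, i3, i4, i5⟩ := ih _ (by omega) rfl hb het.2
      obtain ⟨w, w1, w2, w3, w4, w5, w6⟩ := exists_balance hF ha i1 (fun x hx y hy => by
        rcases (i2 y).1 hy with rfl | hy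
        · rcases eq_or_below_topLine ha.correct ha.pairwise hx with rfl | hx
          exacts [hc', hx.trans hc']
        · exact hab x hx y hy) (by omega) (by omega)
      refine ⟨w, w1, fun x => by rw [w2, List.mem_append, i2, List.mem_append, or_left_comm],
        by omega, by omega, .of_wp insertIntoCode rfl ?_⟩
      refine CallRun.intro hd fun t ht => ?_
      refine CallRun.intro (runs_topLine a) fun t ht => ?_
      refine Branch.mk (fun hn => (hc hn).elim) (fun _ => ?_)
      refine CallRun.intro i5 fun t ht => ?_
      refine CallRun.intro w6 fun t ht => ?_
      refine And.intro rfl ?_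
      have := mul_step (K := 200000) (D := 2 * Nat.log 2 (F.ncard + 2) + 1) (h' := b.height)
        (h := (node n' m T l r).height) (x := 150000 * (2 * Nat.log 2 (F.ncard + 2) + 1))
        (by omega) (by omega)
      omega

/-- An empty result arises only from a single leaf; the sibling then replaces the parent. In all
other cases the height falls by at most one, so one rebalancing per level is enough. -/
theorem exists_delete (hF : IsPseudoLines F) {e : Curve} (n : ℕ) :
    ∀ {t : XiTree}, t.height = n → t.Full F → e ∈ t.lines →
      ∃ t' : Xi, (∀ u, t' = some u → u.Full F ∧ (∀ x, x ∈ u.lines ↔ x ≠ e ∧ x ∈ t.lines) ∧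
          u.height ≤ t.height ∧ t.height ≤ u.height + 1) ∧
        (t' = none → t.lines = [e] ∧ t.height = 0) ∧
        RunsWithin prog 22 (.cons (.line e) t.toVal) t'.toVal
          (200000 * (2 * Nat.log 2 (F.ncard + 2) + 1) * (t.height + 1)) := by
  induction n using Nat.strong_induction_on with
  | _ n ih =>
  intro t htn hfull het
  cases t with
  | leaf f =>
    obtain rfl : e = f := by simpa [lines] using het
    refine ⟨none, by simp, fun _ => ⟨rfl, rfl⟩, .of_wp deleteCode rfl ?_⟩
    exact ⟨rfl, by simp only [height]; omega⟩
  | node n' m T l r =>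
    obtain ⟨e1, e2, e3⟩ := height_node_eq hfull.correct
    obtain ⟨a, b, ha, hb, hal, hbl, hah, hbh, -, hd⟩ := exists_down hF hfull
    have hlines : (node n' m T l r).lines = a.lines ++ b.lines := by rw [hal, hbl]; rfl
    have hab := (List.pairwise_append.1 (hlines ▸ hfull.pairwise)).2.2
    rw [hlines, List.mem_append] at het
    rw [hlines]
    have htop := ha.correct.topLine_mem
    by_cases hc : Below a.topLine e
    · have hea : e ∉ a.lines := fun h => by
        rcases eq_or_below_topLine ha.correct ha.pairwise h with rfl | h
        exacts [not_below_self _ hc, hc.asymm h]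
      obtain ⟨b', i1, i2, i3⟩ := ih _ (by omega) rfl hb (het.resolve_left hea)
      have hmul := mul_step (K := 200000) (D := 2 * Nat.log 2 (F.ncard + 2) + 1) (h' := b.height)
        (h := (node n' m T l r).height) (x := 150000 * (2 * Nat.log 2 (F.ncard + 2) + 1))
        (by omega) (by omega)
      cases b' with
      | none =>
        obtain ⟨j1, j2⟩ := i2 rfl
        refine ⟨some a, fun u hu => ?_, fun h => by simp at h, .of_wp deleteCode rfl ?_⟩
        · obtain rfl := Option.some.inj hu
          refine ⟨ha, fun x => ?_, by omega, by omega⟩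
          rw [j1, List.mem_append, List.mem_singleton]
          exact ⟨fun hx => ⟨fun h => hea (h ▸ hx), .inl hx⟩, fun h => h.2.resolve_right h.1⟩
        refine CallRun.intro hd fun t ht => ?_
        refine CallRun.intro (runs_topLine a) fun t ht => ?_
        refine Branch.mk (fun _ => ?_) (fun hn => (hn hc).elim)
        refine CallRun.intro i3 fun t ht => ?_
        exact ⟨rfl, by omega⟩
      | some b' =>
        obtain ⟨j1, j2, j3, j4⟩ := i1 b' rfl
        obtain ⟨w, w1, w2, w3, w4, w5, w6⟩ := exists_balance hF ha j1 (fun x hx y hy =>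
          hab x hx y ((j2 y).1 hy).2) (by omega) (by omega)
        refine ⟨some w, fun u hu => ?_, fun h => by simp at h, .of_wp deleteCode rfl ?_⟩
        · obtain rfl := Option.some.inj hu
          refine ⟨w1, fun x => ?_, by omega, by omega⟩
          rw [w2, List.mem_append, List.mem_append, j2, and_or_left]
          exact or_congr_left ⟨fun hx => ⟨fun h => hea (h ▸ hx), hx⟩, fun h => h.2⟩
        refine CallRun.intro hd fun t ht => ?_
        refine CallRun.intro (runs_topLine a) fun t ht => ?_
        refine Branch.mk (fun _ => ?_) (fun hn => (hn hc).elim)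
        refine CallRun.intro i3 fun t ht => ?_
        -- The program tests whether the result is empty, so its value must be in constructor form
        -- for `wp` to reduce.
        cases b' <;>
        · refine CallRun.intro w6 fun t ht => ?_
          exact ⟨rfl, by omega⟩
    · have hea : e ∈ a.lines := het.resolve_right fun h => hc (hab _ htop _ h)
      have heb : e ∉ b.lines := fun h => not_below_self e (hab e hea e h)
      obtain ⟨a', i1, i2, i3⟩ := ih _ (by omega) rfl ha hea
      have hmul := mul_step (K := 200000) (D := 2 * Nat.log 2 (F.ncard + 2) + 1) (h' := a.height)
        (h := (node n' m T l r).height) (x := 150000 * (2 * Nat.log 2 (F.ncard + 2) + 1))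
        (by omega) (by omega)
      cases a' with
      | none =>
        obtain ⟨j1, j2⟩ := i2 rfl
        refine ⟨some b, fun u hu => ?_, fun h => by simp at h, .of_wp deleteCode rfl ?_⟩
        · obtain rfl := Option.some.inj hu
          refine ⟨hb, fun x => ?_, by omega, by omega⟩
          rw [j1, List.mem_append, List.mem_singleton]
          exact ⟨fun hx => ⟨fun h => heb (h ▸ hx), .inr hx⟩, fun h => h.2.resolve_left h.1⟩
        refine CallRun.intro hd fun t ht => ?_
        refine CallRun.intro (runs_topLine a) fun t ht => ?_
        refine Branch.mk (fun hn => (hc hn).elim) (fun _ => ?_)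
        refine CallRun.intro i3 fun t ht => ?_
        exact ⟨rfl, by omega⟩
      | some a' =>
        obtain ⟨j1, j2, j3, j4⟩ := i1 a' rfl
        obtain ⟨w, w1, w2, w3, w4, w5, w6⟩ := exists_balance hF j1 hb (fun x hx y hy =>
          hab x ((j2 x).1 hx).2 y hy) (by omega) (by omega)
        refine ⟨some w, fun u hu => ?_, fun h => by simp at h, .of_wp deleteCode rfl ?_⟩
        · obtain rfl := Option.some.inj hu
          refine ⟨w1, fun x => ?_, by omega, by omega⟩
          rw [w2, List.mem_append, List.mem_append, j2, and_or_left]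
          exact or_congr_right ⟨fun hx => ⟨fun h => heb (h ▸ hx), hx⟩, fun h => h.2⟩
        refine CallRun.intro hd fun t ht => ?_
        refine CallRun.intro (runs_topLine a) fun t ht => ?_
        refine Branch.mk (fun hn => (hc hn).elim) (fun _ => ?_)
        refine CallRun.intro i3 fun t ht => ?_
        cases a' <;>
        · refine CallRun.intro w6 fun t ht => ?_
          exact ⟨rfl, by omega⟩

/-! ### Storage -/

/-- A descent loses at most two segments in total, one for each glued pair. With `a` and `b` leaves
below the children, induction gives `(3a - 2) + (3b - 2) + 2 = 3(a + b) - 2`. -/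
theorem weight_le (hF : IsPseudoLines F) (n : ℕ) :
    ∀ {t : XiTree}, t.height = n → t.Full F → t.weight + 2 ≤ 3 * t.lines.length := by
  induction n using Nat.strong_induction_on with
  | _ n ih =>
  intro t htn hfull
  cases t with
  | leaf f => simp [weight, lines]
  | node n' m T l r =>
    obtain ⟨e1, e2, e3⟩ := height_node_eq hfull.correct
    obtain ⟨a, b, ha, hb, hal, hbl, hah, hbh, hw, -⟩ := exists_down hF hfull
    have h1 := ih _ (by omega) rfl ha
    have h2 := ih _ (by omega) rfl hb
    rw [hal] at h1
    rw [hbl] at h2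
    simp only [lines, List.length_append]
    omega

/-- A leaf takes 7 cells and atoms and an inner node 9 besides its children, so equality holds
throughout. -/
theorem _root_.Envelope.EnvTree.size_toVal_le (T : EnvTree) :
    T.toVal.size + 9 ≤ 16 * T.leaves := by
  induction T with
  | leaf s => simp [EnvTree.toVal, Val.size, leaves]
  | node n p a b l r ihl ihr =>
    simp only [EnvTree.toVal, Val.size, leaves]
    omega

theorem size_toVal_le (t : XiTree) : t.toVal.size ≤ 16 * t.weight + 6 * t.lines.length := by
  induction t with
  | leaf e => simp [toVal, Val.size, weight, lines]
  | node n m T l r ihl ihr =>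
    have := T.size_toVal_le
    simp only [toVal, Val.size, weight, lines, List.length_append]
    omega

theorem Full.length_le (hF : IsPseudoLines F) (h : t.Full F) : t.lines.length ≤ F.ncard := by
  classical
  have hn : t.lines.Nodup := h.pairwise.imp fun hb => hb.ne
  rw [← List.toFinset_card_of_nodup hn, ← Set.ncard_coe_finset]
  refine Set.ncard_le_ncard (fun f hf => ?_) hF.1
  exact h.subset (List.mem_toFinset.1 hf)

theorem Correct.two_pow_le {lo hi : EReal} (h : t.Correct lo hi) :
    2 ^ ((t.height + 1) / 2) ≤ t.lines.length := by
  induction t generalizing lo hi with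
  | leaf e => simp [height, lines]
  | node n m T l r ihl ihr =>
    obtain ⟨h1, h2, h3, h4, h5, q, hq, hl, hr⟩ := h
    simp only [lines, List.length_append]
    exact two_pow_step (ihl hl) (ihr hr) h2 h3

theorem Full.height_le (hF : IsPseudoLines F) (h : t.Full F) :
    t.height ≤ 2 * Nat.log 2 (F.ncard + 2) :=
  le_two_mul_log h.correct.two_pow_le (h.length_le hF)

end XiTree

end Envelope

namespace Envelope

open EnvTree XiTree

/-! ### The operations on the structure `Ξ` -/

theorem Xi.Represents.full {E F : Set Curve} {t : XiTree} (h : Xi.Represents (some t) E)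
    (hE : E ⊆ F) : t.Full F :=
  ⟨h.1, h.2.2, h.2.1.subset.trans hE⟩

theorem XiTree.Full.represents {E F : Set Curve} {t : XiTree} (h : t.Full F)
    (hE : ∀ x, x ∈ t.lines ↔ x ∈ E) : Xi.Represents (some t) E :=
  ⟨h.pairwise, Set.ext hE, h.correct⟩

theorem one_le_log (n : ℕ) : 1 ≤ Nat.log 2 (n + 2) := Nat.le_log_of_pow_le (by omega) (by omega)

theorem log_succ_le (n : ℕ) : Nat.log 2 (n + 1 + 2) ≤ Nat.log 2 (n + 2) + 1 := by
  rw [← Nat.log_mul_base (by omega) (by omega)]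
  exact Nat.log_mono_right (by omega)

/-- Insertion works in a family of `n + 1` members. Its logarithm is at most `L + 1`, and `2(L + 1)
+ 1 ≤ 5L` for `L ≥ 1`; the product of the two factors is at most `25 L ^ 2`. -/
theorem bound_sq {d h L : ℕ} (hd : d ≤ 5 * L) (hh : h ≤ 5 * L) (hL : 1 ≤ L) :
    200000 * d * h + 100 ≤ 6000000 * L ^ 2 := by
  have h1 : d * h ≤ 5 * L * (5 * L) := Nat.mul_le_mul hd hh
  nlinarith

theorem exists_insert {E : Set Curve} {t : Xi} {e : Curve} (ht : t.Represents E) (he : e ∉ E)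
    (hE : IsPseudoLines (insert e E)) :
    ∃ t' : Xi, t'.Represents (insert e E) ∧
      RunsWithin prog 21 (.cons (.line e) t.toVal) t'.toVal
        (6000000 * Nat.log 2 (E.ncard + 2) ^ 2) := by
  have hL := one_le_log E.ncard
  have hcard : (insert e E).ncard = E.ncard + 1 :=
    Set.ncard_insert_of_notMem he (hE.1.subset (Set.subset_insert _ _))
  have hL' := log_succ_le E.ncard
  cases t with
  | none =>
    obtain rfl : E = ∅ := ht
    refine ⟨some (.leaf e), (full_leaf (Set.mem_insert e ∅)).represents fun x => by simp [lines],
      .of_wp insertCode rfl ⟨rfl, ?_⟩⟩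
    have := bound_sq (d := 0) (h := 0) (by omega) (by omega) hL
    omega
  | some t =>
    -- The old tree is viewed inside the enlarged family, so that one ambient family bounds every
    -- intermediate tree.
    have hfull := ht.full (Set.subset_insert e E)
    obtain ⟨t', h1, h2, -, -, h3⟩ := exists_insertInto hE (Set.mem_insert e E) _ rfl hfull
      fun h => he (ht.2.1 ▸ h)
    refine ⟨some t', h1.represents fun x => ?_, .of_wp insertCode rfl ?_⟩
    · rw [h2, Set.mem_insert_iff, ← ht.2.1]
      rfl
    have hh := hfull.height_le hE
    rw [hcard] at hh h3
    have := bound_sq (d := 2 * Nat.log 2 (E.ncard + 1 + 2) + 1) (h := t.height + 1) (by omega)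
      (by omega) hL
    cases t <;>
    · refine CallRun.intro h3 fun t ht => ?_
      exact ⟨rfl, by omega⟩

theorem exists_delete_xi {E : Set Curve} {t : Xi} {e : Curve} (ht : t.Represents E) (he : e ∈ E)
    (hE : IsPseudoLines E) :
    ∃ t' : Xi, t'.Represents (E \ {e}) ∧
      RunsWithin prog 22 (.cons (.line e) t.toVal) t'.toVal
        (6000000 * Nat.log 2 (E.ncard + 2) ^ 2) := by
  have hL := one_le_log E.ncard
  cases t with
  | none =>
    obtain rfl : E = ∅ := ht
    exact he.elim
  | some t =>
    have hfull := ht.full subset_rfl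
    have hmem : ∀ x, x ∈ t.lines ↔ x ∈ E := fun x => ht.2.1 ▸ Iff.rfl
    obtain ⟨t', h1, h2, h3⟩ := exists_delete hE _ rfl hfull ((hmem e).2 he)
    have hh := hfull.height_le hE
    refine ⟨t', ?_, h3.mono ?_⟩
    · cases t' with
      | none =>
        have hl := (h2 rfl).1
        refine Set.sdiff_eq_empty.2 fun x hx => ?_
        have := (hmem x).2 hx
        rwa [hl, List.mem_singleton] at this
      | some u =>
        obtain ⟨g1, g2, -⟩ := h1 u rfl
        refine g1.represents fun x => ?_
        rw [g2, hmem, Set.mem_sdiff, Set.mem_singleton_iff, and_comm]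
    · have := bound_sq (d := 2 * Nat.log 2 (E.ncard + 2) + 1) (h := t.height + 1) (by omega)
        (by omega) hL
      exact (Nat.le_add_right _ 100).trans this

theorem exists_shoot {E : Set Curve} {t : Xi} (x : ℝ) (ht : t.Represents E)
    (hE : IsPseudoLines E) :
    ∃ ans : List Curve, ans.Nodup ∧ (∀ e, e ∈ ans ↔ HitAt E x e) ∧
      RunsWithin prog 24 (.cons (.coord (x : EReal)) t.toVal) (linesVal ans)
        (6000000 * Nat.log 2 (E.ncard + 2)) := by
  have hL := one_le_log E.ncard
  cases t with
  | none =>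
    obtain rfl : E = ∅ := ht
    refine ⟨[], List.nodup_nil, fun e => ⟨fun h => by simp at h, ?_⟩,
      .of_wp shootCode rfl ⟨rfl, by omega⟩⟩
    rintro ⟨s, hs, σ, hσ, -⟩
    exact (hs.1 σ hσ).1.elim
  | some t =>
    have hfull := ht.full subset_rfl
    have henv := hfull.env
    have hh := hfull.height_env_le hE
    have hfam := ht.2.1
    rw [hfam] at henv
    obtain ⟨ans, h1, h2, h3, h4⟩ := exists_locate hE henv (EReal.bot_lt_coe x) (EReal.coe_lt_top x)
    refine ⟨ans, h1, fun e => ⟨fun he => ?_, ?_⟩, .of_wp shootCode rfl ?_⟩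
    · obtain ⟨σ, hσ, hσ'⟩ := h2 e he
      exact ⟨t.env.segs, henv.stores.2, σ, hσ, hσ'⟩
    · rintro ⟨s, hs, σ, hσ, rfl, hx, hx'⟩
      obtain ⟨g1, g2, g3⟩ := hs.1 σ hσ
      exact h3 _ g1 _ _ g2 hx hx' g3
    cases t <;>
    · refine CallRun.intro (runs_envOf _) fun t ht => ?_
      refine CallRun.intro h4 fun t ht => ?_
      exact ⟨rfl, by omega⟩

theorem exists_meet {A B : Set Curve} {S T : EnvTree} (hS : S.Stores A ⊥ ⊤)
    (hT : T.Stores B ⊥ ⊤) (hE : IsPseudoLines (A ∪ B)) (hAB : ∀ a ∈ A, ∀ b ∈ B, Below a b) :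
    ∃ q : ℝ, MeetAt A B q ∧
      RunsWithin prog 13 (.cons S.toVal T.toVal) (.coord (q : EReal))
        (6000000 * Nat.log 2 ((A ∪ B).ncard + 2)) := by
  have hL := one_le_log (A ∪ B).ncard
  have h : Separated A B := ⟨hE, ⟨_, hS.env.first_mem⟩, ⟨_, hT.env.first_mem⟩, hAB⟩
  obtain ⟨q, hq⟩ := h.exists_meetAt
  have h1 := Full.height_le_of_env hE Set.subset_union_left hS.env
  have h2 := Full.height_le_of_env hE Set.subset_union_right hT.env
  exact ⟨q, hq, (runs_meet h hq hS.env hT.env).mono (by omega)⟩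

theorem size_toVal_xi_le {E : Set Curve} {t : Xi} (ht : t.Represents E) (hE : IsPseudoLines E) :
    t.toVal.size ≤ 6000000 * (E.ncard + 1) := by
  cases t with
  | none =>
    simp only [Xi.toVal, Val.size]
    omega
  | some t =>
    have hfull := ht.full subset_rfl
    have h1 := weight_le hE _ rfl hfull
    have h2 := t.size_toVal_le
    have h3 := hfull.length_le hE
    simp only [Xi.toVal]
    omega

end Envelope

theorem mainTheorem3 :
    ∃ (P : Envelope.Program) (ins del qry meet : ℕ) (C : ℕ),
      -- the empty structure
      Envelope.Xi.Represents none ∅ ∧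
      -- insertion in time `O(log² n)`
      (∀ (E : Set Envelope.Curve) (t : Envelope.Xi) (e : Envelope.Curve),
        t.Represents E → e ∉ E → Envelope.IsPseudoLines (insert e E) →
        ∃ t' : Envelope.Xi, t'.Represents (insert e E) ∧
          Envelope.RunsWithin P ins (.cons (.line e) t.toVal) t'.toVal
            (C * Nat.log 2 (E.ncard + 2) ^ 2)) ∧
      -- deletion in time `O(log² n)`
      (∀ (E : Set Envelope.Curve) (t : Envelope.Xi) (e : Envelope.Curve),
        t.Represents E → e ∈ E → Envelope.IsPseudoLines E →
        ∃ t' : Envelope.Xi, t'.Represents (E \ {e}) ∧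
          Envelope.RunsWithin P del (.cons (.line e) t.toVal) t'.toVal
            (C * Nat.log 2 (E.ncard + 2) ^ 2)) ∧
      -- vertical ray shooting in time `O(log n)`
      (∀ (E : Set Envelope.Curve) (t : Envelope.Xi) (x₀ : ℝ),
        t.Represents E → Envelope.IsPseudoLines E →
        ∃ ans : List Envelope.Curve, ans.Nodup ∧ (∀ e, e ∈ ans ↔ Envelope.HitAt E x₀ e) ∧
          Envelope.RunsWithin P qry (.cons (.coord (x₀ : EReal)) t.toVal)
            (Envelope.linesVal ans) (C * Nat.log 2 (E.ncard + 2))) ∧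
      -- the intersection point of two lower envelopes in time `O(log n)`
      (∀ (A B : Set Envelope.Curve) (S T : Envelope.EnvTree),
        S.Stores A ⊥ ⊤ → T.Stores B ⊥ ⊤ → Envelope.IsPseudoLines (A ∪ B) →
        (∀ a ∈ A, ∀ b ∈ B, Envelope.Below a b) →
        ∃ q : ℝ, Envelope.MeetAt A B q ∧
          Envelope.RunsWithin P meet (.cons S.toVal T.toVal) (.coord (q : EReal))
            (C * Nat.log 2 ((A ∪ B).ncard + 2))) ∧
      -- storage `O(n)`
      (∀ (E : Set Envelope.Curve) (t : Envelope.Xi),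
        t.Represents E → Envelope.IsPseudoLines E →
        t.toVal.size ≤ C * (E.ncard + 1)) := by
  exact ⟨Envelope.prog, 21, 22, 24, 13, 6000000, rfl,
    fun _ _ _ => Envelope.exists_insert, fun _ _ _ => Envelope.exists_delete_xi,
    fun _ _ x => Envelope.exists_shoot x, fun _ _ _ _ => Envelope.exists_meet,
    fun _ _ => Envelope.size_toVal_xi_le⟩
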